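/- **Setting.** Let $d\ge 1$, $0<m<1$, and let $\|\cdot\|$, $\|\cdot\|_F$ be the Euclidean and Frobenius norms. Let $U:\mathbb R^d\to\mathbb R$ be twice continuously differentiable with minimum value $0$, attained at some point, and suppose there are constants $R,d_1,D_1,d_2,D_2,d_3,D_3,r>0$ such that for all $\|x\|\ge R$ $$d_1\|x\|^m\le U(x)\le D_1\|x\|^m,\qquad d_2\|x\|^{m-1}\le\|\nabla U(x)\|\le D_2\|x\|^{m-1},$$ $$\frac{\nabla U(x)}{\|\nabla U(x)\|}\cdot\frac{x}{\|x\|}\ge r,\qquad d_3\|x\|^{m-2}\le\|\nabla^2U(x)\|_F\le D_3\|x\|^{m-2}.$$ Let $\pi(dx)=Z^{-1}e^{-U(x)}dx$ with $Z=\int_{\mathbb R^d} e^{-U(x)}dx$. Fix $\lambda_*,\lambda^*>0$ and let $\mathcal Y$ be the set of symmetric $\gamma\in\mathbb R^{d\times d}$ with $\lambda_*I\le\gamma\le\lambda^*I$. Fix $\sigma,\rho>0$ and let $g(\xi)\propto e^{-\|\xi\|^2/(2\sigma^2)}1_{\{\|\xi\|\le\rho\}}$ be the centered isotropic Gaussian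 density truncated to a closed ball. With $a(x,y)=e^{U(x)-U(y)}\wedge1$, the random-walk Metropolis kernels are, for $\gamma\in\mathcal Y$, $$P_\gamma(x,A)=\int 1_A(x+\gamma^{1/2}\xi)\,a(x,x+\gamma^{1/2}\xi)\,g(\xi)\,d\xi+\delta_x(A)\Big(1-\int a(x,x+\gamma^{1/2}\xi)\,g(\xi)\,d\xi\Big).$$ An adaptation plan $\mathcal Q=(\mathcal Q_t)_{t\ge1}$ is a sequence of Borel probability kernels $\mathcal Q_t$ from $(\mathcal Y\times\mathbb R^d)^t$ to $\mathcal Y$. The adaptive process $(\Gamma_t,X_t)_{t\ge0}$ starts at $(\Gamma_0,X_0)=(\gamma_0,x_0)\in\mathcal Y\times\mathbb R^d$; at each $t\ge1$, given the past, $\Gamma_t\sim\mathcal Q_t((\Gamma_s,X_s)_{s<t},\cdot)$, and then $X_t\sim P_{\Gamma_t}(X_{t-1},\cdot)$. Let $\mathcal A^{(t)}_{\mathcal Q}((\gamma_0,x_0),\cdot)$ be the law of $X_t$, and let $$\mathcal W_{\|\cdot\|\wedge1}(\mu,\nu)=\inf_{\xi}\int(\|x-y\|\wedge1)\,\xi(dx,dy),$$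 the infimum being over all couplings $\xi$ of $\mu$ and $\nu$. For a strictly decreasing $G:\{0,1,2,\dots\}\to(0,\infty)$ with $G(t)\to0$, write $(1/G)^{-1}(y)=\min\{s\in\{0,1,2,\dots\}:1/G(s)\ge y\}$. **Statement.** There are constants $c_*,c^*,J^*>0$ (depending only on $d,m,U,\lambda_*,\lambda^*,\sigma,\rho$) and, for every $x_0\in\mathbb R^d$, constants $M_*,M^*>0$ (which may in addition depend on $x_0$) such that the following holds for all $\gamma_0\in\mathcal Y$, all adaptation plans $\mathcal Q$ and all strictly decreasing $G:\{0,1,2,\dots\}\to(0,\infty)$ with $G(t)\to0$. If, for the adaptive process started at $(\gamma_0,x_0)$, $$\lim_{t\to\infty}\frac{\|\Gamma_{t+1}-\Gamma_t\|_F}{G(t)}=0\quad\text{almost surely},$$ then for every $\epsilon\in(0,1)$ there is an integer $S_\epsilon\ge0$ such that for all integers $t\ge0$, with $T_{\epsilon,t}=S_\epsilon+(1/G)^{-1}(J^*t^2/\epsilon)$, $$M_*\exp\!\big[-c_*(T_{\epsilon,t}+t)^{\frac m{2-m}}\big]\le\mathcal W_{\|\cdot\|\wedge1}\big(\mathcal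 A_{\mathcal Q}^{(T_{\epsilon,t}+t)}((\gamma_0,x_0),\cdot),\pi\big)\le M^*\,T_{\epsilon,t}\exp\!\big[-c^*t^{\frac m{2-m}}\big]+\epsilon .$$ -/

import Mathlib

open MeasureTheory ProbabilityTheory Filter Topology Set
open scoped ENNReal

namespace AdaptiveRWM

noncomputable section

/-- The state space `ℝᵈ` with the Euclidean norm. -/
abbrev E (d : ℕ) : Type := EuclideanSpace ℝ (Fin d)

/-- Real `d × d` matrices carry their Borel sigma-algebra. -/
instance instMeasurableSpaceMatrix (d : ℕ) : MeasurableSpace (Matrix (Fin d) (Fin d) ℝ) := borel _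

instance instBorelSpaceMatrix (d : ℕ) : BorelSpace (Matrix (Fin d) (Fin d) ℝ) := ⟨rfl⟩

/-- The Frobenius norm of a real square matrix. -/
def frobNorm {d : ℕ} (A : Matrix (Fin d) (Fin d) ℝ) : ℝ :=
  Real.sqrt (∑ i, ∑ j, A i j ^ 2)

/-- The Hessian matrix of `U` at `x`: its entries are the second partial derivatives. -/
def hessian {d : ℕ} (U : E d → ℝ) (x : E d) : Matrix (Fin d) (Fin d) ℝ :=
  Matrix.of fun i j =>
    iteratedFDeriv ℝ 2 U x ![EuclideanSpace.single i (1 : ℝ), EuclideanSpace.single j (1 : ℝ)]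

/-- Regularity of the potential `U` of the target: `U` is `C²` with minimal value `0`, and outside
some ball `U`, its gradient and its Hessian grow like the powers `m`, `m - 1`, `m - 2` of the norm,
while the direction of the gradient has a radial component bounded below. -/
structure Regularity {d : ℕ} (m : ℝ) (U : E d → ℝ) : Prop where
  contDiff : ContDiff ℝ 2 U
  exists_min : ∃ xmin, U xmin = 0 ∧ ∀ x, U xmin ≤ U x
  growth : ∃ R > 0, ∃ d₁ > 0, ∃ D₁ > 0, ∃ d₂ > 0, ∃ D₂ > 0, ∃ d₃ > 0, ∃ D₃ > 0, ∃ r > 0,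
    ∀ x : E d, R ≤ ‖x‖ →
      (d₁ * ‖x‖ ^ m ≤ U x ∧ U x ≤ D₁ * ‖x‖ ^ m) ∧
      (d₂ * ‖x‖ ^ (m - 1) ≤ ‖gradient U x‖ ∧ ‖gradient U x‖ ≤ D₂ * ‖x‖ ^ (m - 1)) ∧
      r ≤ inner ℝ (‖gradient U x‖⁻¹ • gradient U x) (‖x‖⁻¹ • x) ∧
      (d₃ * ‖x‖ ^ (m - 2) ≤ frobNorm (hessian U x) ∧
        frobNorm (hessian U x) ≤ D₃ * ‖x‖ ^ (m - 2))

/-- The data of a random-walk Metropolis family on `ℝᵈ`: the potential `U` of the target, the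
bounds on the eigenvalues of the tuning matrices, and the standard deviation and the truncation
radius of the Gaussian proposal. -/
structure Model (d : ℕ) where
  U : E d → ℝ
  continuous_U : Continuous U
  lamMin : ℝ
  lamMax : ℝ
  lamMin_pos : 0 < lamMin
  lamMax_pos : 0 < lamMax
  sigma : ℝ
  sigma_pos : 0 < sigma
  rho : ℝ
  rho_pos : 0 < rho

variable {d : ℕ}

namespace Model

/-- The measure `exp(-U(x)) dx`. -/
def unnormalizedTarget (M : Model d) : Measure (E d) :=
  volume.withDensity fun x => ENNReal.ofReal (Real.exp (-M.U x))

/-- The target `π(dx) = Z⁻¹ exp(-U(x)) dx` with `Z = ∫ exp(-U(x)) dx`. -/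
def target (M : Model d) : Measure (E d) :=
  (M.unnormalizedTarget univ)⁻¹ • M.unnormalizedTarget

/-- The tuning parameter set: symmetric matrices `γ` with `lamMin I ≤ γ ≤ lamMax I` in the
Loewner order. -/
abbrev Param (M : Model d) : Type :=
  {γ : Matrix (Fin d) (Fin d) ℝ // γ.transpose = γ ∧
    (γ - M.lamMin • (1 : Matrix (Fin d) (Fin d) ℝ)).PosSemidef ∧
    (M.lamMax • (1 : Matrix (Fin d) (Fin d) ℝ) - γ).PosSemidef}

/-- The measure `exp(-‖ξ‖² / (2 sigma²)) dξ` restricted to the closed ball of radius `rho`. -/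
def unnormalizedProposal (M : Model d) : Measure (E d) :=
  (volume.restrict (Metric.closedBall 0 M.rho)).withDensity
    fun ξ => ENNReal.ofReal (Real.exp (-‖ξ‖ ^ 2 / (2 * M.sigma ^ 2)))

/-- The proposal `g(ξ) dξ`: a centered isotropic Gaussian conditioned to lie in the closed ball of
radius `rho` around the origin. -/
def proposal (M : Model d) : Measure (E d) :=
  (M.unnormalizedProposal univ)⁻¹ • M.unnormalizedProposal

/-- The Metropolis acceptance probability `a(x, y) = exp(U(x) - U(y)) ∧ 1`. -/
def accept (M : Model d) (x y : E d) : ℝ :=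
  min (Real.exp (M.U x - M.U y)) 1

end Model

open scoped MatrixOrder in
/-- The positive semidefinite square root of a positive semidefinite matrix. -/
def sqrtMat (γ : Matrix (Fin d) (Fin d) ℝ) : Matrix (Fin d) (Fin d) ℝ :=
  CFC.sqrt γ

namespace Model

/-- The proposed point `x + γ^{1/2} ξ`. -/
def move (M : Model d) (γ : M.Param) (x ξ : E d) : E d :=
  x + WithLp.toLp 2 ((sqrtMat γ.1).mulVec (WithLp.ofLp ξ))

open scoped MatrixOrder Matrix.Norms.L2Operator in
lemma continuous_sqrtMat (M : Model d) : Continuous fun γ : M.Param => sqrtMat γ.1 := by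
  refine CFC.continuousOn_sqrt.comp_continuous continuous_subtype_val ?_
  intro γ
  have h1 := γ.2.2.1
  have h2 : (M.lamMin • (1 : Matrix (Fin d) (Fin d) ℝ)).PosSemidef :=
    Matrix.PosSemidef.one.smul M.lamMin_pos.le
  have h3 := h1.add h2
  simp only [sub_add_cancel] at h3
  exact h3.nonneg

lemma continuous_move (M : Model d) :
    Continuous fun p : (M.Param × E d) × E d => M.move p.1.1 p.1.2 p.2 := by
  unfold move
  refine Continuous.add (by fun_prop) ?_
  refine (PiLp.continuous_toLp 2 _).comp ?_
  exact Continuous.matrix_mulVec (M.continuous_sqrtMat.comp (by fun_prop))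
    ((PiLp.continuous_ofLp 2 _).comp continuous_snd)

lemma measurable_move (M : Model d) :
    Measurable fun p : (M.Param × E d) × E d => M.move p.1.1 p.1.2 p.2 := by
  have : SecondCountableTopology (Matrix (Fin d) (Fin d) ℝ) :=
    inferInstanceAs (SecondCountableTopology (Fin d → Fin d → ℝ))
  exact M.continuous_move.measurable

/-- The acceptance probability of the proposed point `x + γ^{1/2} ξ`, as a number in `[0, ∞]`. -/
def acceptMove (M : Model d) (γ : M.Param) (x ξ : E d) : ℝ≥0∞ :=
  ENNReal.ofReal (M.accept x (M.move γ x ξ))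

lemma measurable_acceptMove (M : Model d) :
    Measurable fun p : (M.Param × E d) × E d => M.acceptMove p.1.1 p.1.2 p.2 := by
  have hU := M.continuous_U.measurable
  have hm := M.measurable_move
  unfold acceptMove accept
  refine ENNReal.measurable_ofReal.comp (Measurable.min ?_ measurable_const)
  exact Real.measurable_exp.comp ((hU.comp (by fun_prop)).sub (hU.comp hm))

instance isProbabilityMeasure_proposal (M : Model d) : IsProbabilityMeasure M.proposal := by
  have hmeas : Measurable fun ξ : E d =>
      ENNReal.ofReal (Real.exp (-‖ξ‖ ^ 2 / (2 * M.sigma ^ 2))) := by fun_prop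
  have h0 : M.unnormalizedProposal univ ≠ 0 := by
    unfold unnormalizedProposal
    rw [withDensity_apply _ MeasurableSet.univ, Measure.restrict_univ]
    intro h
    rw [lintegral_eq_zero_iff hmeas] at h
    have h' : ∀ᵐ ξ ∂(volume.restrict (Metric.closedBall (0 : E d) M.rho)), False := by
      filter_upwards [h] with ξ hξ
      have : (0 : ℝ≥0∞) < ENNReal.ofReal (Real.exp (-‖ξ‖ ^ 2 / (2 * M.sigma ^ 2))) :=
        ENNReal.ofReal_pos.2 (Real.exp_pos _)
      exact this.ne' hξ
    rw [Filter.eventually_false_iff_eq_bot, ae_eq_bot, Measure.restrict_eq_zero] at h'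
    exact (Metric.measure_closedBall_pos volume (0 : E d) M.rho_pos).ne' h'
  have h1 : M.unnormalizedProposal univ ≠ ∞ := by
    unfold unnormalizedProposal
    rw [withDensity_apply _ MeasurableSet.univ, Measure.restrict_univ]
    refine ne_top_of_le_ne_top
      (b := ∫⁻ _ in Metric.closedBall (0 : E d) M.rho, (1 : ℝ≥0∞) ∂volume) ?_ ?_
    · simpa using (measure_closedBall_lt_top (μ := volume) (x := (0 : E d)) (r := M.rho)).ne
    · refine lintegral_mono fun ξ => ?_
      rw [← ENNReal.ofReal_one]
      refine ENNReal.ofReal_le_ofReal (Real.exp_le_one_iff.2 ?_)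
      exact div_nonpos_of_nonpos_of_nonneg (by simp) (by positivity)
  exact ⟨by simp only [proposal, Measure.smul_apply, smul_eq_mul]; exact ENNReal.inv_mul_cancel h0 h1⟩

/-- The rejection probability `R_γ(x) = 1 - ∫ a(x, x + γ^{1/2} ξ) g(ξ) dξ`. -/
def rejectProb (M : Model d) (γ : M.Param) (x : E d) : ℝ≥0∞ :=
  1 - ∫⁻ ξ, M.acceptMove γ x ξ ∂M.proposal

/-- The law of one random-walk Metropolis step from `x` with tuning matrix `γ`:
`A ↦ ∫ 1_A(x + γ^{1/2} ξ) a(x, x + γ^{1/2} ξ) g(ξ) dξ + δ_x(A) R_γ(x)`. -/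
def stepMeasure (M : Model d) (γ : M.Param) (x : E d) : Measure (E d) :=
  (M.proposal.withDensity (M.acceptMove γ x)).map (M.move γ x)
    + M.rejectProb γ x • Measure.dirac x

lemma stepMeasure_apply (M : Model d) (γ : M.Param) (x : E d) {A : Set (E d)}
    (hA : MeasurableSet A) :
    M.stepMeasure γ x A
      = (∫⁻ ξ, A.indicator 1 (M.move γ x ξ) * M.acceptMove γ x ξ ∂M.proposal)
        + M.rejectProb γ x * A.indicator 1 x := by
  have hm : Measurable (M.move γ x) :=
    M.measurable_move.comp (f := fun ξ : E d => ((γ, x), ξ)) (by fun_prop)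
  rw [stepMeasure, Measure.add_apply, Measure.map_apply hm hA, Measure.smul_apply,
    Measure.dirac_apply' x hA, smul_eq_mul, withDensity_apply _ (hm hA),
    ← lintegral_indicator (hm hA)]
  congr 1
  refine lintegral_congr fun ξ => ?_
  by_cases h : M.move γ x ξ ∈ A
  · rw [indicator_of_mem (show ξ ∈ M.move γ x ⁻¹' A from h), indicator_of_mem h]
    simp
  · rw [indicator_of_notMem (show ξ ∉ M.move γ x ⁻¹' A from h), indicator_of_notMem h]
    simp

/-- The random-walk Metropolis family `(γ, x) ↦ P_γ(x, ·)`. -/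
def kernel (M : Model d) : Kernel (M.Param × E d) (E d) where
  toFun p := M.stepMeasure p.1 p.2
  measurable' := by
    refine Measure.measurable_of_measurable_coe _ fun A hA => ?_
    simp only [M.stepMeasure_apply _ _ hA, rejectProb]
    have hI : Measurable (A.indicator (1 : E d → ℝ≥0∞)) := measurable_one.indicator hA
    refine Measurable.add ?_ (Measurable.mul ?_ (hI.comp measurable_snd))
    · exact Measurable.lintegral_prod_right'
        (f := fun q : (M.Param × E d) × E d =>
          A.indicator 1 (M.move q.1.1 q.1.2 q.2) * M.acceptMove q.1.1 q.1.2 q.2)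
        ((hI.comp M.measurable_move).mul M.measurable_acceptMove)
    · exact measurable_const.sub (Measurable.lintegral_prod_right' M.measurable_acceptMove)

instance isMarkovKernel_kernel (M : Model d) : IsMarkovKernel M.kernel := by
  refine ⟨fun p => ⟨?_⟩⟩
  change M.stepMeasure p.1 p.2 univ = 1
  rw [M.stepMeasure_apply _ _ MeasurableSet.univ]
  simp only [indicator_univ, Pi.one_apply, one_mul, mul_one, rejectProb]
  refine add_tsub_cancel_of_le ?_
  calc ∫⁻ ξ, M.acceptMove p.1 p.2 ξ ∂M.proposal ≤ ∫⁻ _, 1 ∂M.proposal := by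
        refine lintegral_mono fun ξ => ?_
        rw [← ENNReal.ofReal_one]
        exact ENNReal.ofReal_le_ofReal (min_le_right _ _)
    _ = 1 := by simp

end Model

/-- An adaptation plan: for every `n` a Markov kernel giving the conditional law of the tuning
parameter at time `n + 1` given the whole history `(Γ₀, X₀), …, (Γₙ, Xₙ)`. -/
structure AdaptationPlan (M : Model d) where
  kernel : (n : ℕ) → Kernel ((_ : Finset.Iic n) → M.Param × E d) M.Param
  isMarkovKernel : ∀ n, IsMarkovKernel (kernel n)

namespace AdaptationPlan

variable {M : Model d}

instance instIsMarkovKernelKernel (Q : AdaptationPlan M) (n : ℕ) : IsMarkovKernel (Q.kernel n) :=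
  Q.isMarkovKernel n

/-- From a history up to time `n` and a new tuning parameter `γ` keep `(γ, Xₙ)`. -/
def paramState (M : Model d) (n : ℕ)
    (p : ((_ : Finset.Iic n) → M.Param × E d) × M.Param) : M.Param × E d :=
  (p.2, (p.1 ⟨n, Finset.mem_Iic.2 le_rfl⟩).2)

lemma measurable_paramState (M : Model d) (n : ℕ) : Measurable (paramState M n) := by
  unfold paramState
  fun_prop

/-- One step of the adaptive process given the history up to time `n`: first draw `Γ_{n+1}` from
the plan, then draw `X_{n+1}` from `P_{Γ_{n+1}}(Xₙ, ·)`. -/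
def step (Q : AdaptationPlan M) (n : ℕ) :
    Kernel ((_ : Finset.Iic n) → M.Param × E d) (M.Param × E d) :=
  (Q.kernel n) ⊗ₖ (M.kernel.comap (paramState M n) (measurable_paramState M n))

instance instIsMarkovKernelStep (Q : AdaptationPlan M) (n : ℕ) : IsMarkovKernel (Q.step n) := by
  unfold step
  infer_instance

/-- The law of the whole adaptive process `(Γₜ, Xₜ)ₜ` started at `(γ₀, x₀)`, on the space of
sequences in `Param × ℝᵈ`. -/
def law (Q : AdaptationPlan M) (γ₀ : M.Param) (x₀ : E d) : Measure (ℕ → M.Param × E d) :=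
  Kernel.traj (X := fun _ => M.Param × E d) Q.step 0 (fun _ => (γ₀, x₀))

/-- The marginal law of `Xₜ` for the adaptive process started at `(γ₀, x₀)`. -/
def marginal (Q : AdaptationPlan M) (γ₀ : M.Param) (x₀ : E d) (t : ℕ) : Measure (E d) :=
  (Q.law γ₀ x₀).map fun ω => (ω t).2

end AdaptationPlan

/-- Couplings of two measures. -/
def couplings (μ ν : Measure (E d)) : Set (Measure (E d × E d)) :=
  {ξ | ξ.map Prod.fst = μ ∧ ξ.map Prod.snd = ν}

/-- The Wasserstein distance for the cost `‖x - y‖ ∧ 1`: the infimum of the expected cost over all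
couplings. -/
def wasserstein (μ ν : Measure (E d)) : ℝ :=
  sInf ((fun ξ : Measure (E d × E d) => ∫ p, min ‖p.1 - p.2‖ 1 ∂ξ) '' couplings μ ν)

/-- The inverse of the increasing function `1 / G` on the natural numbers: the least `s` with
`1 / G s ≥ y`. -/
def invRecip (G : ℕ → ℝ) (y : ℝ) : ℕ :=
  sInf {s : ℕ | y ≤ 1 / G s}

end

end AdaptiveRWM

/-! ### Frobenius norm and square roots of the tuning matrices -/

namespace AdaptiveRWM

variable {d : ℕ}

/-! Write β = m/(2-m) and V = exp(sU). The upper bound combines a convergence rate for the chain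
with frozen tuning matrix, uniform over the matrices, with a perturbation argument. The lower bound
compares tails.

Frozen chain. A second order expansion over the opposite moves ±ξ cancels the first order change of
U. Accepting downhill moves more readily than uphill ones leaves a gain of order ‖∇U‖². Hence V
drifts down by at least c V (1+‖x‖)^(2(m-1)), up to a constant (`exists_drift`). An iterate of the
kernel is minorized on a large ball (`exists_pow_lower`), and `exists_driftMinorization` joins the
two facts. On the region V ≤ exp(s t^β) one has ‖x‖ = O(t^(1/(2-m))), so the relative drift is at
least of order t^(β-1). Over about t steps this contracts by exp(-c t^β). The region above that
level is charged to a leak V²/exp(s t^β), which after t steps is again stretched-exponentially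
small. This is `DriftMinorization.iterate`, turned into a rate in `exists_frozen_convergence` and,
through invariance of the target, in `exists_frozen_convergence_target`.

Perturbation. The kernels are Lipschitz in the tuning matrix in total variation, uniformly in the
state (`exists_kernel_lipschitz`). If every increment after time T is at most G, the parameter at
time T+k is within k G(T) of the one at time T. Exchanging frozen steps for adaptive ones, one at a
time, therefore costs O(t² G(T)) in total (`exists_adaptive_comparison`). The definition of T makes
this at most ε/2, and diminishing adaptation bounds the exceptional event by another ε/2. The
expectation of V at time T grows at most linearly in T, which is where the prefactor T comes from. A
setwise bound becomes a Wasserstein bound through a maximal coupling.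

Lower bound. The target has tail at least p exp(-D r^m). For a large exponent s the moment of
exp(sU) under the adaptive chain at time n is at most of order exp(A n^β) (`exists_moment_growth`).
At radius r proportional to n^(1/(2-m)) Markov's inequality makes the chain's tail negligible
against that of the target once n is large. For the remaining n, bounded step lengths confine the
chain to a fixed ball. -/

lemma frobNorm_nonneg (A : Matrix (Fin d) (Fin d) ℝ) : 0 ≤ frobNorm A := Real.sqrt_nonneg _

lemma frobNorm_sub_comm (A B : Matrix (Fin d) (Fin d) ℝ) : frobNorm (A - B) = frobNorm (B - A) := by
  unfold frobNorm
  congr 1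
  refine Finset.sum_congr rfl fun i _ => Finset.sum_congr rfl fun j _ => ?_
  simp only [Matrix.sub_apply]
  ring

/-- The Frobenius norm dominates the Euclidean operator norm. -/
lemma norm_mulVec_le_frobNorm (A : Matrix (Fin d) (Fin d) ℝ) (u : E d) :
    ‖A.toEuclideanLin u‖ ≤ frobNorm A * ‖u‖ := by
  rw [EuclideanSpace.norm_eq, EuclideanSpace.norm_eq, frobNorm, ← Real.sqrt_mul (by positivity)]
  refine Real.sqrt_le_sqrt ?_
  rw [Finset.sum_mul]
  refine Finset.sum_le_sum fun i _ => ?_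
  simp only [Real.norm_eq_abs, sq_abs, Matrix.toLpLin_apply, Matrix.mulVec, dotProduct]
  exact Finset.sum_mul_sq_le_sq_mul_sq _ _ _

lemma frobNorm_eq_norm (A : Matrix (Fin d) (Fin d) ℝ) :
    frobNorm A = ‖(WithLp.toLp 2 (Function.uncurry A) : EuclideanSpace ℝ (Fin d × Fin d))‖ := by
  simp only [EuclideanSpace.norm_eq, frobNorm, Fintype.sum_prod_type, Function.uncurry,
    Real.norm_eq_abs, sq_abs]

lemma frobNorm_add_le (A B : Matrix (Fin d) (Fin d) ℝ) :
    frobNorm (A + B) ≤ frobNorm A + frobNorm B := by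
  simp only [frobNorm_eq_norm]
  exact norm_add_le (WithLp.toLp 2 (Function.uncurry A) : EuclideanSpace ℝ (Fin d × Fin d))
    (WithLp.toLp 2 (Function.uncurry B))

namespace Model

variable (M : Model d)

/-- The square root of a tuning matrix as a linear endomorphism of the state space. -/
noncomputable def scale (γ : M.Param) : E d →ₗ[ℝ] E d := (sqrtMat γ.1).toEuclideanLin

lemma move_eq (γ : M.Param) (x ξ : E d) : M.move γ x ξ = x + M.scale γ ξ := rfl

open scoped MatrixOrder in
lemma posSemidef_param (γ : M.Param) : γ.1.PosSemidef := by
  have h2 : (M.lamMin • (1 : Matrix (Fin d) (Fin d) ℝ)).PosSemidef :=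
    Matrix.PosSemidef.one.smul M.lamMin_pos.le
  simpa only [sub_add_cancel] using γ.2.2.1.add h2

open scoped MatrixOrder Matrix.Norms.L2Operator in
lemma sqrtMat_mul_self (γ : M.Param) : sqrtMat γ.1 * sqrtMat γ.1 = γ.1 :=
  CFC.sqrt_mul_sqrt_self _ (M.posSemidef_param γ).nonneg

open scoped MatrixOrder Matrix.Norms.L2Operator in
lemma isHermitian_sqrtMat (γ : M.Param) : (sqrtMat γ.1).IsHermitian :=
  (Matrix.nonneg_iff_posSemidef.1 (CFC.sqrt_nonneg γ.1)).isHermitian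

lemma inner_scale_left (γ : M.Param) (u v : E d) :
    inner ℝ (M.scale γ u) v = inner ℝ u (M.scale γ v) :=
  Matrix.isSymmetric_toEuclideanLin_iff.2 (M.isHermitian_sqrtMat γ) u v

lemma scale_scale (γ : M.Param) (u : E d) :
    M.scale γ (M.scale γ u) = γ.1.toEuclideanLin u := by
  rw [← M.sqrtMat_mul_self γ]
  simp [scale, Matrix.toLpLin_apply, Matrix.mulVec_mulVec]

lemma norm_scale_sq (γ : M.Param) (u : E d) :
    ‖M.scale γ u‖ ^ 2 = inner ℝ u (γ.1.toEuclideanLin u) := by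
  rw [← real_inner_self_eq_norm_sq, inner_scale_left, scale_scale]

lemma inner_toEuclideanLin_nonneg {A : Matrix (Fin d) (Fin d) ℝ} (hA : A.PosSemidef) (u : E d) :
    0 ≤ inner ℝ u (A.toEuclideanLin u) := by
  have := (Matrix.isPositive_toEuclideanLin_iff.2 hA).inner_nonneg_right u
  simpa using this

lemma norm_scale_sq_ge (γ : M.Param) (u : E d) : M.lamMin * ‖u‖ ^ 2 ≤ ‖M.scale γ u‖ ^ 2 := by
  have h := inner_toEuclideanLin_nonneg γ.2.2.1 u
  rw [norm_scale_sq, ← sub_nonneg]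
  simpa [inner_sub_right, inner_smul_right, real_inner_self_eq_norm_sq] using h

lemma norm_scale_sq_le (γ : M.Param) (u : E d) : ‖M.scale γ u‖ ^ 2 ≤ M.lamMax * ‖u‖ ^ 2 := by
  have h := inner_toEuclideanLin_nonneg γ.2.2.2 u
  rw [norm_scale_sq, ← sub_nonneg]
  simpa [inner_sub_right, inner_smul_right, real_inner_self_eq_norm_sq] using h

lemma norm_scale_le (γ : M.Param) (u : E d) : ‖M.scale γ u‖ ≤ √M.lamMax * ‖u‖ := by
  refine le_of_sq_le_sq ?_ (by positivity)
  rw [mul_pow, Real.sq_sqrt M.lamMax_pos.le]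
  exact M.norm_scale_sq_le γ u

lemma norm_scale_ge (γ : M.Param) (u : E d) : √M.lamMin * ‖u‖ ≤ ‖M.scale γ u‖ := by
  refine le_of_sq_le_sq ?_ (by positivity)
  rw [mul_pow, Real.sq_sqrt M.lamMin_pos.le]
  exact M.norm_scale_sq_ge γ u

lemma scale_injective (γ : M.Param) : Function.Injective (M.scale γ) := by
  rw [← LinearMap.ker_eq_bot, LinearMap.ker_eq_bot']
  intro u hu
  have h := M.norm_scale_ge γ u
  rw [hu, norm_zero] at h
  have := Real.sqrt_pos.2 M.lamMin_pos
  exact norm_le_zero_iff.1 (by nlinarith [norm_nonneg u])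

/-- The square root of a tuning matrix as a linear equivalence. -/
noncomputable def scaleEquiv (γ : M.Param) : E d ≃L[ℝ] E d :=
  (LinearEquiv.ofInjectiveEndo (M.scale γ) (M.scale_injective γ)).toContinuousLinearEquiv

@[simp] lemma scaleEquiv_apply (γ : M.Param) (u : E d) : M.scaleEquiv γ u = M.scale γ u := rfl

@[simp] lemma scale_scaleEquiv_symm (γ : M.Param) (z : E d) :
    M.scale γ ((M.scaleEquiv γ).symm z) = z := (M.scaleEquiv γ).apply_symm_apply z

/-- The squared norms of the inverse scalings of a point are comparable, with relative error
proportional to the distance of the tuning matrices. -/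
lemma norm_scaleEquiv_symm_sq_le (γ γ' : M.Param) (z : E d) :
    ‖(M.scaleEquiv γ').symm z‖ ^ 2 ≤
      (1 + M.lamMax / M.lamMin ^ 2 * frobNorm (γ.1 - γ'.1)) * ‖(M.scaleEquiv γ).symm z‖ ^ 2 := by
  set w := (M.scaleEquiv γ).symm z with hw
  set w' := (M.scaleEquiv γ').symm z with hw'
  have hz : M.scale γ w = z := by simp [hw]
  have hz' : M.scale γ' w' = z := by simp [hw']
  set a := (M.scaleEquiv γ).symm w with ha
  set a' := (M.scaleEquiv γ').symm w' with ha'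
  have hwa : M.scale γ a = w := by simp [ha]
  have hwa' : M.scale γ' a' = w' := by simp [ha']
  have hga : γ.1.toEuclideanLin a = z := by rw [← scale_scale, hwa, hz]
  have hga' : γ'.1.toEuclideanLin a' = z := by rw [← scale_scale, hwa', hz']
  have e1 : ‖w‖ ^ 2 = inner ℝ a z := by rw [← hwa, norm_scale_sq, hga]
  have e2 : ‖w'‖ ^ 2 = inner ℝ a' z := by rw [← hwa', norm_scale_sq, hga']
  have sym : ∀ (γ : M.Param) (u v : E d),
      inner ℝ (γ.1.toEuclideanLin u) v = inner ℝ u (γ.1.toEuclideanLin v) := by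
    intro γ u v
    rw [← scale_scale, ← scale_scale, inner_scale_left, inner_scale_left]
  -- This is the resolvent identity γ'⁻¹ - γ⁻¹ = γ'⁻¹(γ - γ')γ⁻¹ tested on z, with a = γ⁻¹z and a' =
  -- γ'⁻¹z. Working with squared norms avoids any perturbation estimate for the square roots.
  have e3 : ‖w'‖ ^ 2 - ‖w‖ ^ 2 = inner ℝ a' ((γ.1 - γ'.1).toEuclideanLin a) := by
    rw [map_sub, LinearMap.sub_apply, inner_sub_right, hga, ← sym γ' a' a, hga', e1, e2,
      real_inner_comm z a]
  have hn : ∀ (γ : M.Param) (u : E d), M.lamMin * ‖u‖ ≤ ‖M.scale γ (M.scale γ u)‖ := by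
    intro γ u
    have h1 := M.norm_scale_ge γ (M.scale γ u)
    have h2 := M.norm_scale_ge γ u
    calc M.lamMin * ‖u‖ = √M.lamMin * (√M.lamMin * ‖u‖) := by
          rw [← mul_assoc, Real.mul_self_sqrt M.lamMin_pos.le]
      _ ≤ √M.lamMin * ‖M.scale γ u‖ := by gcongr
      _ ≤ _ := h1
  have n1 : ‖a‖ ≤ ‖z‖ / M.lamMin := by
    rw [le_div_iff₀ M.lamMin_pos, mul_comm]
    simpa [hwa, hz] using hn γ a
  have n2 : ‖a'‖ ≤ ‖z‖ / M.lamMin := by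
    rw [le_div_iff₀ M.lamMin_pos, mul_comm]
    simpa [hwa', hz'] using hn γ' a'
  have n3 : ‖z‖ ^ 2 ≤ M.lamMax * ‖w‖ ^ 2 := by
    rw [← hz]; exact M.norm_scale_sq_le γ w
  have hF := frobNorm_nonneg (γ.1 - γ'.1)
  have hl := M.lamMin_pos
  have e4 : ‖w'‖ ^ 2 - ‖w‖ ^ 2 ≤ M.lamMax / M.lamMin ^ 2 * frobNorm (γ.1 - γ'.1) * ‖w‖ ^ 2 := by
    calc ‖w'‖ ^ 2 - ‖w‖ ^ 2 ≤ ‖a'‖ * ‖(γ.1 - γ'.1).toEuclideanLin a‖ := by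
          rw [e3]; exact real_inner_le_norm _ _
      _ ≤ (‖z‖ / M.lamMin) * (frobNorm (γ.1 - γ'.1) * (‖z‖ / M.lamMin)) := by
          gcongr
          exact (norm_mulVec_le_frobNorm _ _).trans (by gcongr)
      _ = frobNorm (γ.1 - γ'.1) / M.lamMin ^ 2 * ‖z‖ ^ 2 := by field_simp
      _ ≤ frobNorm (γ.1 - γ'.1) / M.lamMin ^ 2 * (M.lamMax * ‖w‖ ^ 2) := by gcongr
      _ = _ := by field_simp
  linarith

end Model

end AdaptiveRWM

/-! ### The proposal law and integrals against one Metropolis step -/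

namespace AdaptiveRWM

variable {d : ℕ}

namespace Model

variable (M : Model d)

/-- The unnormalized density of the proposal. -/
noncomputable def proposalWeight (ξ : E d) : ℝ≥0∞ :=
  (Metric.closedBall (0 : E d) M.rho).indicator
    (fun ξ => ENNReal.ofReal (Real.exp (-‖ξ‖ ^ 2 / (2 * M.sigma ^ 2)))) ξ

lemma measurable_proposalWeight : Measurable M.proposalWeight :=
  Measurable.indicator (by fun_prop) measurableSet_closedBall

lemma proposalWeight_congr {ξ ξ' : E d} (h : ‖ξ‖ = ‖ξ'‖) :
    M.proposalWeight ξ = M.proposalWeight ξ' := by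
  simp [proposalWeight, indicator, h]

lemma proposalWeight_le_one (ξ : E d) : M.proposalWeight ξ ≤ 1 := by
  unfold proposalWeight
  refine (indicator_le_self _ _ ξ).trans ?_
  rw [← ENNReal.ofReal_one]
  exact ENNReal.ofReal_le_ofReal (Real.exp_le_one_iff.2
    (div_nonpos_of_nonpos_of_nonneg (by simp) (by positivity)))

lemma le_proposalWeight {ξ : E d} (h : ‖ξ‖ ≤ M.rho) :
    ENNReal.ofReal (Real.exp (-M.rho ^ 2 / (2 * M.sigma ^ 2))) ≤ M.proposalWeight ξ := by
  rw [proposalWeight, indicator_of_mem (by simpa using h)]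
  have := M.sigma_pos
  gcongr

lemma proposalWeight_eq_zero {ξ : E d} (h : M.rho < ‖ξ‖) : M.proposalWeight ξ = 0 := by
  rw [proposalWeight, indicator_of_notMem (by simpa using h)]

lemma proposal_eq : M.proposal =
    (M.unnormalizedProposal univ)⁻¹ • volume.withDensity M.proposalWeight := by
  rw [proposal]
  congr 1
  exact (withDensity_indicator measurableSet_closedBall _).symm

lemma inv_unnormalizedProposal_ne :
    (M.unnormalizedProposal univ)⁻¹ ≠ 0 ∧ (M.unnormalizedProposal univ)⁻¹ ≠ ∞ := by
  have h : M.proposal univ = 1 := measure_univ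
  simp only [proposal, Measure.smul_apply, smul_eq_mul] at h
  constructor
  · intro h0
    simp [h0] at h
  · intro h0
    rw [h0] at h
    by_cases h1 : M.unnormalizedProposal univ = 0
    · simp [h1] at h
    · simp [ENNReal.top_mul h1] at h

lemma lintegral_proposal {f : E d → ℝ≥0∞} (hf : Measurable f) :
    ∫⁻ ξ, f ξ ∂M.proposal
      = (M.unnormalizedProposal univ)⁻¹ * ∫⁻ ξ, M.proposalWeight ξ * f ξ := by
  rw [proposal_eq, lintegral_smul_measure, smul_eq_mul,
    lintegral_withDensity_eq_lintegral_mul _ M.measurable_proposalWeight hf]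
  rfl

lemma lintegral_proposal_neg {f : E d → ℝ≥0∞} (hf : Measurable f) :
    ∫⁻ ξ, f (-ξ) ∂M.proposal = ∫⁻ ξ, f ξ ∂M.proposal := by
  rw [M.lintegral_proposal hf, M.lintegral_proposal (f := fun ξ => f (-ξ)) (by fun_prop),
    ← lintegral_neg_eq_self (fun ξ => M.proposalWeight ξ * f ξ)]
  simp_rw [M.proposalWeight_congr (norm_neg _)]

lemma ae_norm_le_proposal : ∀ᵐ ξ ∂M.proposal, ‖ξ‖ ≤ M.rho := by
  rw [proposal_eq]
  refine Measure.ae_smul_measure ?_ _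
  rw [ae_withDensity_iff M.measurable_proposalWeight]
  refine Eventually.of_forall fun ξ h => ?_
  by_contra h'
  exact h (M.proposalWeight_eq_zero (not_le.1 h'))

/-- The proposal dominates a multiple of Lebesgue measure on its support. -/
lemma exists_proposal_lower : ∃ p : ℝ≥0∞, p ≠ 0 ∧ p ≠ ∞ ∧ ∀ f : E d → ℝ≥0∞, Measurable f →
    p * ∫⁻ ξ in Metric.closedBall 0 M.rho, f ξ ≤ ∫⁻ ξ, f ξ ∂M.proposal := by
  obtain ⟨h0, h1⟩ := M.inv_unnormalizedProposal_ne
  refine ⟨(M.unnormalizedProposal univ)⁻¹ *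
    ENNReal.ofReal (Real.exp (-M.rho ^ 2 / (2 * M.sigma ^ 2))), ?_, ?_, fun f hf => ?_⟩
  · exact mul_ne_zero h0 (ENNReal.ofReal_pos.2 (Real.exp_pos _)).ne'
  · exact ENNReal.mul_ne_top h1 ENNReal.ofReal_ne_top
  · rw [M.lintegral_proposal hf, mul_assoc, ← lintegral_indicator measurableSet_closedBall,
      ← lintegral_const_mul _ (hf.indicator measurableSet_closedBall)]
    refine mul_le_mul_right (lintegral_mono fun ξ => ?_) _
    by_cases h : ξ ∈ Metric.closedBall (0 : E d) M.rho
    · rw [indicator_of_mem h]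
      gcongr
      exact M.le_proposalWeight (by simpa using h)
    · rw [indicator_of_notMem h]
      simp

lemma measurable_move_right (γ : M.Param) (x : E d) : Measurable (M.move γ x) :=
  M.measurable_move.comp (f := fun ξ : E d => ((γ, x), ξ)) (by fun_prop)

lemma measurable_acceptMove_right (γ : M.Param) (x : E d) : Measurable (M.acceptMove γ x) :=
  M.measurable_acceptMove.comp (f := fun ξ : E d => ((γ, x), ξ)) (by fun_prop)

lemma acceptMove_le_one (γ : M.Param) (x ξ : E d) : M.acceptMove γ x ξ ≤ 1 := by
  rw [← ENNReal.ofReal_one]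
  exact ENNReal.ofReal_le_ofReal (min_le_right _ _)

/-- The rejection probability is the proposal integral of one minus the acceptance, so the atom at
the current state can be absorbed into a single integral over the proposal. -/
lemma lintegral_kernel (γ : M.Param) (x : E d) {h : E d → ℝ≥0∞} (hh : Measurable h) :
    ∫⁻ y, h y ∂M.kernel (γ, x)
      = ∫⁻ ξ, (h (M.move γ x ξ) * M.acceptMove γ x ξ + h x * (1 - M.acceptMove γ x ξ))
          ∂M.proposal := by
  have ha := M.measurable_acceptMove_right γ x
  have hm := M.measurable_move_right γ x
  have hr : M.rejectProb γ x = ∫⁻ ξ, (1 - M.acceptMove γ x ξ) ∂M.proposal := by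
    rw [lintegral_sub ha _ (Eventually.of_forall fun ξ => M.acceptMove_le_one γ x ξ)]
    · simp [rejectProb]
    · refine ne_top_of_le_ne_top ENNReal.one_ne_top ?_
      calc ∫⁻ ξ, M.acceptMove γ x ξ ∂M.proposal ≤ ∫⁻ _, 1 ∂M.proposal :=
            lintegral_mono fun ξ => M.acceptMove_le_one γ x ξ
        _ = 1 := by simp
  change ∫⁻ y, h y ∂M.stepMeasure γ x = _
  rw [stepMeasure, lintegral_add_measure, lintegral_map hh hm, lintegral_smul_measure,
    lintegral_dirac' _ hh, lintegral_withDensity_eq_lintegral_mul (g := fun ξ => h (M.move γ x ξ)) _ ha (hh.comp hm),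
    lintegral_add_left (f := fun ξ => h (M.move γ x ξ) * M.acceptMove γ x ξ) ((hh.comp hm).mul ha),
    lintegral_const_mul (f := fun ξ => 1 - M.acceptMove γ x ξ) _
      (measurable_const.sub ha), hr,
    smul_eq_mul, mul_comm (h x)]
  congr 1
  exact lintegral_congr fun ξ => mul_comm _ _

lemma norm_scale_le_of_norm_le {γ : M.Param} {ξ : E d} (h : ‖ξ‖ ≤ M.rho) :
    ‖M.scale γ ξ‖ ≤ √M.lamMax * M.rho :=
  (M.norm_scale_le γ ξ).trans (by gcongr)

/-- A step of the Metropolis chain has bounded length. -/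
lemma ae_norm_sub_le_kernel (γ : M.Param) (x : E d) :
    ∀ᵐ y ∂M.kernel (γ, x), ‖y - x‖ ≤ √M.lamMax * M.rho := by
  have hs : MeasurableSet {y : E d | ¬ ‖y - x‖ ≤ √M.lamMax * M.rho} := by measurability
  rw [ae_iff, ← lintegral_indicator_one hs, M.lintegral_kernel γ x (measurable_one.indicator hs),
    ← lintegral_zero (μ := M.proposal)]
  refine lintegral_congr_ae ?_
  filter_upwards [M.ae_norm_le_proposal] with ξ hξ
  have h1 : M.move γ x ξ ∉ {y : E d | ¬ ‖y - x‖ ≤ √M.lamMax * M.rho} := by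
    simpa [move_eq] using M.norm_scale_le_of_norm_le hξ
  have h2 : x ∉ {y : E d | ¬ ‖y - x‖ ≤ √M.lamMax * M.rho} := by
    simpa using mul_nonneg (Real.sqrt_nonneg _) M.rho_pos.le
  rw [indicator_of_notMem h1, indicator_of_notMem h2]
  simp

end Model

end AdaptiveRWM

/-! ### Lipschitz dependence of the kernels on the tuning matrix -/

namespace AdaptiveRWM

variable {d : ℕ}

namespace Model

variable (M : Model d)

lemma det_scale_ne_zero (γ : M.Param) : LinearMap.det (M.scale γ) ≠ 0 := by
  have h := (M.scaleEquiv γ).toLinearEquiv.isUnit_det'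
  exact h.ne_zero

lemma continuous_scale (γ : M.Param) : Continuous (M.scale γ) := (M.scaleEquiv γ).continuous

lemma measurable_scaled_weight (γ : M.Param) :
    Measurable fun z => M.proposalWeight ((M.scaleEquiv γ).symm z) :=
  M.measurable_proposalWeight.comp (M.scaleEquiv γ).symm.continuous.measurable

/-- The scaled proposal has a density proportional to the scaled proposal weight. -/
lemma exists_lintegral_scale (γ : M.Param) : ∃ c : ℝ≥0∞, ∀ H : E d → ℝ≥0∞, Measurable H →
    ∫⁻ ξ, H (M.scale γ ξ) ∂M.proposal
      = c * ∫⁻ z, M.proposalWeight ((M.scaleEquiv γ).symm z) * H z := by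
  refine ⟨(M.unnormalizedProposal univ)⁻¹ *
    ENNReal.ofReal |(LinearMap.det (M.scale γ))⁻¹|, fun H hH => ?_⟩
  have hS := (M.continuous_scale γ).measurable
  rw [M.lintegral_proposal (f := fun ξ => H (M.scale γ ξ)) (hH.comp hS), mul_assoc]
  congr 1
  rw [← smul_eq_mul, ← lintegral_smul_measure,
    ← Measure.map_linearMap_addHaar_eq_smul_addHaar volume (M.det_scale_ne_zero γ),
    lintegral_map (f := fun z => M.proposalWeight ((M.scaleEquiv γ).symm z) * H z)
      ((M.measurable_scaled_weight γ).mul hH) hS]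
  refine lintegral_congr fun ξ => ?_
  rw [← scaleEquiv_apply, ContinuousLinearEquiv.symm_apply_apply]

lemma norm_le_of_norm_scaleEquiv_symm_le {γ : M.Param} {z : E d}
    (h : ‖(M.scaleEquiv γ).symm z‖ ≤ M.rho) : ‖z‖ ≤ √M.lamMax * M.rho := by
  simpa using M.norm_scale_le_of_norm_le (γ := γ) h

lemma norm_scaleEquiv_symm_le (γ : M.Param) (z : E d) :
    ‖(M.scaleEquiv γ).symm z‖ ≤ ‖z‖ / √M.lamMin := by
  rw [le_div_iff₀ (Real.sqrt_pos.2 M.lamMin_pos), mul_comm]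
  simpa using M.norm_scale_ge γ ((M.scaleEquiv γ).symm z)

/-- A positive lower bound, uniform in the tuning matrix, for the total scaled weight. -/
lemma exists_le_lintegral_scaled_weight : ∃ z₀ : ℝ≥0∞, z₀ ≠ 0 ∧ z₀ ≠ ∞ ∧ ∀ γ : M.Param,
    z₀ ≤ ∫⁻ z, M.proposalWeight ((M.scaleEquiv γ).symm z) := by
  have hl := Real.sqrt_pos.2 M.lamMin_pos
  have hb : 0 < M.rho * √M.lamMin := mul_pos M.rho_pos hl
  refine ⟨ENNReal.ofReal (Real.exp (-M.rho ^ 2 / (2 * M.sigma ^ 2))) *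
    volume (Metric.closedBall (0 : E d) (M.rho * √M.lamMin)), ?_, ?_, fun γ => ?_⟩
  · exact mul_ne_zero (ENNReal.ofReal_pos.2 (Real.exp_pos _)).ne'
      (Metric.measure_closedBall_pos volume _ hb).ne'
  · exact ENNReal.mul_ne_top ENNReal.ofReal_ne_top measure_closedBall_lt_top.ne
  · rw [← lintegral_indicator_const measurableSet_closedBall]
    refine lintegral_mono fun z => ?_
    by_cases hz : z ∈ Metric.closedBall (0 : E d) (M.rho * √M.lamMin)
    swap
    · rw [indicator_of_notMem hz]
      exact zero_le
    rw [indicator_of_mem hz]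
    refine M.le_proposalWeight ((M.norm_scaleEquiv_symm_le γ z).trans ?_)
    rw [div_le_iff₀ hl]
    simpa using hz

lemma exp_neg_sub_le {a b : ℝ} (ha : 0 ≤ a) : Real.exp (-a) ≤ Real.exp (-b) + max (b - a) 0 := by
  rcases le_total b a with h | h
  · have : Real.exp (-a) ≤ Real.exp (-b) := by gcongr
    exact this.trans (by simp)
  · have h1 : Real.exp (-b) = Real.exp (-a) * Real.exp (-(b - a)) := by
      rw [← Real.exp_add]; ring_nf
    have h2 := Real.add_one_le_exp (-(b - a))
    have h3 : Real.exp (-a) ≤ 1 := Real.exp_le_one_iff.2 (by linarith)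
    have h4 := Real.exp_pos (-a)
    have h5 : b - a ≤ max (b - a) 0 := le_max_left _ _
    nlinarith

/-- Where both ellipsoids contain z, the Gaussian factors differ by at most the difference of their
exponents. The truncation can disagree only in a thin shell: since 1 + κ ≤ (1 + κ)², a point of the
shrunken γ'-ellipsoid also lies in the γ-ellipsoid. -/
lemma scaled_weight_le (γ γ' : M.Param) {κ : ℝ} (hκ : 0 ≤ κ)
    (hq : ∀ z, ‖(M.scaleEquiv γ).symm z‖ ^ 2 ≤ (1 + κ) * ‖(M.scaleEquiv γ').symm z‖ ^ 2)
    (z : E d) :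
    M.proposalWeight ((M.scaleEquiv γ').symm z) ≤ M.proposalWeight ((M.scaleEquiv γ).symm z)
      + ((Metric.closedBall (0 : E d) (√M.lamMax * M.rho)).indicator
          (fun _ => ENNReal.ofReal (κ * (M.rho ^ 2 / (2 * M.sigma ^ 2)))) z
        + ({z : E d | ‖(M.scaleEquiv γ').symm z‖ ≤ M.rho} \
            {z : E d | (1 + κ) * ‖(M.scaleEquiv γ').symm z‖ ≤ M.rho}).indicator 1 z) := by
  set w := (M.scaleEquiv γ).symm z with hw
  set w' := (M.scaleEquiv γ').symm z with hw'
  have hs := M.sigma_pos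
  by_cases h' : ‖w'‖ ≤ M.rho
  swap
  · rw [M.proposalWeight_eq_zero (not_le.1 h')]
    exact zero_le
  have hz : z ∈ Metric.closedBall (0 : E d) (√M.lamMax * M.rho) := by
    simpa using M.norm_le_of_norm_scaleEquiv_symm_le h'
  rw [indicator_of_mem hz]
  by_cases h : ‖w‖ ≤ M.rho
  · refine le_trans ?_ (add_le_add_right le_self_add _)
    rw [proposalWeight, proposalWeight, indicator_of_mem (by simpa using h'),
      indicator_of_mem (by simpa using h), ← ENNReal.ofReal_add (Real.exp_pos _).le (by positivity)]
    refine ENNReal.ofReal_le_ofReal ?_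
    have h1 := exp_neg_sub_le (a := ‖w'‖ ^ 2 / (2 * M.sigma ^ 2)) (b := ‖w‖ ^ 2 / (2 * M.sigma ^ 2))
      (by positivity)
    rw [neg_div, neg_div]
    refine h1.trans (add_le_add_right (max_le ?_ (by positivity)) _)
    rw [← sub_div, mul_div_assoc']
    gcongr
    have h2 := hq z
    have h3 : ‖w'‖ ^ 2 ≤ M.rho ^ 2 := by gcongr
    nlinarith
  · have hmem : z ∈ ({z : E d | ‖(M.scaleEquiv γ').symm z‖ ≤ M.rho} \
            {z : E d | (1 + κ) * ‖(M.scaleEquiv γ').symm z‖ ≤ M.rho}) := by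
      refine ⟨h', fun hc => h ?_⟩
      have hc' : (1 + κ) * ‖w'‖ ≤ M.rho := hc
      refine le_of_sq_le_sq ?_ M.rho_pos.le
      refine (hq z).trans ?_
      have : ((1 + κ) * ‖w'‖) ^ 2 ≤ M.rho ^ 2 := by gcongr
      nlinarith [sq_nonneg ‖w'‖, mul_nonneg hκ (sq_nonneg ‖w'‖)]
    rw [indicator_of_mem hmem]
    exact (M.proposalWeight_le_one _).trans (le_add_left (le_add_left le_rfl))

-- The removed set is a dilate of the ellipsoid by (1+κ)⁻¹, so its volume scales by (1+κ)⁻ᵈ, and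
-- Bernoulli's inequality bounds the lost fraction by dκ.
open scoped Pointwise in
lemma volume_ellipsoid_shell_le (γ : M.Param) {κ : ℝ} (hκ : 0 ≤ κ) :
    volume ({z : E d | ‖(M.scaleEquiv γ).symm z‖ ≤ M.rho} \
      {z : E d | (1 + κ) * ‖(M.scaleEquiv γ).symm z‖ ≤ M.rho})
      ≤ ENNReal.ofReal (d * κ) * volume (Metric.closedBall (0 : E d) (√M.lamMax * M.rho)) := by
  set S : Set (E d) := {z : E d | ‖(M.scaleEquiv γ).symm z‖ ≤ M.rho} with hS
  have hSm : MeasurableSet S :=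
    measurableSet_le (M.scaleEquiv γ).symm.continuous.norm.measurable measurable_const
  have hSsub : S ⊆ Metric.closedBall (0 : E d) (√M.lamMax * M.rho) := fun z hz => by
    simpa using M.norm_le_of_norm_scaleEquiv_symm_le hz
  have hSfin : volume S ≠ ∞ := ne_top_of_le_ne_top measure_closedBall_lt_top.ne (measure_mono hSsub)
  have h1κ : 0 < 1 + κ := by linarith
  have hT : {z : E d | (1 + κ) * ‖(M.scaleEquiv γ).symm z‖ ≤ M.rho} = (1 + κ)⁻¹ • S := by
    ext z
    rw [Set.mem_inv_smul_set_iff₀ h1κ.ne']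
    simp [hS, norm_smul, abs_of_pos h1κ]
  have hTm : MeasurableSet ((1 + κ)⁻¹ • S) := hSm.const_smul₀ _
  have hTS : (1 + κ)⁻¹ • S ⊆ S := by
    rw [← hT]
    intro z hz
    have hz' : (1 + κ) * ‖(M.scaleEquiv γ).symm z‖ ≤ M.rho := hz
    change ‖(M.scaleEquiv γ).symm z‖ ≤ M.rho
    nlinarith [norm_nonneg ((M.scaleEquiv γ).symm z)]
  have hvol : volume ((1 + κ)⁻¹ • S) = ENNReal.ofReal (((1 + κ)⁻¹) ^ d) * volume S := by
    rw [Measure.addHaar_smul, finrank_euclideanSpace_fin, abs_of_nonneg (by positivity)]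
  have hber : 1 - d * κ ≤ ((1 + κ)⁻¹) ^ d := by
    have h1 : 1 - κ ≤ (1 + κ)⁻¹ := by
      rw [← one_div, le_div_iff₀ h1κ]; nlinarith
    rcases le_total κ 1 with hk | hk
    · have h2 := one_add_mul_le_pow (a := -κ) (by linarith) d
      calc 1 - d * κ = 1 + d * (-κ) := by ring
        _ ≤ (1 + -κ) ^ d := h2
        _ ≤ _ := by
          refine pow_le_pow_left₀ (by linarith) (by linarith) _
    · rcases Nat.eq_zero_or_pos d with h0 | h0
      · simp [h0]
      · have : (1 : ℝ) ≤ d := by exact_mod_cast h0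
        have h3 : 0 ≤ ((1 + κ)⁻¹) ^ d := by positivity
        nlinarith
  rw [hT, measure_sdiff hTS hTm.nullMeasurableSet (ne_top_of_le_ne_top hSfin (measure_mono hTS)), hvol]
  refine le_trans ?_ (mul_le_mul_right (measure_mono hSsub) _)
  rw [tsub_le_iff_right, ← add_mul, ← ENNReal.ofReal_add (by positivity) (by positivity)]
  refine le_mul_of_one_le_left zero_le ?_
  rw [← ENNReal.ofReal_one]
  exact ENNReal.ofReal_le_ofReal (by linarith)

/-- The integrals of functions bounded by one against the scaled weights are Lipschitz in the tuning
matrix. -/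
lemma exists_lintegral_scaled_weight_lipschitz : ∃ C > (0 : ℝ), ∀ (γ γ' : M.Param)
    (H : E d → ℝ≥0∞), Measurable H → (∀ z, H z ≤ 1) →
    ∫⁻ z, M.proposalWeight ((M.scaleEquiv γ').symm z) * H z
      ≤ (∫⁻ z, M.proposalWeight ((M.scaleEquiv γ).symm z) * H z)
        + ENNReal.ofReal (C * frobNorm (γ'.1 - γ.1)) := by
  set B := Metric.closedBall (0 : E d) (√M.lamMax * M.rho) with hB
  have hBfin : volume B ≠ ∞ := measure_closedBall_lt_top.ne
  have hs := M.sigma_pos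
  have hlam : 0 < M.lamMax / M.lamMin ^ 2 := div_pos M.lamMax_pos (pow_pos M.lamMin_pos 2)
  refine ⟨M.lamMax / M.lamMin ^ 2 * (M.rho ^ 2 / (2 * M.sigma ^ 2) + d) * (volume B).toReal + 1,
    by positivity, fun γ γ' H hH hH1 => ?_⟩
  set κ := M.lamMax / M.lamMin ^ 2 * frobNorm (γ'.1 - γ.1) with hκ
  have hκ0 : 0 ≤ κ := mul_nonneg hlam.le (frobNorm_nonneg _)
  have hp := M.scaled_weight_le γ γ' hκ0 (fun z => M.norm_scaleEquiv_symm_sq_le γ' γ z)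
  have hSm : MeasurableSet ({z : E d | ‖(M.scaleEquiv γ').symm z‖ ≤ M.rho} \
      {z : E d | (1 + κ) * ‖(M.scaleEquiv γ').symm z‖ ≤ M.rho}) := by
    have := (M.scaleEquiv γ').symm.continuous.norm.measurable
    exact (measurableSet_le this measurable_const).diff
      (measurableSet_le (this.const_mul _) measurable_const)
  calc ∫⁻ z, M.proposalWeight ((M.scaleEquiv γ').symm z) * H z
      ≤ ∫⁻ z, (M.proposalWeight ((M.scaleEquiv γ).symm z) * H z +
        (B.indicator (fun _ => ENNReal.ofReal (κ * (M.rho ^ 2 / (2 * M.sigma ^ 2)))) z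
        + ({z : E d | ‖(M.scaleEquiv γ').symm z‖ ≤ M.rho} \
            {z : E d | (1 + κ) * ‖(M.scaleEquiv γ').symm z‖ ≤ M.rho}).indicator 1 z)) := by
        refine lintegral_mono fun z => ?_
        refine (mul_le_mul_left (hp z) _).trans ?_
        rw [add_mul]
        exact add_le_add_right (mul_le_of_le_one_right zero_le (hH1 z)) _
    _ = (∫⁻ z, M.proposalWeight ((M.scaleEquiv γ).symm z) * H z) +
        (ENNReal.ofReal (κ * (M.rho ^ 2 / (2 * M.sigma ^ 2))) * volume B +
          volume ({z : E d | ‖(M.scaleEquiv γ').symm z‖ ≤ M.rho} \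
            {z : E d | (1 + κ) * ‖(M.scaleEquiv γ').symm z‖ ≤ M.rho})) := by
        rw [lintegral_add_left
            (f := fun z => M.proposalWeight ((M.scaleEquiv γ).symm z) * H z)
            ((M.measurable_scaled_weight γ).mul hH),
          lintegral_add_left (measurable_const.indicator measurableSet_closedBall),
          lintegral_indicator_one hSm, lintegral_indicator_const measurableSet_closedBall]
    _ ≤ (∫⁻ z, M.proposalWeight ((M.scaleEquiv γ).symm z) * H z) +
        (ENNReal.ofReal (κ * (M.rho ^ 2 / (2 * M.sigma ^ 2))) * volume B +
          ENNReal.ofReal (d * κ) * volume B) := by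
        gcongr
        exact M.volume_ellipsoid_shell_le γ' hκ0
    _ ≤ _ := by
        gcongr
        rw [← add_mul, ← ENNReal.ofReal_add (by positivity) (by positivity),
          ← ENNReal.ofReal_toReal hBfin, ← ENNReal.ofReal_mul (by positivity),
          ENNReal.toReal_ofReal ENNReal.toReal_nonneg]
        refine ENNReal.ofReal_le_ofReal ?_
        have := frobNorm_nonneg (γ'.1 - γ.1)
        calc _ = M.lamMax / M.lamMin ^ 2 * (M.rho ^ 2 / (2 * M.sigma ^ 2) + d) * (volume B).toReal
              * frobNorm (γ'.1 - γ.1) := by rw [hκ]; ring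
          _ ≤ _ := by gcongr; linarith

/-- Normalization preserves Lipschitz comparisons. -/
lemma normalized_le_add {c c' I I' Z Z' D z₀ : ℝ≥0∞} (hc : c * Z = 1) (hc' : c' * Z' = 1)
    (hI : I' ≤ I + D) (hZ : Z ≤ Z' + D) (hIZ : c * I ≤ 1) (hz : z₀ ≤ Z') :
    c' * I' ≤ c * I + 2 * z₀⁻¹ * D := by
  have hcz : c' ≤ z₀⁻¹ := by
    rw [← ENNReal.inv_le_inv, inv_inv]
    refine hz.trans ?_
    rw [ENNReal.eq_inv_of_mul_eq_one_left ((mul_comm _ _).trans hc')]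
  calc c' * I' ≤ c' * (I + D) := by gcongr
    -- Inserting cZ = 1 and regrouping puts Z next to c', so that Z ≤ Z' + D and c'Z' = 1 compare
    -- the two normalizations. The bound cI ≤ 1 keeps the resulting error additive.
    _ = (c * Z) * (c' * I) + c' * D := by rw [hc, one_mul, mul_add]
    _ = (c * I) * (c' * Z) + c' * D := by ring
    _ ≤ (c * I) * (c' * (Z' + D)) + c' * D := by gcongr
    _ = c * I + (c * I) * (c' * D) + c' * D := by rw [mul_add c', hc', mul_add, mul_one]
    _ ≤ c * I + 1 * (c' * D) + c' * D := by gcongr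
    _ = c * I + 2 * c' * D := by ring
    _ ≤ _ := by gcongr

/-- The random-walk Metropolis kernels are Lipschitz in the tuning matrix, for the Frobenius norm
and the total variation distance, uniformly in the state. -/
lemma exists_kernel_lipschitz : ∃ C > (0 : ℝ), ∀ (γ γ' : M.Param) (x : E d)
    (h : E d → ℝ≥0∞), Measurable h → (∀ z, h z ≤ 1) →
    ∫⁻ y, h y ∂M.kernel (γ', x)
      ≤ (∫⁻ y, h y ∂M.kernel (γ, x)) + ENNReal.ofReal (C * frobNorm (γ'.1 - γ.1)) := by
  obtain ⟨C, hC, hlip⟩ := M.exists_lintegral_scaled_weight_lipschitz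
  obtain ⟨z₀, hz0, hz1, hz⟩ := M.exists_le_lintegral_scaled_weight
  have hz0' : 0 < z₀.toReal := ENNReal.toReal_pos hz0 hz1
  refine ⟨2 * z₀.toReal⁻¹ * C, by positivity, fun γ γ' x h hh hh1 => ?_⟩
  obtain ⟨c, hc⟩ := M.exists_lintegral_scale γ
  obtain ⟨c', hc'⟩ := M.exists_lintegral_scale γ'
  have hU := M.continuous_U.measurable
  have hone := fun (γ : M.Param) => lintegral_one (μ := M.proposal)
  have hcZ : c * ∫⁻ z, M.proposalWeight ((M.scaleEquiv γ).symm z) = 1 := by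
    have := hc 1 measurable_one
    simpa using this.symm
  have hcZ' : c' * ∫⁻ z, M.proposalWeight ((M.scaleEquiv γ').symm z) = 1 := by
    have := hc' 1 measurable_one
    simpa using this.symm
  -- As a function of the displacement z, the integrand does not involve the tuning matrix. The
  -- matrix enters only through the law of z, so the bound for scaled weights applies with the same
  -- H on both sides.
  set H : E d → ℝ≥0∞ := fun z => h (x + z) * ENNReal.ofReal (M.accept x (x + z))
    + h x * (1 - ENNReal.ofReal (M.accept x (x + z))) with hHdef
  have ha : Measurable fun z => ENNReal.ofReal (M.accept x (x + z)) := by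
    unfold accept; fun_prop
  have hH : Measurable H :=
    ((hh.comp (measurable_const_add x)).mul ha).add (measurable_const.mul (measurable_const.sub ha))
  have hH1 : ∀ z, H z ≤ 1 := fun z => by
    have h1 : ENNReal.ofReal (M.accept x (x + z)) ≤ 1 := by
      rw [← ENNReal.ofReal_one]
      exact ENNReal.ofReal_le_ofReal (min_le_right _ _)
    calc H z ≤ 1 * ENNReal.ofReal (M.accept x (x + z))
          + 1 * (1 - ENNReal.ofReal (M.accept x (x + z))) :=
            add_le_add (mul_le_mul_left (hh1 _) _) (mul_le_mul_left (hh1 _) _)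
      _ = 1 := by rw [one_mul, one_mul, add_tsub_cancel_of_le h1]
  have hker : ∀ γ : M.Param, ∫⁻ y, h y ∂M.kernel (γ, x) = ∫⁻ ξ, H (M.scale γ ξ) ∂M.proposal :=
    fun γ => M.lintegral_kernel γ x hh
  have hle1 : c * ∫⁻ z, M.proposalWeight ((M.scaleEquiv γ).symm z) * H z ≤ 1 := by
    rw [← hc H hH]
    calc ∫⁻ ξ, H (M.scale γ ξ) ∂M.proposal ≤ ∫⁻ _, 1 ∂M.proposal :=
          lintegral_mono fun ξ => hH1 _
      _ = 1 := by simp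
  rw [hker, hker, hc H hH, hc' H hH]
  have hZ := hlip γ' γ 1 measurable_one (fun _ => le_rfl)
  simp only [Pi.one_apply, mul_one] at hZ
  rw [frobNorm_sub_comm] at hZ
  refine (normalized_le_add hcZ hcZ' (hlip γ γ' H hH hH1) hZ hle1 (hz γ')).trans
    (le_of_eq ?_)
  congr 1
  rw [ENNReal.ofReal_mul (by positivity : (0 : ℝ) ≤ 2 * z₀.toReal⁻¹ * C), mul_assoc 2 z₀.toReal⁻¹ C,
    ENNReal.ofReal_mul (by positivity), ENNReal.ofReal_mul (by positivity),
    ENNReal.ofReal_mul (by positivity), ENNReal.ofReal_inv_of_pos hz0', ENNReal.ofReal_toReal hz1]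
  simp only [ENNReal.ofReal_ofNat]
  ring

end Model

end AdaptiveRWM

/-! ### Abstract subgeometric contraction from drift and minorization -/

namespace AdaptiveRWM

section Contraction

variable {X : Type*}

/-- A function whose increments are bounded by a sum of weights is within the weight of a constant. -/
lemma exists_abs_sub_le_of_sub_le_add [Nonempty X] {g w : X → ℝ}
    (h : ∀ x y, g x - g y ≤ w x + w y) : ∃ c, ∀ x, |g x - c| ≤ w x := by
  have hb : BddAbove (range fun x => g x - w x) := by
    obtain ⟨y⟩ := ‹Nonempty X›
    refine ⟨g y + w y, ?_⟩
    rintro _ ⟨x, rfl⟩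
    change g x - w x ≤ _
    linarith [h x y]
  refine ⟨⨆ x, (g x - w x), fun x => abs_le.2 ⟨?_, ?_⟩⟩
  · have : ⨆ y, (g y - w y) ≤ g x + w x := ciSup_le fun y => by linarith [h y x]
    linarith
  · have := le_ciSup hb x
    linarith

variable [MeasurableSpace X]

/-- A subgeometric drift condition with a minorization condition for a Markov kernel: `φ` is the
drift of the Lyapunov function `V`, its square grows at most linearly in time, the drift dominates
the constant `K` for pairs of points outside `C`, and the kernel is minorized on `C`. -/
structure DriftMinorization (κ : Kernel X X) (V φ : X → ℝ) (K K₂ η : ℝ) : Prop where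
  measurable_V : Measurable V
  V_nonneg : ∀ x, 0 ≤ V x
  K_pos : 0 < K
  K₂_nonneg : 0 ≤ K₂
  η_pos : 0 < η
  integrable_V : ∀ x, Integrable V (κ x)
  integrable_V_sq : ∀ x, Integrable (fun y => V y ^ 2) (κ x)
  drift : ∀ x, ∫ y, V y ∂κ x ≤ V x - φ x + K
  drift_sq : ∀ x, ∫ y, V y ^ 2 ∂κ x ≤ V x ^ 2 + K₂
  φ_nonneg : ∀ x, 0 ≤ φ x
  minor : ∃ (C : Set X) (ν : Measure X), ν.real univ = η ∧ IsFiniteMeasure ν ∧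
    (∀ x ∈ C, ν ≤ κ x) ∧ ∀ x y, ¬ (x ∈ C ∧ y ∈ C) → 8 * K ≤ φ x + φ y

namespace DriftMinorization

variable {κ : Kernel X X} [IsMarkovKernel κ] {V φ : X → ℝ} {K K₂ η : ℝ}

/-- The functions w ∓ (g - c) are nonnegative, so passing from ν to a larger measure increases their
integrals. Adding the two inequalities cancels g on the common part ν and saves twice the ν-mass of
w. With ν = 0 nothing is saved, which serves pairs outside the small set. -/
lemma sub_le_of_abs_sub_le {g w : X → ℝ} {c : ℝ} (hg : ∀ x, |g x - c| ≤ w x) {ν : Measure X}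
    [IsFiniteMeasure ν] {x y : X} (hx : ν ≤ κ x) (hy : ν ≤ κ y)
    (hgi : ∀ x, Integrable g (κ x)) (hwi : ∀ x, Integrable w (κ x)) :
    ∫ z, g z ∂κ x - ∫ z, g z ∂κ y ≤ ∫ z, w z ∂κ x + ∫ z, w z ∂κ y - 2 * ∫ z, w z ∂ν := by
  have hgc : ∀ x, Integrable (fun z => g z - c) (κ x) := fun x => (hgi x).sub (integrable_const c)
  have hcx : ∀ x, ∫ z, (w z - (g z - c)) ∂κ x = ∫ z, w z ∂κ x - (∫ z, g z ∂κ x - c) := fun x => by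
    rw [integral_sub (hwi x) (hgc x),
      integral_sub (hgi x) (integrable_const c)]
    simp
  have hcy : ∀ x, ∫ z, (w z + (g z - c)) ∂κ x = ∫ z, w z ∂κ x + (∫ z, g z ∂κ x - c) := fun x => by
    rw [integral_add (hwi x) (hgc x),
      integral_sub (hgi x) (integrable_const c)]
    simp
  have hgν : Integrable (fun z => g z - c) ν :=
    ((hgi x).mono_measure hx).sub (integrable_const c)
  have hwν : Integrable w ν := (hwi x).mono_measure hx
  have h1 : ∫ z, (w z - (g z - c)) ∂ν ≤ ∫ z, (w z - (g z - c)) ∂κ x :=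
    integral_mono_measure hx (Eventually.of_forall fun z => sub_nonneg.2 (abs_le.1 (hg z)).2)
      ((hwi x).sub ((hgi x).sub (integrable_const c)))
  have h2 : ∫ z, (w z + (g z - c)) ∂ν ≤ ∫ z, (w z + (g z - c)) ∂κ y :=
    integral_mono_measure hy (Eventually.of_forall fun z => by
        have := (abs_le.1 (hg z)).1
        change 0 ≤ w z + (g z - c)
        linarith)
      ((hwi y).add ((hgi y).sub (integrable_const c)))
  rw [integral_sub hwν hgν, hcx] at h1
  rw [integral_add hwν hgν, hcy] at h2
  linarith

/-- One step of the kernel contracts the weights, up to a small leak into the square of `V`. -/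
lemma step (h : DriftMinorization κ V φ K K₂ η) {δ v b e : ℝ} (hδη : δ ≤ η) (hb : 0 ≤ b)
    (he : 0 ≤ e) (hφ : ∀ x, δ * (V x - V x ^ 2 / v) ≤ φ x) {g : X → ℝ} (hgm : Measurable g)
    (hg0 : ∀ x, 0 ≤ g x) (hg1 : ∀ x, g x ≤ 1)
    (hosc : ∀ x y, g x - g y ≤ (b * (2 * K / η + V x) + e * V x ^ 2)
      + (b * (2 * K / η + V y) + e * V y ^ 2)) (x y : X) :
    ∫ z, g z ∂κ x - ∫ z, g z ∂κ y ≤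
      (((1 - δ / 2) * b + e * (K₂ * η / (2 * K))) * (2 * K / η + V x)
        + (e + b * (δ / (2 * v))) * V x ^ 2)
      + (((1 - δ / 2) * b + e * (K₂ * η / (2 * K))) * (2 * K / η + V y)
        + (e + b * (δ / (2 * v))) * V y ^ 2) := by
  have : Nonempty X := ⟨x⟩
  obtain ⟨C, ν, hν, hνf, hC, hfar⟩ := h.minor
  obtain ⟨c, hc⟩ := exists_abs_sub_le_of_sub_le_add hosc
  have hK := h.K_pos
  have hη := h.η_pos
  have hK₂ := h.K₂_nonneg
  -- The constant part A of the weight is calibrated by Aη = 2K: two copies of the minorizing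
  -- measure then save 4Kb, twice the 2Kb that the drift constants cost.
  set A := 2 * K / η with hA
  have hApos : 0 < A := by positivity
  have hAη : A * η = 2 * K := by rw [hA]; field_simp
  have hAinv : K₂ * η / (2 * K) * A = K₂ := by rw [hA]; field_simp
  have hgi : ∀ x, Integrable g (κ x) := fun x =>
    Integrable.of_bound hgm.aestronglyMeasurable 1 (Eventually.of_forall fun z => by
      rw [Real.norm_eq_abs, abs_of_nonneg (hg0 z)]; exact hg1 z)
  have hAV : ∀ x, Integrable (fun z => b * (A + V z)) (κ x) := fun x =>
    ((integrable_const A).add (h.integrable_V x)).const_mul b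
  have heV : ∀ x, Integrable (fun z => e * V z ^ 2) (κ x) := fun x =>
    (h.integrable_V_sq x).const_mul e
  have hwi : ∀ x, Integrable (fun z => b * (A + V z) + e * V z ^ 2) (κ x) := fun x =>
    (hAV x).add (heV x)
  have hPw : ∀ x, ∫ z, (b * (A + V z) + e * V z ^ 2) ∂κ x
      ≤ b * (A + V x - φ x + K) + e * (V x ^ 2 + K₂) := fun x => by
    rw [integral_add (hAV x) (heV x), integral_const_mul, integral_const_mul,
      integral_add (integrable_const A) (h.integrable_V x)]
    have h1 := h.drift x
    have h2 := h.drift_sq x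
    simp only [integral_const, probReal_univ, smul_eq_mul, one_mul]
    exact add_le_add (mul_le_mul_of_nonneg_left (by linarith) hb)
      (mul_le_mul_of_nonneg_left h2 he)
  have main : ∫ z, g z ∂κ x - ∫ z, g z ∂κ y ≤
      b * (2 * A - 2 * K + (V x + V y) - (φ x + φ y) / 2)
        + e * (V x ^ 2 + V y ^ 2 + 2 * K₂) := by
    have hφx := h.φ_nonneg x
    have hφy := h.φ_nonneg y
    -- In both cases the net constant is -2Kb. Inside C the minorization saves 4Kb. Outside C half
    -- of the drift, which is at least 4K by the far condition, plays that role, and the other half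
    -- is kept.
    by_cases hxy : x ∈ C ∧ y ∈ C
    · have h1 := sub_le_of_abs_sub_le hc (hC x hxy.1) (hC y hxy.2) hgi hwi
      have h2 : b * (A * η) ≤ ∫ z, (b * (A + V z) + e * V z ^ 2) ∂ν := by
        have h3 : ∫ _, b * A ∂ν = b * (A * η) := by
          rw [integral_const, hν, smul_eq_mul]; ring
        rw [← h3]
        refine integral_mono (integrable_const _) ((hwi x).mono_measure (hC x hxy.1)) fun z => ?_
        have := h.V_nonneg z
        change b * A ≤ b * (A + V z) + e * V z ^ 2
        have h4 := mul_nonneg hb this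
        have h5 := mul_nonneg he (sq_nonneg (V z))
        linarith
      rw [hAη] at h2
      nlinarith [hPw x, hPw y, mul_nonneg hb hφx, mul_nonneg hb hφy]
    · have hz : (0 : Measure X) ≤ κ x := Measure.zero_le _
      have hz' : (0 : Measure X) ≤ κ y := Measure.zero_le _
      have h1 := sub_le_of_abs_sub_le hc hz hz' hgi hwi
      rw [integral_zero_measure] at h1
      have h2 := mul_le_mul_of_nonneg_left (hfar x y hxy) hb
      nlinarith [hPw x, hPw y]
  have hx := mul_le_mul_of_nonneg_left (hφ x) hb
  have hy := mul_le_mul_of_nonneg_left (hφ y) hb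
  have hVx := h.V_nonneg x
  have hVy := h.V_nonneg y
  -- The gain 2Kb contracts the constants A of both points, thanks to δ ≤ η. The retained half of
  -- the drift contracts V, up to the leak δV²/(2v), and the growth eK₂ of the square term is
  -- rewritten as a multiple of A.
  have hAδ : b * (δ * A) ≤ b * (2 * K) := by
    rw [← hAη]
    gcongr b * ?_
    nlinarith
  have hq : 0 ≤ e * (K₂ * η / (2 * K)) := by positivity
  have e1 := mul_nonneg hq hVx
  have e2 := mul_nonneg hq hVy
  have e3 : e * (K₂ * η / (2 * K)) * A = e * K₂ := by rw [mul_assoc, hAinv]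
  have e4 : b * (δ / (2 * v)) * V x ^ 2 = b * (δ * (V x ^ 2 / v)) / 2 := by
    rw [mul_comm 2 v, ← div_div]; ring
  have e5 : b * (δ / (2 * v)) * V y ^ 2 = b * (δ * (V y ^ 2 / v)) / 2 := by
    rw [mul_comm 2 v, ← div_div]; ring
  nlinarith

/-- Iterating the kernel: the oscillation of the iterates of a function with values in `[0, 1]`. -/
lemma iterate (h : DriftMinorization κ V φ K K₂ η) {δ v : ℝ} (hδ0 : 0 ≤ δ) (hδη : δ ≤ η)
    (hδ1 : δ ≤ 1) (hv : 0 < v) (hφ : ∀ x, δ * (V x - V x ^ 2 / v) ≤ φ x) {g : ℕ → X → ℝ}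
    (hgm : ∀ n, Measurable (g n)) (hg0 : ∀ n x, 0 ≤ g n x) (hg1 : ∀ n x, g n x ≤ 1)
    (hg : ∀ n x, g (n + 1) x = ∫ z, g n z ∂κ x) (N : ℕ) (x y : X) :
    g N x - g N y ≤
      ((1 - δ / 2) ^ N + N ^ 2 * (K₂ * η / (2 * K)) / v) * (η / (4 * K))
          * (2 * (2 * K / η) + V x + V y)
        + N * (η / (4 * K)) / v * (V x ^ 2 + V y ^ 2) := by
  have hK := h.K_pos
  have hη := h.η_pos
  have hK₂ := h.K₂_nonneg
  set b₀ := η / (4 * K) with hb0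
  set q := K₂ * η / (2 * K) with hq
  have hb0pos : 0 < b₀ := by positivity
  have hq0 : 0 ≤ q := by positivity
  -- The initial weight b₀ is chosen so that the constants alone dominate an oscillation of size
  -- one.
  have hbA : b₀ * (2 * (2 * K / η)) = 1 := by rw [hb0]; field_simp; norm_num
  have hVx := h.V_nonneg x
  have hVy := h.V_nonneg y
  have hδ' : 0 ≤ 1 - δ / 2 := by linarith
  -- If N²q/v exceeds one, the claim is weaker than the trivial oscillation bound. Otherwise the
  -- feedback from the leak stays below b₀, so the linear weight never exceeds 2b₀ and each step
  -- adds at most b₀/v to the quadratic weight.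
  rcases le_total (N ^ 2 * q / v) 1 with hN | hN
  · have ind : ∀ n ≤ N, ∀ x y, g n x - g n y ≤
        (((1 - δ / 2) ^ n + n * N * q / v) * b₀ * (2 * K / η + V x) + n * b₀ / v * V x ^ 2)
        + (((1 - δ / 2) ^ n + n * N * q / v) * b₀ * (2 * K / η + V y)
          + n * b₀ / v * V y ^ 2) := by
      intro n
      induction n with
      | zero =>
        intro _ x y
        have h1 := mul_nonneg hb0pos.le (h.V_nonneg x)
        have h2 := mul_nonneg hb0pos.le (h.V_nonneg y)
        have h3 := hg0 0 y
        have h4 := hg1 0 x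
        simp only [pow_zero, Nat.cast_zero, zero_mul, zero_div, add_zero, one_mul]
        nlinarith
      | succ n ih =>
        intro hn x y
        have hnN : (n : ℝ) ≤ N := by exact_mod_cast (Nat.le_of_succ_le hn)
        have hn0 : (0 : ℝ) ≤ n := Nat.cast_nonneg n
        set bn := ((1 - δ / 2) ^ n + n * N * q / v) * b₀ with hbn
        have hpow1 : (1 - δ / 2) ^ n ≤ 1 := pow_le_one₀ hδ' (by linarith)
        have hbn0 : 0 ≤ bn := by positivity
        have hbn2 : bn ≤ 2 * b₀ := by
          have : n * N * q / v ≤ 1 := by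
            refine le_trans ?_ hN
            gcongr
            nlinarith
          rw [hbn]
          gcongr
          linarith
        have hen0 : 0 ≤ n * b₀ / v := by positivity
        rw [hg, hg]
        refine (h.step hδη hbn0 hen0 hφ (hgm n) (hg0 n) (hg1 n)
          (ih (Nat.le_of_succ_le hn)) x y).trans ?_
        have hAx : 0 ≤ 2 * K / η + V x := add_nonneg (by positivity) (h.V_nonneg x)
        have hAy : 0 ≤ 2 * K / η + V y := add_nonneg (by positivity) (h.V_nonneg y)
        have hb' : (1 - δ / 2) * bn + n * b₀ / v * q
            ≤ ((1 - δ / 2) ^ (n + 1) + ((n + 1 : ℕ) : ℝ) * N * q / v) * b₀ := by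
          have t1 : (1 - δ / 2) * (n * N * q / v) ≤ n * N * q / v :=
            mul_le_of_le_one_left (by positivity) (by linarith)
          have t2 : n * q / v ≤ N * q / v := by gcongr
          have : ((n + 1 : ℕ) : ℝ) * N * q / v = n * N * q / v + N * q / v := by
            push_cast; ring
          rw [this, hbn, pow_succ]
          have t3 : n * b₀ / v * q = (n * q / v) * b₀ := by ring
          rw [t3]
          have := mul_le_mul_of_nonneg_right (add_le_add t1 t2) hb0pos.le
          linarith
        have he' : n * b₀ / v + bn * (δ / (2 * v)) ≤ ((n + 1 : ℕ) : ℝ) * b₀ / v := by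
          have : bn * (δ / (2 * v)) ≤ b₀ / v := by
            calc bn * (δ / (2 * v)) ≤ 2 * b₀ * (1 / (2 * v)) := by gcongr
              _ = b₀ / v := by field_simp
          calc _ ≤ n * b₀ / v + b₀ / v := by gcongr
            _ = _ := by push_cast; ring
        gcongr
    refine (ind N le_rfl x y).trans (le_of_eq ?_)
    ring
  · have h1 : g N x - g N y ≤ 1 := by linarith [hg0 N y, hg1 N x]
    have hp : 0 ≤ (1 - δ / 2) ^ N := by positivity
    calc g N x - g N y ≤ 1 * (b₀ * (2 * (2 * K / η) + V x + V y)) := by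
          nlinarith [mul_nonneg hb0pos.le hVx, mul_nonneg hb0pos.le hVy]
      _ ≤ ((1 - δ / 2) ^ N + N ^ 2 * q / v) * (b₀ * (2 * (2 * K / η) + V x + V y)) := by
          gcongr
          linarith
      _ ≤ _ := by
          rw [mul_assoc]
          exact le_add_of_nonneg_right (by positivity)

end DriftMinorization

end Contraction

end AdaptiveRWM

/-! ### Taylor expansion of the potential and scalar estimates for acceptance -/

namespace AdaptiveRWM

variable {d : ℕ}

/-- The Frobenius norm of the Hessian matrix bounds the second derivative. -/
lemma norm_fderiv_fderiv_le (U : E d → ℝ) (z : E d) :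
    ‖fderiv ℝ (fderiv ℝ U) z‖ ≤ frobNorm (hessian U z) := by
  set D := fderiv ℝ (fderiv ℝ U) z with hD
  refine ContinuousLinearMap.opNorm_le_bound₂ _ (frobNorm_nonneg _) fun u v => ?_
  have hent : ∀ i j, hessian U z i j
      = D (EuclideanSpace.single i (1 : ℝ)) (EuclideanSpace.single j (1 : ℝ)) := fun i j => by
    simp [hessian, iteratedFDeriv_two_apply, hD]
  have hexp : ∀ u : E d, u = ∑ i, u i • EuclideanSpace.single i (1 : ℝ) := fun u => by
    have := (EuclideanSpace.basisFun (Fin d) ℝ).sum_repr u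
    simpa using this.symm
  have hDuv : D u v = inner ℝ u ((hessian U z).toEuclideanLin v) := by
    conv_lhs => rw [hexp u, hexp v]
    simp only [map_sum, map_smul, _root_.sum_apply, _root_.smul_apply,
      smul_eq_mul, ← hent, PiLp.inner_apply, Matrix.toLpLin_apply, Matrix.mulVec, dotProduct,
      Finset.mul_sum, Finset.sum_mul, RCLike.inner_apply, conj_trivial]
    rw [Finset.sum_comm]
    refine Finset.sum_congr rfl fun i _ => Finset.sum_congr rfl fun j _ => ?_
    ring
  rw [hDuv]
  calc ‖inner ℝ u ((hessian U z).toEuclideanLin v)‖ ≤ ‖u‖ * ‖(hessian U z).toEuclideanLin v‖ :=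
        norm_inner_le_norm _ _
    _ ≤ ‖u‖ * (frobNorm (hessian U z) * ‖v‖) := by
        gcongr
        exact norm_mulVec_le_frobNorm _ _
    _ = _ := by ring

lemma inner_gradient_eq (U : E d → ℝ) (x h : E d) : inner ℝ (gradient U x) h = fderiv ℝ U x h := by
  rw [gradient, InnerProductSpace.toDual_symm_apply]

/-- The second order Taylor estimate for the potential far from the origin, at a bounded range. -/
lemma Regularity.exists_taylor {m : ℝ} {U : E d → ℝ} (hU : Regularity m U) (hm₁ : m < 1) {L : ℝ}
    (hL : 0 < L) : ∃ R > (0 : ℝ), ∃ B > (0 : ℝ), ∀ x h : E d, R ≤ ‖x‖ → ‖h‖ ≤ L →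
      |U (x + h) - U x - inner ℝ (gradient U x) h| ≤ B * ‖x‖ ^ (m - 2) := by
  obtain ⟨R, hR, d₁, hd₁, D₁, hD₁, d₂, hd₂, D₂, hD₂, d₃, hd₃, D₃, hD₃, r, hr, hgr⟩ := hU.growth
  -- Beyond R + 2L the whole ball of radius L around x stays outside radius R and has norms at least
  -- ‖x‖/2, whence the factor (1/2)^(m-2). The two factors L come from two uses of the mean value
  -- inequality.
  refine ⟨R + 2 * L, by positivity, D₃ * (1 / 2) ^ (m - 2) * L * L, by positivity,
    fun x h hx hh => ?_⟩
  have hxpos : 0 < ‖x‖ := by linarith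
  set C := D₃ * (1 / 2) ^ (m - 2) * ‖x‖ ^ (m - 2) with hC
  have hC0 : 0 ≤ C := by positivity
  have hdiff : Differentiable ℝ U := hU.contDiff.differentiable (by norm_num)
  have hdiff2 : Differentiable ℝ (fderiv ℝ U) :=
    (hU.contDiff.fderiv_right (m := 1) (by norm_num)).differentiable (by norm_num)
  have hconv := convex_closedBall x L
  have hxmem : x ∈ Metric.closedBall x L := Metric.mem_closedBall_self hL.le
  have hhess : ∀ z ∈ Metric.closedBall x L, ‖fderiv ℝ (fderiv ℝ U) z‖ ≤ C := by
    intro z hz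
    have hzx : ‖x‖ - L ≤ ‖z‖ := by
      have h1 : ‖z - x‖ ≤ L := by simpa [dist_eq_norm] using hz
      have h2 := norm_sub_norm_le x z
      rw [norm_sub_rev] at h2
      linarith
    refine (norm_fderiv_fderiv_le U z).trans (((hgr z (by linarith)).2.2.2.2).trans ?_)
    rw [hC, mul_assoc, ← Real.mul_rpow (by norm_num) hxpos.le]
    gcongr D₃ * ?_
    exact Real.rpow_le_rpow_of_nonpos (by positivity) (by linarith) (by linarith)
  have hgrad : ∀ z ∈ Metric.closedBall x L, ‖fderiv ℝ U z - fderiv ℝ U x‖ ≤ C * L := by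
    intro z hz
    refine (hconv.norm_image_sub_le_of_norm_fderiv_le (fun y _ => hdiff2 y) hhess hxmem hz).trans ?_
    gcongr
    simpa [dist_eq_norm] using hz
  have hmem : x + h ∈ Metric.closedBall x L := by simpa [dist_eq_norm] using hh
  have := hconv.norm_image_sub_le_of_norm_fderiv_le' (fun y _ => hdiff y) hgrad hxmem hmem
  rw [add_sub_cancel_left, Real.norm_eq_abs] at this
  rw [inner_gradient_eq]
  refine this.trans ?_
  calc C * L * ‖h‖ ≤ C * L * L := by gcongr
    _ = _ := by rw [hC]; ring

section Scalar

lemma exp_sub_one_le {y : ℝ} (hy : |y| ≤ 1) : Real.exp y - 1 ≤ y + y ^ 2 := by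
  have := (abs_le.1 (Real.abs_exp_sub_one_sub_id_le hy)).2
  linarith

/-- The expected gain of an accepted or rejected move with potential difference `Δ`. -/
lemma accept_mul_exp_sub_one_le {s Δ : ℝ} (hs : 0 < s) (hs8 : s ≤ 1 / 8) (hΔ : |Δ| ≤ 1) :
    min (Real.exp (-Δ)) 1 * (Real.exp (s * Δ) - 1)
      ≤ s * Δ + s * (Δ ^ 2 / 8 - max Δ 0 ^ 2 / 2) := by
  have hsΔ : |s * Δ| ≤ 1 := by
    rw [abs_mul, abs_of_pos hs]
    nlinarith [abs_nonneg Δ]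
  have h1 := exp_sub_one_le hsΔ
  obtain ⟨hΔl, hΔu⟩ := abs_le.1 hΔ
  rcases le_total Δ 0 with h | h
  · rw [min_eq_right (Real.one_le_exp (by linarith)), max_eq_right h]
    nlinarith [sq_nonneg Δ]
  -- An uphill move is accepted with probability at most 1 - Δ/2. This costs the second order amount
  -- sΔ²/2, while the convexity term s²Δ² is only sΔ²/8 when s ≤ 1/8.
  · rw [min_eq_left (Real.exp_le_one_iff.2 (by linarith)), max_eq_left h]
    have h2 : Real.exp (-Δ) ≤ 1 - Δ / 2 := by
      have h3 := Real.add_one_le_exp Δ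
      have h4 : Real.exp (-Δ) * Real.exp Δ = 1 := by rw [← Real.exp_add]; simp
      have h5 := Real.exp_pos (-Δ)
      have h6 : Real.exp (-Δ) * (1 + Δ) ≤ 1 := by nlinarith
      nlinarith [mul_nonneg h (sub_nonneg.2 hΔu)]
    have h7 : 0 ≤ Real.exp (s * Δ) - 1 := by
      have := Real.add_one_le_exp (s * Δ)
      nlinarith
    have h8 : 0 ≤ 1 - Δ / 2 := by linarith
    calc _ ≤ (1 - Δ / 2) * (s * Δ + (s * Δ) ^ 2) := by
          refine mul_le_mul h2 h1 h7 h8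
      _ ≤ _ := by
          have := mul_nonneg (mul_nonneg hs.le (sq_nonneg Δ)) (by linarith : 0 ≤ 1 / 8 - s)
          have := mul_nonneg (mul_nonneg (sq_nonneg s) (sq_nonneg Δ)) h
          nlinarith

/-- Opposite moves change the potential by about ℓ and -ℓ, so the linear terms cancel. The uphill
move contributes -ℓ²/2 from rejections and the two convexity terms contribute +ℓ²/4, leaving -ℓ²/4.
This surviving term is the source of the drift. -/
lemma pair_gain_le {s ℓ ε a b : ℝ} (hs : 0 < s) (hs8 : s ≤ 1 / 8) (hε : ε ≤ 1 / 2)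
    (hℓ : |ℓ| ≤ 1 / 2) (ha : |a - ℓ| ≤ ε) (hb : |b + ℓ| ≤ ε) :
    min (Real.exp (-a)) 1 * (Real.exp (s * a) - 1) + min (Real.exp (-b)) 1 * (Real.exp (s * b) - 1)
      ≤ s * (-(ℓ ^ 2 / 4) + 4 * ε) := by
  wlog h0 : 0 ≤ ℓ generalizing ℓ a b
  · have := this (ℓ := -ℓ) (a := b) (b := a) (by rwa [abs_neg]) (by rwa [sub_neg_eq_add])
      (by rwa [← sub_eq_add_neg]) (by linarith)
    rw [neg_sq, add_comm] at this
    exact this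
  obtain ⟨a1, a2⟩ := abs_le.1 ha
  obtain ⟨b1, b2⟩ := abs_le.1 hb
  obtain ⟨l1, l2⟩ := abs_le.1 hℓ
  have hε0 : 0 ≤ ε := (abs_nonneg _).trans ha
  have ha1 : |a| ≤ 1 := by rw [abs_le]; constructor <;> linarith
  have hb1 : |b| ≤ 1 := by rw [abs_le]; constructor <;> linarith
  have h1 := accept_mul_exp_sub_one_le hs hs8 ha1
  have h2 := accept_mul_exp_sub_one_le hs hs8 hb1
  have ha2 : a ^ 2 ≤ (ℓ + ε) ^ 2 := sq_le_sq' (by linarith) (by linarith)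
  have hb2 : b ^ 2 ≤ (ℓ + ε) ^ 2 := sq_le_sq' (by linarith) (by linarith)
  have hmax : ℓ ^ 2 - 2 * ℓ * ε ≤ max a 0 ^ 2 := by
    rcases le_total ℓ ε with h | h
    · nlinarith [sq_nonneg (max a 0)]
    · have : (ℓ - ε) ^ 2 ≤ max a 0 ^ 2 := by
        refine pow_le_pow_left₀ (by linarith) ?_ 2
        exact le_max_of_le_left (by linarith)
      nlinarith
  have hmb := sq_nonneg (max b 0)
  have key : a + b + ((a ^ 2 + b ^ 2) / 8 - (max a 0 ^ 2 + max b 0 ^ 2) / 2)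
      ≤ -(ℓ ^ 2 / 4) + 4 * ε := by nlinarith
  nlinarith

lemma accept_mul_exp_sub_one_le_of_abs_le {s Δ : ℝ} (hs : 0 < s) (hΔ : |s * Δ| ≤ 1) :
    min (Real.exp (-Δ)) 1 * (Real.exp (s * Δ) - 1) ≤ s * Δ + s ^ 2 * Δ ^ 2 := by
  have h1 := exp_sub_one_le hΔ
  rcases le_total Δ 0 with h | h
  · rw [min_eq_right (Real.one_le_exp (by linarith))]
    linarith
  · have h2 : 0 ≤ Real.exp (s * Δ) - 1 := by
      have := Real.add_one_le_exp (s * Δ)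
      nlinarith
    have h3 := mul_le_mul_of_nonneg_right (min_le_right (Real.exp (-Δ)) 1) h2
    linarith

/-- The linear terms again cancel, but no smallness of s itself is required, only of s times the
potential change. No gain is claimed; the estimate serves the moment growth with the large exponent
of the lower bound. -/
lemma pair_growth_le {s ℓ ε a b : ℝ} (hs : 0 < s) (hε : s * (|ℓ| + ε) ≤ 1) (ha : |a - ℓ| ≤ ε)
    (hb : |b + ℓ| ≤ ε) :
    min (Real.exp (-a)) 1 * (Real.exp (s * a) - 1) + min (Real.exp (-b)) 1 * (Real.exp (s * b) - 1)
      ≤ 2 * s * ε + 2 * s ^ 2 * (|ℓ| + ε) ^ 2 := by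
  have ha1 : |a| ≤ |ℓ| + ε := by
    have := abs_add_le (a - ℓ) ℓ
    rw [sub_add_cancel] at this
    linarith
  have hb1 : |b| ≤ |ℓ| + ε := by
    have := abs_sub (b + ℓ) ℓ
    rw [add_sub_cancel_right] at this
    linarith
  have hs' : ∀ {t}, |t| ≤ |ℓ| + ε → |s * t| ≤ 1 := fun {t} ht => by
    rw [abs_mul, abs_of_pos hs]
    exact (mul_le_mul_of_nonneg_left ht hs.le).trans hε
  have h1 := accept_mul_exp_sub_one_le_of_abs_le hs (hs' ha1)
  have h2 := accept_mul_exp_sub_one_le_of_abs_le hs (hs' hb1)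
  have ha2 : a ^ 2 ≤ (|ℓ| + ε) ^ 2 := sq_le_sq' (by linarith [neg_abs_le a]) (by linarith [le_abs_self a])
  have hb2 : b ^ 2 ≤ (|ℓ| + ε) ^ 2 := sq_le_sq' (by linarith [neg_abs_le b]) (by linarith [le_abs_self b])
  have h3 := (abs_le.1 ha).2
  have h4 := (abs_le.1 hb).2
  have h5 : s * (a + b) ≤ s * (2 * ε) := mul_le_mul_of_nonneg_left (by linarith) hs.le
  have h6 := mul_le_mul_of_nonneg_left (add_le_add ha2 hb2) (sq_nonneg s)
  nlinarith

end Scalar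

end AdaptiveRWM

/-! ### Nondegeneracy of the proposal and pairing of opposite moves -/

namespace AdaptiveRWM

variable {d : ℕ}

namespace Model

variable (M : Model d)

/-- The proposal is nondegenerate in every direction. -/
lemma exists_inner_sq_lower : ∃ c > (0 : ℝ), ∀ w : E d,
    c * ‖w‖ ^ 2 ≤ ∫ ξ, inner ℝ w ξ ^ 2 ∂M.proposal := by
  obtain ⟨p, hp0, hp1, hp⟩ := M.exists_proposal_lower
  have hρ := M.rho_pos
  set v := volume (Metric.closedBall (0 : E d) (M.rho / 4)) with hv
  have hv0 : v ≠ 0 := (Metric.measure_closedBall_pos volume _ (by positivity)).ne'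
  have hv1 : v ≠ ∞ := measure_closedBall_lt_top.ne
  refine ⟨(p * v).toReal * (M.rho / 4) ^ 2,
    mul_pos (ENNReal.toReal_pos (mul_ne_zero hp0 hv0) (ENNReal.mul_ne_top hp1 hv1)) (by positivity),
    fun w => ?_⟩
  have hm : Measurable fun ξ : E d => inner ℝ w ξ ^ 2 := by fun_prop
  rw [integral_eq_lintegral_of_nonneg_ae (Eventually.of_forall fun ξ => sq_nonneg _)
    hm.aestronglyMeasurable]
  have hfin : ∫⁻ ξ, ENNReal.ofReal (inner ℝ w ξ ^ 2) ∂M.proposal ≠ ∞ := by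
    refine ne_top_of_le_ne_top (b := ∫⁻ _, ENNReal.ofReal ((‖w‖ * M.rho) ^ 2) ∂M.proposal)
      (by simp) (lintegral_mono_ae ?_)
    filter_upwards [M.ae_norm_le_proposal] with ξ hξ
    refine ENNReal.ofReal_le_ofReal ?_
    rw [← sq_abs]
    have := (abs_real_inner_le_norm w ξ).trans (by gcongr : ‖w‖ * ‖ξ‖ ≤ ‖w‖ * M.rho)
    gcongr
  rcases eq_or_ne w 0 with rfl | hw
  · simp
  have hwn : 0 < ‖w‖ := norm_pos_iff.2 hw
  -- The ball of radius ρ/4 around this point, at distance ρ/2 in the direction of w, lies in the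
  -- support of the proposal. On it the inner product with w is at least ‖w‖ρ/4.
  set z : E d := (M.rho / (2 * ‖w‖)) • w with hz
  have hzn : ‖z‖ = M.rho / 2 := by
    rw [hz, norm_smul, Real.norm_eq_abs, abs_of_pos (by positivity)]
    field_simp
  have hwz : inner ℝ w z = ‖w‖ * (M.rho / 2) := by
    rw [hz, inner_smul_right, real_inner_self_eq_norm_sq]
    field_simp
  have hsub : Metric.closedBall z (M.rho / 4) ⊆ Metric.closedBall 0 M.rho := by
    intro ξ hξ
    have h1 : ‖ξ - z‖ ≤ M.rho / 4 := by simpa [dist_eq_norm] using hξ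
    have h2 := norm_add_le (ξ - z) z
    rw [sub_add_cancel] at h2
    simp only [Metric.mem_closedBall, dist_zero_right]
    linarith
  have hlow : ENNReal.ofReal ((p * v).toReal * (M.rho / 4) ^ 2 * ‖w‖ ^ 2)
      ≤ ∫⁻ ξ, ENNReal.ofReal (inner ℝ w ξ ^ 2) ∂M.proposal := by
    refine le_trans ?_ (hp _ (ENNReal.measurable_ofReal.comp hm))
    calc ENNReal.ofReal ((p * v).toReal * (M.rho / 4) ^ 2 * ‖w‖ ^ 2)
        = p * ∫⁻ _ in Metric.closedBall z (M.rho / 4), ENNReal.ofReal ((M.rho / 4 * ‖w‖) ^ 2) := by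
          rw [setLIntegral_const, Measure.addHaar_closedBall_center, ← hv, mul_assoc,
            ENNReal.ofReal_mul ENNReal.toReal_nonneg, ENNReal.ofReal_toReal
            (ENNReal.mul_ne_top hp1 hv1), mul_pow]
          ring
      _ ≤ p * ∫⁻ ξ in Metric.closedBall z (M.rho / 4), ENNReal.ofReal (inner ℝ w ξ ^ 2) := by
          refine mul_le_mul_right ?_ _
          refine setLIntegral_mono (ENNReal.measurable_ofReal.comp hm) fun ξ hξ => ?_
          refine ENNReal.ofReal_le_ofReal ?_
          have h1 : ‖ξ - z‖ ≤ M.rho / 4 := by simpa [dist_eq_norm] using hξ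
          have h2 : inner ℝ w ξ = inner ℝ w z + inner ℝ w (ξ - z) := by
            rw [← inner_add_right, add_sub_cancel]
          have h3 := neg_le_of_abs_le ((abs_real_inner_le_norm w (ξ - z)).trans
            (by gcongr : ‖w‖ * ‖ξ - z‖ ≤ ‖w‖ * (M.rho / 4)))
          refine pow_le_pow_left₀ (by positivity) ?_ 2
          rw [h2, hwz]
          nlinarith
      _ ≤ _ := mul_le_mul_right (lintegral_mono_set hsub) _
  exact (ENNReal.ofReal_le_iff_le_toReal hfin).1 hlow

lemma integrable_proposal_of_bound {G : E d → ℝ} (hG : Measurable G) {B : ℝ}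
    (hB : ∀ ξ, ‖ξ‖ ≤ M.rho → |G ξ| ≤ B) : Integrable G M.proposal := by
  refine Integrable.of_bound hG.aestronglyMeasurable B ?_
  filter_upwards [M.ae_norm_le_proposal] with ξ hξ
  exact hB ξ hξ

lemma accept_pos (x y : E d) : 0 < M.accept x y := lt_min (Real.exp_pos _) one_pos

lemma accept_le_one (x y : E d) : M.accept x y ≤ 1 := min_le_right _ _

lemma lintegral_kernel_ofReal (γ : M.Param) (x : E d) {h : E d → ℝ} (hm : Measurable h)
    (h0 : ∀ y, 0 ≤ h y) :
    ∫⁻ y, ENNReal.ofReal (h y) ∂M.kernel (γ, x) = ∫⁻ ξ, ENNReal.ofReal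
      (h x + M.accept x (M.move γ x ξ) * (h (M.move γ x ξ) - h x)) ∂M.proposal := by
  rw [M.lintegral_kernel γ x (h := fun y => ENNReal.ofReal (h y)) (ENNReal.measurable_ofReal.comp hm)]
  refine lintegral_congr fun ξ => ?_
  have h1 := M.accept_pos x (M.move γ x ξ)
  have h2 := M.accept_le_one x (M.move γ x ξ)
  rw [acceptMove, ← ENNReal.ofReal_one, ← ENNReal.ofReal_sub _ h1.le, ← ENNReal.ofReal_mul (h0 _),
    ← ENNReal.ofReal_mul (h0 _), ← ENNReal.ofReal_add (mul_nonneg (h0 _) h1.le)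
    (mul_nonneg (h0 _) (by linarith))]
  congr 1
  ring

/-- Bounding the image of a function under a Metropolis kernel through pairs of opposite moves. -/
lemma lintegral_kernel_le_of_pair (γ : M.Param) (x : E d) {h : E d → ℝ} (hm : Measurable h)
    (h0 : ∀ y, 0 ≤ h y) {G : E d → ℝ} (hG : Integrable G M.proposal)
    (hpair : ∀ ξ, ‖ξ‖ ≤ M.rho →
      M.accept x (M.move γ x ξ) * (h (M.move γ x ξ) - h x)
        + M.accept x (M.move γ x (-ξ)) * (h (M.move γ x (-ξ)) - h x) ≤ 2 * (G ξ - h x)) :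
    ∫⁻ y, ENNReal.ofReal (h y) ∂M.kernel (γ, x) ≤ ENNReal.ofReal (∫ ξ, G ξ ∂M.proposal) := by
  set T : E d → ℝ := fun ξ => h x + M.accept x (M.move γ x ξ) * (h (M.move γ x ξ) - h x) with hT
  have hT0 : ∀ ξ, 0 ≤ T ξ := fun ξ => by
    have h1 := M.accept_pos x (M.move γ x ξ)
    have h2 := M.accept_le_one x (M.move γ x ξ)
    have : T ξ = (1 - M.accept x (M.move γ x ξ)) * h x
      + M.accept x (M.move γ x ξ) * h (M.move γ x ξ) := by simp only [hT]; ring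
    rw [this]
    exact add_nonneg (mul_nonneg (by linarith) (h0 _)) (mul_nonneg h1.le (h0 _))
  have hTm : Measurable T := by
    have hU := M.continuous_U.measurable
    have := M.measurable_move_right γ x
    have ha : Measurable fun ξ => M.accept x (M.move γ x ξ) := by
      unfold accept; fun_prop
    exact measurable_const.add (ha.mul ((hm.comp this).sub_const _))
  have hTm' : Measurable fun ξ => ENNReal.ofReal (T ξ) := ENNReal.measurable_ofReal.comp hTm
  have hG0 : 0 ≤ᵐ[M.proposal] G := by
    filter_upwards [M.ae_norm_le_proposal] with ξ hξ
    have h1 := hpair ξ hξ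
    have h2 := hT0 ξ
    have h3 := hT0 (-ξ)
    simp only [hT] at h2 h3
    change 0 ≤ G ξ
    linarith
  rw [M.lintegral_kernel_ofReal γ x hm h0, ofReal_integral_eq_lintegral_ofReal hG hG0]
  -- The integral is doubled and one copy is reflected by ξ ↦ -ξ, which preserves the proposal, so
  -- only the sum over opposite moves has to be bounded.
  have h2 : (2 : ℝ≥0∞) * ∫⁻ ξ, ENNReal.ofReal (T ξ) ∂M.proposal
      ≤ 2 * ∫⁻ ξ, ENNReal.ofReal (G ξ) ∂M.proposal := by
    rw [two_mul]
    conv_lhs => arg 2; rw [← M.lintegral_proposal_neg hTm']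
    rw [← lintegral_add_left hTm', ← lintegral_const_mul' _ _ (by simp)]
    refine lintegral_mono_ae ?_
    filter_upwards [M.ae_norm_le_proposal] with ξ hξ
    have h2G : (2 : ℝ≥0∞) * ENNReal.ofReal (G ξ) = ENNReal.ofReal (2 * G ξ) := by
      rw [ENNReal.ofReal_mul zero_le_two, ENNReal.ofReal_ofNat]
    rw [← ENNReal.ofReal_add (hT0 _) (hT0 _), h2G]
    refine ENNReal.ofReal_le_ofReal ?_
    have := hpair ξ hξ
    simp only [hT]
    linarith
  exact (ENNReal.mul_le_mul_iff_right (by simp) (by simp)).1 h2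

end Model

end AdaptiveRWM

/-! ### Growth and drift of the exponential Lyapunov functions -/

namespace AdaptiveRWM

variable {d : ℕ}

lemma tendsto_rpow_norm_zero {a : ℝ} (ha : a < 0) {c : ℝ} (hc : 0 < c) :
    ∃ R > (0 : ℝ), ∀ p : ℝ, R ≤ p → p ^ a ≤ c := by
  have h := (tendsto_rpow_neg_atTop (neg_pos.2 ha)).eventually_le_const hc
  rw [neg_neg] at h
  obtain ⟨R, hR⟩ := eventually_atTop.1 h
  exact ⟨max R 1, by positivity, fun p hp => hR p (le_of_max_le_left hp)⟩

namespace Model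

variable (M : Model d)

/-- The exponential Lyapunov function `exp(s U)`. -/
noncomputable def lyap (s : ℝ) (x : E d) : ℝ := Real.exp (s * M.U x)

lemma lyap_pos (s : ℝ) (x : E d) : 0 < M.lyap s x := Real.exp_pos _

lemma continuous_lyap (s : ℝ) : Continuous (M.lyap s) := by
  have := M.continuous_U
  unfold lyap
  fun_prop

lemma lyap_sub (s : ℝ) (x y : E d) :
    M.lyap s y - M.lyap s x = M.lyap s x * (Real.exp (s * (M.U y - M.U x)) - 1) := by
  unfold lyap
  rw [mul_sub, mul_one, ← Real.exp_add]
  ring_nf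

/-- On a bounded set the image of the Lyapunov function under the kernels is bounded. -/
lemma exists_lintegral_lyap_le (s R : ℝ) : ∃ B > (0 : ℝ), ∀ (γ : M.Param) (x : E d), ‖x‖ ≤ R →
    ∫⁻ y, ENNReal.ofReal (M.lyap s y) ∂M.kernel (γ, x) ≤ ENNReal.ofReal B := by
  obtain ⟨B, hB⟩ := (isCompact_closedBall (0 : E d) (R + √M.lamMax * M.rho)).bddAbove_image
    (M.continuous_lyap s).continuousOn
  refine ⟨max B 1, by positivity, fun γ x hx => ?_⟩
  calc ∫⁻ y, ENNReal.ofReal (M.lyap s y) ∂M.kernel (γ, x)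
      ≤ ∫⁻ _, ENNReal.ofReal (max B 1) ∂M.kernel (γ, x) := by
        refine lintegral_mono_ae ?_
        filter_upwards [M.ae_norm_sub_le_kernel γ x] with y hy
        refine ENNReal.ofReal_le_ofReal (le_max_of_le_left (hB ⟨y, ?_, rfl⟩))
        have h2 := norm_add_le (y - x) x
        rw [sub_add_cancel] at h2
        simp only [Metric.mem_closedBall, dist_zero_right]
        linarith
    _ = _ := by simp

variable {M} {m : ℝ}

/-- Potential differences along opposite moves far from the origin. -/
lemma exists_pair_taylor (hm₁ : m < 1) (hU : Regularity m M.U) :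
    ∃ R > (0 : ℝ), ∃ B > (0 : ℝ), ∃ D > (0 : ℝ), ∃ k > (0 : ℝ), ∀ (γ : M.Param) (x : E d), R ≤ ‖x‖ →
      1 ≤ ‖x‖ ∧ k * ‖x‖ ^ (m - 1) ≤ ‖M.scale γ (gradient M.U x)‖ ∧ ∀ ξ, ‖ξ‖ ≤ M.rho →
        |inner ℝ (M.scale γ (gradient M.U x)) ξ| ≤ D * ‖x‖ ^ (m - 1) ∧
        |M.U (M.move γ x ξ) - M.U x - inner ℝ (M.scale γ (gradient M.U x)) ξ|
          ≤ B * ‖x‖ ^ (m - 2) ∧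
        |M.U (M.move γ x (-ξ)) - M.U x + inner ℝ (M.scale γ (gradient M.U x)) ξ|
          ≤ B * ‖x‖ ^ (m - 2) := by
  have hL : 0 < √M.lamMax * M.rho := mul_pos (Real.sqrt_pos.2 M.lamMax_pos) M.rho_pos
  obtain ⟨R₀, hR₀, B, hB, hT⟩ := hU.exists_taylor hm₁ hL
  obtain ⟨R, hR, d₁, hd₁, D₁, hD₁, d₂, hd₂, D₂, hD₂, d₃, hd₃, D₃, hD₃, r, hr, hgr⟩ := hU.growth
  refine ⟨max (max R₀ R) 1, by positivity, B, hB, √M.lamMax * D₂ * M.rho,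
    mul_pos (mul_pos (Real.sqrt_pos.2 M.lamMax_pos) hD₂) M.rho_pos, √M.lamMin * d₂,
    mul_pos (Real.sqrt_pos.2 M.lamMin_pos) hd₂, fun γ x hx => ?_⟩
  have hx1 : 1 ≤ ‖x‖ := (le_max_right _ _).trans hx
  have hxR₀ : R₀ ≤ ‖x‖ := ((le_max_left _ _).trans (le_max_left _ _)).trans hx
  have hxR : R ≤ ‖x‖ := ((le_max_right _ _).trans (le_max_left _ _)).trans hx
  obtain ⟨-, ⟨hg1, hg2⟩, -⟩ := hgr x hxR
  refine ⟨hx1, ?_, fun ξ hξ => ⟨?_, ?_, ?_⟩⟩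
  · rw [mul_assoc]
    exact (mul_le_mul_of_nonneg_left hg1 (Real.sqrt_nonneg _)).trans (M.norm_scale_ge γ _)
  · calc |inner ℝ (M.scale γ (gradient M.U x)) ξ| ≤ ‖M.scale γ (gradient M.U x)‖ * ‖ξ‖ :=
          abs_real_inner_le_norm _ _
      _ ≤ (√M.lamMax * (D₂ * ‖x‖ ^ (m - 1))) * M.rho := by
          gcongr
          exact (M.norm_scale_le γ _).trans (by gcongr)
      _ = _ := by ring
  · rw [inner_scale_left, move_eq]
    exact hT x _ hxR₀ (M.norm_scale_le_of_norm_le hξ)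
  · have := hT x (M.scale γ (-ξ)) hxR₀ (M.norm_scale_le_of_norm_le (by simpa using hξ))
    rw [inner_scale_left, move_eq]
    rwa [map_neg, inner_neg_right, sub_neg_eq_add, ← map_neg] at this

lemma accept_mul_lyap_sub (s : ℝ) (x y : E d) :
    M.accept x y * (M.lyap s y - M.lyap s x) = M.lyap s x *
      (min (Real.exp (-(M.U y - M.U x))) 1 * (Real.exp (s * (M.U y - M.U x)) - 1)) := by
  rw [lyap_sub, accept, neg_sub]
  ring

/-- The exponential Lyapunov functions grow slowly far from the origin. -/
lemma exists_growth (hm₀ : 0 < m) (hm₁ : m < 1) (hU : Regularity m M.U) {s : ℝ} (hs : 0 < s) :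
    ∃ R > (0 : ℝ), ∃ C > (0 : ℝ), ∀ (γ : M.Param) (x : E d), R ≤ ‖x‖ →
      ∫⁻ y, ENNReal.ofReal (M.lyap s y) ∂M.kernel (γ, x)
        ≤ ENNReal.ofReal (M.lyap s x * (1 + C * ‖x‖ ^ (2 * (m - 1)))) := by
  obtain ⟨R, hR, B, hB, D, hD, k, hk, h⟩ := M.exists_pair_taylor hm₁ hU
  obtain ⟨R', hR', hsmall⟩ := tendsto_rpow_norm_zero (a := m - 1) (by linarith)
    (c := 1 / (s * (D + B))) (by positivity)
  refine ⟨max R R', by positivity, s * B + s ^ 2 * (D + B) ^ 2, by positivity, fun γ x hx => ?_⟩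
  obtain ⟨hx1, -, hpair⟩ := h γ x ((le_max_left _ _).trans hx)
  have hq := hsmall ‖x‖ ((le_max_right _ _).trans hx)
  have hx0 : 0 < ‖x‖ := by linarith
  set q := ‖x‖ ^ (m - 1) with hqdef
  have hq0 : 0 < q := by positivity
  have hqq : ‖x‖ ^ (2 * (m - 1)) = q ^ 2 := by
    rw [hqdef, ← Real.rpow_natCast, ← Real.rpow_mul hx0.le]; congr 1; push_cast; ring
  -- Since m - 2 ≤ 2(m - 1), the Hessian remainder is no larger than the order of the squared
  -- gradient.
  have hε : ‖x‖ ^ (m - 2) ≤ q ^ 2 := by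
    rw [← hqq]; exact Real.rpow_le_rpow_of_exponent_le hx1 (by linarith)
  have hε' : ‖x‖ ^ (m - 2) ≤ q := Real.rpow_le_rpow_of_exponent_le hx1 (by linarith)
  have hV := M.lyap_pos s x
  refine (M.lintegral_kernel_le_of_pair γ x (M.continuous_lyap s).measurable
    (fun y => (M.lyap_pos s y).le) (G := fun _ => M.lyap s x *
      (1 + (s * B + s ^ 2 * (D + B) ^ 2) * ‖x‖ ^ (2 * (m - 1)))) (integrable_const _) ?_).trans
        (by simp)
  intro ξ hξ
  obtain ⟨h1, h2, h3⟩ := hpair ξ hξ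
  have hle : |inner ℝ (M.scale γ (gradient M.U x)) ξ| + B * ‖x‖ ^ (m - 2) ≤ (D + B) * q := by
    have := mul_le_mul_of_nonneg_left hε' hB.le
    linarith
  have hle1 : s * (|inner ℝ (M.scale γ (gradient M.U x)) ξ| + B * ‖x‖ ^ (m - 2)) ≤ 1 := by
    refine (mul_le_mul_of_nonneg_left hle hs.le).trans ?_
    rw [le_div_iff₀ (by positivity)] at hq
    linarith
  have h4 := pair_growth_le hs hle1 h2 h3
  rw [accept_mul_lyap_sub, accept_mul_lyap_sub, ← mul_add]
  have h5 : (|inner ℝ (M.scale γ (gradient M.U x)) ξ| + B * ‖x‖ ^ (m - 2)) ^ 2 ≤ ((D + B) * q) ^ 2 :=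
    pow_le_pow_left₀ (by positivity) hle 2
  have h6 : 2 * s * (B * ‖x‖ ^ (m - 2))
      + 2 * s ^ 2 * (|inner ℝ (M.scale γ (gradient M.U x)) ξ| + B * ‖x‖ ^ (m - 2)) ^ 2
      ≤ 2 * ((s * B + s ^ 2 * (D + B) ^ 2) * q ^ 2) := by
    have h7 := mul_le_mul_of_nonneg_left hε (by positivity : 0 ≤ 2 * s * B)
    have h8 := mul_le_mul_of_nonneg_left h5 (by positivity : 0 ≤ 2 * s ^ 2)
    nlinarith
  calc _ ≤ M.lyap s x * (2 * ((s * B + s ^ 2 * (D + B) ^ 2) * q ^ 2)) := by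
        gcongr
        exact h4.trans h6
    _ = _ := by rw [hqq]; ring

/-- The simultaneous subgeometric drift condition. -/
lemma exists_drift (hm₀ : 0 < m) (hm₁ : m < 1) (hU : Regularity m M.U) {s : ℝ} (hs : 0 < s)
    (hs8 : s ≤ 1 / 8) : ∃ c > (0 : ℝ), ∃ K > (0 : ℝ), c ≤ 1 ∧ ∀ (γ : M.Param) (x : E d),
      ∫⁻ y, ENNReal.ofReal (M.lyap s y) ∂M.kernel (γ, x)
        ≤ ENNReal.ofReal (M.lyap s x - c * M.lyap s x * (1 + ‖x‖) ^ (2 * (m - 1)) + K) := by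
  obtain ⟨R, hR, B, hB, D, hD, k, hk, h⟩ := M.exists_pair_taylor hm₁ hU
  obtain ⟨c₀, hc₀, hinner⟩ := M.exists_inner_sq_lower
  -- The three radii make the linear term at most 1/2, make the Taylor remainder at most 1/2, and
  -- make the remainder a small fraction of the squared gradient, using ‖x‖^(m-2) = ‖x‖^(-m)
  -- ‖x‖^(2(m-1)).
  obtain ⟨R₁, hR₁, hsm₁⟩ := tendsto_rpow_norm_zero (a := m - 1) (by linarith)
    (c := 1 / (2 * D)) (by positivity)
  obtain ⟨R₂, hR₂, hsm₂⟩ := tendsto_rpow_norm_zero (a := m - 2) (by linarith)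
    (c := 1 / (2 * B)) (by positivity)
  obtain ⟨R₃, hR₃, hsm₃⟩ := tendsto_rpow_norm_zero (a := -m) (by linarith)
    (c := c₀ * k ^ 2 / (32 * B)) (by positivity)
  set R' := max (max R R₁) (max R₂ R₃) with hR'
  obtain ⟨K, hK, hcomp⟩ := M.exists_lintegral_lyap_le s R'
  -- The averaged gain is s c₀k²/8 times the squared scale ‖x‖^(2(m-1)), and the remainder uses up
  -- at most half of it. Taking the minimum with 1 keeps V minus its drift nonnegative.
  set c₁ := s * c₀ * k ^ 2 / 16 with hc₁
  have hc₁pos : 0 < c₁ := by positivity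
  refine ⟨min c₁ 1, by positivity, K, hK, min_le_right _ _, fun γ x => ?_⟩
  have hV := M.lyap_pos s x
  have hbase : 0 < 1 + ‖x‖ := by positivity
  rcases le_total ‖x‖ R' with hx | hx
  · refine (hcomp γ x hx).trans (ENNReal.ofReal_le_ofReal ?_)
    have h1 : (1 + ‖x‖) ^ (2 * (m - 1)) ≤ 1 :=
      Real.rpow_le_one_of_one_le_of_nonpos (by linarith [norm_nonneg x]) (by linarith)
    have h2 : min c₁ 1 * M.lyap s x * (1 + ‖x‖) ^ (2 * (m - 1)) ≤ 1 * M.lyap s x * 1 := by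
      gcongr
      exact min_le_right _ _
    linarith
  · have hxR : R ≤ ‖x‖ := ((le_max_left _ _).trans (le_max_left _ _)).trans hx
    obtain ⟨hx1, hgl, hpair⟩ := h γ x hxR
    have hx0 : 0 < ‖x‖ := by linarith
    have hq := hsm₁ ‖x‖ (((le_max_right _ _).trans (le_max_left _ _)).trans hx)
    have hp2 := hsm₂ ‖x‖ (((le_max_left _ _).trans (le_max_right _ _)).trans hx)
    have hpm := hsm₃ ‖x‖ (((le_max_right _ _).trans (le_max_right _ _)).trans hx)
    set q := ‖x‖ ^ (m - 1) with hqdef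
    have hq0 : 0 < q := by positivity
    have hqq : ‖x‖ ^ (2 * (m - 1)) = q ^ 2 := by
      rw [hqdef, ← Real.rpow_natCast, ← Real.rpow_mul hx0.le]; congr 1; push_cast; ring
    have hε : B * ‖x‖ ^ (m - 2) ≤ c₀ * k ^ 2 / 32 * q ^ 2 := by
      have : ‖x‖ ^ (m - 2) = ‖x‖ ^ (-m) * q ^ 2 := by
        rw [← hqq, ← Real.rpow_add hx0]; congr 1; ring
      rw [this]
      calc B * (‖x‖ ^ (-m) * q ^ 2) ≤ B * (c₀ * k ^ 2 / (32 * B) * q ^ 2) := by gcongr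
        _ = _ := by field_simp
    have hε2 : B * ‖x‖ ^ (m - 2) ≤ 1 / 2 := by
      rw [le_div_iff₀ (by positivity)] at hp2
      linarith
    set w := M.scale γ (gradient M.U x) with hw
    have hGm : Measurable fun ξ : E d => inner ℝ w ξ ^ 2 := by fun_prop
    have hGi : Integrable (fun ξ : E d => inner ℝ w ξ ^ 2) M.proposal := by
      refine M.integrable_proposal_of_bound hGm (B := (D * q) ^ 2) fun ξ hξ => ?_
      rw [abs_of_nonneg (sq_nonneg _), ← sq_abs]
      exact pow_le_pow_left₀ (abs_nonneg _) (hpair ξ hξ).1 2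
    have hGi' : Integrable (fun ξ : E d => M.lyap s x *
        (1 + s * (2 * (B * ‖x‖ ^ (m - 2))) - s / 8 * inner ℝ w ξ ^ 2)) M.proposal :=
      ((integrable_const _).sub (hGi.const_mul _)).const_mul _
    refine (M.lintegral_kernel_le_of_pair γ x (M.continuous_lyap s).measurable
      (fun y => (M.lyap_pos s y).le) hGi' ?_).trans (ENNReal.ofReal_le_ofReal ?_)
    · intro ξ hξ
      obtain ⟨h1, h2, h3⟩ := hpair ξ hξ
      have hℓ : |inner ℝ w ξ| ≤ 1 / 2 := by
        rw [le_div_iff₀ (by positivity)] at hq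
        linarith
      have h4 := pair_gain_le hs hs8 hε2 hℓ h2 h3
      rw [accept_mul_lyap_sub, accept_mul_lyap_sub, ← mul_add]
      refine (mul_le_mul_of_nonneg_left h4 hV.le).trans (le_of_eq ?_)
      ring
    · rw [integral_const_mul, integral_sub (integrable_const _) (hGi.const_mul _),
        integral_const_mul]
      simp only [integral_const, probReal_univ, smul_eq_mul, one_mul]
      have h5 : c₀ * (k ^ 2 * q ^ 2) ≤ ∫ ξ, inner ℝ w ξ ^ 2 ∂M.proposal := by
        refine le_trans ?_ (hinner w)
        rw [← mul_pow]
        gcongr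
      have h6 : (1 + ‖x‖) ^ (2 * (m - 1)) ≤ q ^ 2 := by
        rw [← hqq]
        exact Real.rpow_le_rpow_of_nonpos hx0 (by linarith) (by linarith)
      have h7 : min c₁ 1 * M.lyap s x * (1 + ‖x‖) ^ (2 * (m - 1)) ≤ c₁ * M.lyap s x * q ^ 2 := by
        gcongr
        exact min_le_left _ _
      have h8 : 1 + s * (2 * (B * ‖x‖ ^ (m - 2))) - s / 8 * ∫ ξ, inner ℝ w ξ ^ 2 ∂M.proposal
          ≤ 1 - c₁ * q ^ 2 := by
        have := mul_le_mul_of_nonneg_left h5 hs.le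
        have := mul_le_mul_of_nonneg_left hε hs.le
        rw [hc₁]
        nlinarith
      have h9 := mul_le_mul_of_nonneg_left h8 hV.le
      linarith

end Model

end AdaptiveRWM

/-! ### Iterated kernels: drift and minorization uniform in the tuning matrix -/

namespace AdaptiveRWM

variable {d : ℕ}

section KernelPow

variable {X : Type*} [MeasurableSpace X] (κ : Kernel X X)

instance isMarkovKernel_pow [IsMarkovKernel κ] (n : ℕ) : IsMarkovKernel (κ ^ n) := by
  induction n with
  | zero => exact inferInstanceAs (IsMarkovKernel (Kernel.id : Kernel X X))
  | succ n ih => rw [pow_succ]; exact inferInstanceAs (IsMarkovKernel ((κ ^ n) ∘ₖ κ))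

lemma lintegral_pow_zero {f : X → ℝ≥0∞} (hf : Measurable f) (x : X) :
    ∫⁻ y, f y ∂(κ ^ 0) x = f x := by
  have : (κ ^ 0) x = Measure.dirac x := by
    rw [pow_zero]; exact Kernel.id_apply x
  rw [this, lintegral_dirac' _ hf]

lemma lintegral_pow_succ {f : X → ℝ≥0∞} (hf : Measurable f) (n : ℕ) (x : X) :
    ∫⁻ y, f y ∂(κ ^ (n + 1)) x = ∫⁻ z, ∫⁻ y, f y ∂(κ ^ n) z ∂κ x := by
  rw [pow_succ]
  exact Kernel.lintegral_comp (κ ^ n) κ x hf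

lemma lintegral_pow_succ' {f : X → ℝ≥0∞} (hf : Measurable f) (n : ℕ) (x : X) :
    ∫⁻ y, f y ∂(κ ^ (n + 1)) x = ∫⁻ z, ∫⁻ y, f y ∂κ z ∂(κ ^ n) x := by
  rw [pow_succ']
  exact Kernel.lintegral_comp κ (κ ^ n) x hf

variable {κ} [IsMarkovKernel κ]

lemma lintegral_pow_le {V : X → ℝ} (hVm : Measurable V) (hV : ∀ x, 0 ≤ V x) {K : ℝ} (hK : 0 ≤ K)
    (h : ∀ x, ∫⁻ y, ENNReal.ofReal (V y) ∂κ x ≤ ENNReal.ofReal (V x + K)) (n : ℕ) (x : X) :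
    ∫⁻ y, ENNReal.ofReal (V y) ∂(κ ^ n) x ≤ ENNReal.ofReal (V x + n * K) := by
  have hm : Measurable fun y => ENNReal.ofReal (V y) := ENNReal.measurable_ofReal.comp hVm
  induction n with
  | zero => rw [lintegral_pow_zero _ hm]; simp
  | succ n ih =>
    rw [lintegral_pow_succ' _ hm]
    calc ∫⁻ z, ∫⁻ y, ENNReal.ofReal (V y) ∂κ z ∂(κ ^ n) x
        ≤ ∫⁻ z, (ENNReal.ofReal (V z) + ENNReal.ofReal K) ∂(κ ^ n) x :=
          lintegral_mono fun z => (h z).trans_eq (ENNReal.ofReal_add (hV z) hK)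
      _ = ∫⁻ z, ENNReal.ofReal (V z) ∂(κ ^ n) x + ENNReal.ofReal K := by
          rw [lintegral_add_left hm]; simp
      _ ≤ ENNReal.ofReal (V x + n * K) + ENNReal.ofReal K := by gcongr
      _ = _ := by
          rw [← ENNReal.ofReal_add (by have := hV x; positivity) hK]
          congr 1
          push_cast
          ring

/-- Only the drift of the first step is retained; every later step costs at most K, because W ≤ V. A
single step of drift is enough for the iterate. -/
lemma lintegral_pow_succ_le_drift {V W : X → ℝ} (hVm : Measurable V) (hV : ∀ x, 0 ≤ V x) {K : ℝ}
    (hK : 0 ≤ K) (hVW : ∀ x, 0 ≤ W x ∧ W x ≤ V x)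
    (h : ∀ x, ∫⁻ y, ENNReal.ofReal (V y) ∂κ x ≤ ENNReal.ofReal (W x + K)) (n : ℕ) (x : X) :
    ∫⁻ y, ENNReal.ofReal (V y) ∂(κ ^ (n + 1)) x ≤ ENNReal.ofReal (W x + (n + 1 : ℕ) * K) := by
  have hm : Measurable fun y => ENNReal.ofReal (V y) := ENNReal.measurable_ofReal.comp hVm
  have h' : ∀ x, ∫⁻ y, ENNReal.ofReal (V y) ∂κ x ≤ ENNReal.ofReal (V x + K) := fun x =>
    (h x).trans (ENNReal.ofReal_le_ofReal (by linarith [(hVW x).2]))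
  rw [lintegral_pow_succ _ hm]
  calc ∫⁻ z, ∫⁻ y, ENNReal.ofReal (V y) ∂(κ ^ n) z ∂κ x
      ≤ ∫⁻ z, (ENNReal.ofReal (V z) + ENNReal.ofReal (n * K)) ∂κ x :=
        lintegral_mono fun z => (lintegral_pow_le hVm hV hK h' n z).trans_eq
          (ENNReal.ofReal_add (hV z) (by positivity))
    _ = ∫⁻ z, ENNReal.ofReal (V z) ∂κ x + ENNReal.ofReal (n * K) := by
        rw [lintegral_add_left hm]; simp
    _ ≤ ENNReal.ofReal (W x + K) + ENNReal.ofReal (n * K) := by gcongr; exact h x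
    _ = _ := by
        rw [← ENNReal.ofReal_add (by have := (hVW x).1; positivity) (by positivity)]
        congr 1
        push_cast
        ring

end KernelPow

namespace Model

variable (M : Model d)

/-- The Metropolis kernel with a fixed tuning matrix. -/
noncomputable def frozen (γ : M.Param) : Kernel (E d) (E d) :=
  M.kernel.comap (fun x => (γ, x)) measurable_prodMk_left

lemma frozen_apply (γ : M.Param) (x : E d) : M.frozen γ x = M.kernel (γ, x) := rfl

instance (γ : M.Param) : IsMarkovKernel (M.frozen γ) := by
  unfold frozen
  infer_instance

/-- The length of the moves that every scaled proposal can make. -/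
noncomputable def reach : ℝ := M.rho * √M.lamMin

lemma reach_pos : 0 < M.reach := mul_pos M.rho_pos (Real.sqrt_pos.2 M.lamMin_pos)

/-- The scaled weights are at most one and supported in a ball common to all tuning matrices, which
bounds the normalizing constants below. On the ball of radius `reach` every scaled weight is bounded
below by the Gaussian factor at the truncation radius. -/
lemma exists_scale_lower : ∃ p : ℝ≥0∞, p ≠ 0 ∧ ∀ (γ : M.Param) (H : E d → ℝ≥0∞), Measurable H →
    p * ∫⁻ z in Metric.closedBall 0 M.reach, H z ≤ ∫⁻ ξ, H (M.scale γ ξ) ∂M.proposal := by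
  set B := Metric.closedBall (0 : E d) (√M.lamMax * M.rho) with hB
  have hBfin : volume B ≠ ∞ := measure_closedBall_lt_top.ne
  set e := ENNReal.ofReal (Real.exp (-M.rho ^ 2 / (2 * M.sigma ^ 2))) with he
  have he0 : e ≠ 0 := (ENNReal.ofReal_pos.2 (Real.exp_pos _)).ne'
  refine ⟨(volume B)⁻¹ * e, mul_ne_zero (ENNReal.inv_ne_zero.2 hBfin) he0, fun γ H hH => ?_⟩
  obtain ⟨c, hc⟩ := M.exists_lintegral_scale γ
  have hcZ : c * ∫⁻ z, M.proposalWeight ((M.scaleEquiv γ).symm z) = 1 := by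
    have := hc 1 measurable_one
    simpa using this.symm
  have hZ : ∫⁻ z, M.proposalWeight ((M.scaleEquiv γ).symm z) ≤ volume B := by
    rw [← lintegral_indicator_one measurableSet_closedBall]
    refine lintegral_mono fun z => ?_
    by_cases h : ‖(M.scaleEquiv γ).symm z‖ ≤ M.rho
    · rw [indicator_of_mem (by simpa using M.norm_le_of_norm_scaleEquiv_symm_le h)]
      exact M.proposalWeight_le_one _
    · rw [M.proposalWeight_eq_zero (not_le.1 h)]
      exact zero_le
  have hcB : (volume B)⁻¹ ≤ c := by
    rw [ENNReal.eq_inv_of_mul_eq_one_left hcZ]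
    exact ENNReal.inv_le_inv.2 hZ
  rw [hc H hH, mul_assoc]
  refine mul_le_mul' hcB ?_
  rw [← lintegral_indicator measurableSet_closedBall,
    ← lintegral_const_mul _ (hH.indicator measurableSet_closedBall)]
  refine lintegral_mono fun z => ?_
  by_cases hz : z ∈ Metric.closedBall (0 : E d) M.reach
  · rw [indicator_of_mem hz]
    refine mul_le_mul_left (M.le_proposalWeight ((M.norm_scaleEquiv_symm_le γ z).trans ?_)) _
    rw [div_le_iff₀ (Real.sqrt_pos.2 M.lamMin_pos)]
    simpa [reach] using hz
  · rw [indicator_of_notMem hz]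
    simp

variable {M} {m : ℝ}

lemma U_nonneg (hU : Regularity m M.U) (x : E d) : 0 ≤ M.U x := by
  obtain ⟨z, hz0, hz⟩ := hU.exists_min
  rw [← hz0]
  exact hz x

/-- On a bounded set the kernels dominate a multiple of Lebesgue measure nearby. -/
lemma exists_kernel_lower (hU : Regularity m M.U) (r : ℝ) : ∃ q : ℝ≥0∞, q ≠ 0 ∧
    ∀ (γ : M.Param) (x : E d), ‖x‖ ≤ r → ∀ f : E d → ℝ≥0∞, Measurable f →
      q * ∫⁻ y in Metric.closedBall x M.reach, f y ≤ ∫⁻ y, f y ∂M.frozen γ x := by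
  obtain ⟨p, hp0, hp⟩ := M.exists_scale_lower
  obtain ⟨B, hB⟩ := (isCompact_closedBall (0 : E d) (r + √M.lamMax * M.rho)).bddAbove_image
    M.continuous_U.continuousOn
  -- A lower bound for the acceptance probability: U is nonnegative at the current state and at most
  -- B at every reachable proposal.
  set α := ENNReal.ofReal (Real.exp (-max B 0)) with hα
  have hα0 : α ≠ 0 := (ENNReal.ofReal_pos.2 (Real.exp_pos _)).ne'
  refine ⟨α * p, mul_ne_zero hα0 hp0, fun γ x hx f hf => ?_⟩
  have hfx : Measurable fun z => f (x + z) := hf.comp (measurable_const_add x)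
  have hshift : ∫⁻ y in Metric.closedBall x M.reach, f y
      = ∫⁻ z in Metric.closedBall 0 M.reach, f (x + z) := by
    rw [← lintegral_indicator measurableSet_closedBall,
      ← lintegral_indicator measurableSet_closedBall,
      ← lintegral_add_left_eq_self (fun y => (Metric.closedBall x M.reach).indicator f y) x]
    refine lintegral_congr fun z => ?_
    simp only [indicator, Metric.mem_closedBall, dist_eq_norm, add_sub_cancel_left, sub_zero]
  rw [frozen_apply, M.lintegral_kernel γ x hf, hshift, mul_assoc]
  calc α * (p * ∫⁻ z in Metric.closedBall 0 M.reach, f (x + z))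
      ≤ α * ∫⁻ ξ, f (x + M.scale γ ξ) ∂M.proposal := by gcongr; exact hp γ _ hfx
    _ = ∫⁻ ξ, α * f (x + M.scale γ ξ) ∂M.proposal := by
        rw [lintegral_const_mul]
        exact hf.comp (M.measurable_move_right γ x)
    _ ≤ _ := by
        refine lintegral_mono_ae ?_
        filter_upwards [M.ae_norm_le_proposal] with ξ hξ
        refine le_add_right ?_
        rw [mul_comm, ← move_eq]
        refine mul_le_mul_right (ENNReal.ofReal_le_ofReal (le_min (Real.exp_le_exp.2 ?_)
          (Real.exp_le_one_iff.2 (by simp)))) _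
        have h1 : M.U (M.move γ x ξ) ≤ B := by
          refine hB ⟨_, ?_, rfl⟩
          have h2 := norm_add_le x (M.scale γ ξ)
          have h3 := M.norm_scale_le_of_norm_le (γ := γ) hξ
          simp only [Metric.mem_closedBall, dist_zero_right, move_eq]
          linarith
        have h2 := U_nonneg hU x
        have h3 := le_max_left B 0
        linarith

/-- The iterated kernels are minorized on large balls, uniformly in the tuning matrix. -/
lemma exists_pow_lower (hU : Regularity m M.U) (N : ℕ) (hN : 0 < N) : ∃ q : ℝ≥0∞, q ≠ 0 ∧ q ≠ ∞ ∧
    ∀ (γ : M.Param) (x : E d), ‖x‖ ≤ N * (M.reach / 4) →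
      q • volume.restrict (Metric.closedBall (0 : E d) (M.reach / 4)) ≤ (M.frozen γ ^ N) x := by
  have hreach := M.reach_pos
  have hN' : (0 : ℝ) < N := by exact_mod_cast hN
  obtain ⟨q, hq0, hq⟩ := exists_kernel_lower hU (N * (M.reach / 4) + M.reach / 4)
  set v := volume (Metric.closedBall (0 : E d) (M.reach / 4)) with hv
  have hv0 : v ≠ 0 := (Metric.measure_closedBall_pos volume _ (by positivity)).ne'
  -- The chain is led along the segment from x to the origin in N equal displacements of length at
  -- most a quarter of the reach. With balls of radius a quarter of the reach around the waypoints,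
  -- any point of one ball is within three quarters of the reach of any point of the next.
  have key : ∀ j : ℕ, j + 1 ≤ N → ∃ p : ℝ≥0∞, p ≠ 0 ∧ ∀ (γ : M.Param) (x : E d),
      ‖x‖ ≤ N * (M.reach / 4) → ∀ f : E d → ℝ≥0∞, Measurable f →
        p * ∫⁻ y in Metric.closedBall ((1 - ((j + 1 : ℕ) : ℝ) / N) • x) (M.reach / 4), f y
          ≤ ∫⁻ y, f y ∂(M.frozen γ ^ (j + 1)) x := by
    have hstep : ∀ (a : ℝ) (x : E d), ‖x‖ ≤ N * (M.reach / 4) →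
        ‖(a - 1 / N) • x - a • x‖ ≤ M.reach / 4 := fun a x hx => by
      rw [← sub_smul, norm_smul, Real.norm_eq_abs, sub_sub_cancel_left, abs_neg,
        abs_of_pos (by positivity), one_div, inv_mul_le_iff₀ hN']
      exact hx
    intro j
    induction j with
    | zero =>
      refine fun _ => ⟨q, hq0, fun γ x hx f hf => ?_⟩
      rw [zero_add, pow_one]
      refine le_trans (mul_le_mul_right (lintegral_mono_set fun y hy => ?_) _)
        (hq γ x (by linarith) f hf)
      have h1 := hstep 1 x hx
      rw [one_smul] at h1
      simp only [Metric.mem_closedBall, dist_eq_norm, Nat.cast_one] at hy ⊢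
      have h2 := norm_add_le (y - (1 - 1 / (N : ℝ)) • x) ((1 - 1 / (N : ℝ)) • x - x)
      rw [sub_add_sub_cancel] at h2
      linarith
    | succ j ih =>
      intro hj
      obtain ⟨p, hp0, hp⟩ := ih (by omega)
      refine ⟨p * (v * q), mul_ne_zero hp0 (mul_ne_zero hv0 hq0), fun γ x hx f hf => ?_⟩
      rw [lintegral_pow_succ' _ hf]
      have hfm : Measurable fun z => ∫⁻ y, f y ∂M.frozen γ z := hf.lintegral_kernel
      refine le_trans ?_ (hp γ x hx _ hfm)
      rw [mul_assoc]
      refine mul_le_mul_right ?_ _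
      set a : ℝ := 1 - ((j + 1 : ℕ) : ℝ) / N with ha
      have ha' : 1 - ((j + 1 + 1 : ℕ) : ℝ) / N = a - 1 / N := by rw [ha]; push_cast; ring
      have haN : ((j + 1 : ℕ) : ℝ) / N ≤ 1 := by
        rw [div_le_one hN']; exact_mod_cast (by omega : j + 1 ≤ N)
      have ha0 : 0 ≤ a := by rw [ha]; linarith
      have ha1 : a ≤ 1 := by
        have : 0 ≤ ((j + 1 : ℕ) : ℝ) / N := by positivity
        rw [ha]; linarith
      rw [ha']
      calc v * q * ∫⁻ y in Metric.closedBall ((a - 1 / N) • x) (M.reach / 4), f y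
          = ∫⁻ _ in Metric.closedBall (a • x) (M.reach / 4),
              q * ∫⁻ y in Metric.closedBall ((a - 1 / N) • x) (M.reach / 4), f y := by
            rw [setLIntegral_const, Measure.addHaar_closedBall_center, ← hv]
            ring
        _ ≤ _ := by
            refine setLIntegral_mono hfm fun z hz => ?_
            simp only [Metric.mem_closedBall, dist_eq_norm] at hz
            have h3 : ‖a • x‖ ≤ ‖x‖ := by
              rw [norm_smul, Real.norm_eq_abs, abs_of_nonneg ha0]
              exact mul_le_of_le_one_left (norm_nonneg _) ha1
            have h4 := norm_add_le (z - a • x) (a • x)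
            rw [sub_add_cancel] at h4
            refine le_trans (mul_le_mul_right (lintegral_mono_set fun y hy => ?_) _)
              (hq γ z (by linarith) f hf)
            simp only [Metric.mem_closedBall, dist_eq_norm] at hy ⊢
            have h1 := hstep a x hx
            have h5 := norm_add_le (y - (a - 1 / (N : ℝ)) • x) ((a - 1 / (N : ℝ)) • x - z)
            have h6 := norm_add_le ((a - 1 / (N : ℝ)) • x - a • x) (a • x - z)
            rw [sub_add_sub_cancel] at h5 h6
            rw [norm_sub_rev] at hz
            linarith
  obtain ⟨j, rfl⟩ : ∃ j, N = j + 1 := ⟨N - 1, by omega⟩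
  obtain ⟨p, hp0, hp⟩ := key j le_rfl
  refine ⟨min p 1, by simp [hp0], by simp, fun γ x hx => ?_⟩
  refine Measure.le_iff.2 fun s hs => ?_
  have h1 := hp γ x hx (s.indicator 1) (measurable_one.indicator hs)
  rw [lintegral_indicator_one hs, lintegral_indicator_one hs, div_self hN'.ne', sub_self,
    zero_smul] at h1
  refine le_trans ?_ h1
  rw [Measure.smul_apply, smul_eq_mul]
  exact mul_le_mul_left (min_le_left _ _) _

/-- The drift of the Lyapunov function dominates any linear function far from the origin. -/
lemma exists_drift_far (hm₀ : 0 < m) (hU : Regularity m M.U) {s c C : ℝ} (hs : 0 < s) (hc : 0 < c)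
    (hC : 0 < C) : ∃ R : ℝ, ∀ x : E d, R ≤ ‖x‖ →
      C * ‖x‖ ≤ c * M.lyap s x * (1 + ‖x‖) ^ (2 * (m - 1)) := by
  obtain ⟨R, hR, d₁, hd₁, D₁, hD₁, _, _, _, _, _, _, _, _, _, _, hgr⟩ := hU.growth
  -- The exponential must beat a cube: one power is the linear function, and the other two pay for
  -- (1+‖x‖)^(2(m-1)) ≥ 1/(4‖x‖²).
  have h1 := ((tendsto_exp_mul_div_rpow_atTop (3 / m) (s * d₁) (by positivity)).comp
    (tendsto_rpow_atTop hm₀)).eventually_ge_atTop (4 * C / c)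
  obtain ⟨R', hR'⟩ := eventually_atTop.1 h1
  refine ⟨max (max R R') 1, fun x hx => ?_⟩
  have hx1 : 1 ≤ ‖x‖ := (le_max_right _ _).trans hx
  have hxR : R ≤ ‖x‖ := ((le_max_left _ _).trans (le_max_left _ _)).trans hx
  have hx0 : 0 < ‖x‖ := by linarith
  have h2 := hR' ‖x‖ (((le_max_right _ _).trans (le_max_left _ _)).trans hx)
  simp only [Function.comp_apply] at h2
  rw [← Real.rpow_mul hx0.le, mul_div_cancel₀ _ hm₀.ne', div_le_div_iff₀ hc (by positivity)] at h2
  have h3 : Real.exp (s * d₁ * ‖x‖ ^ m) ≤ M.lyap s x := by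
    refine Real.exp_le_exp.2 ?_
    rw [mul_assoc]
    exact mul_le_mul_of_nonneg_left (hgr x hxR).1.1 hs.le
  have h4 : 1 / (4 * ‖x‖ ^ 2) ≤ (1 + ‖x‖) ^ (2 * (m - 1)) := by
    calc 1 / (4 * ‖x‖ ^ 2) = (2 * ‖x‖) ^ (-2 : ℝ) := by
          rw [Real.rpow_neg (by positivity), one_div, Real.rpow_two]; congr 1; ring
      _ ≤ (1 + ‖x‖) ^ (-2 : ℝ) :=
          Real.rpow_le_rpow_of_nonpos (by positivity) (by linarith) (by norm_num)
      _ ≤ _ := Real.rpow_le_rpow_of_exponent_le (by linarith) (by linarith)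
  have h5 : ‖x‖ ^ (3 : ℝ) = ‖x‖ ^ 3 := by
    rw [← Real.rpow_natCast]; norm_num
  rw [h5] at h2
  calc C * ‖x‖ = (4 * C * ‖x‖ ^ 3) * (1 / (4 * ‖x‖ ^ 2)) := by field_simp
    _ ≤ (c * M.lyap s x) * (1 + ‖x‖) ^ (2 * (m - 1)) := by
        refine mul_le_mul ?_ h4 (by positivity) (mul_nonneg hc.le (M.lyap_pos s x).le)
        calc _ ≤ Real.exp (s * d₁ * ‖x‖ ^ m) * c := h2
          _ ≤ _ := by rw [mul_comm]; gcongr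

lemma lyap_sq (s : ℝ) (x : E d) : M.lyap s x ^ 2 = M.lyap (2 * s) x := by
  unfold lyap
  rw [← Real.exp_nat_mul]
  congr 1
  push_cast
  ring

/-- The simultaneous drift and minorization conditions for an iterate of the kernels. -/
theorem exists_driftMinorization (hm₀ : 0 < m) (hm₁ : m < 1) (hU : Regularity m M.U) {s : ℝ}
    (hs : 0 < s) (hs16 : s ≤ 1 / 16) :
    ∃ N : ℕ, 0 < N ∧ ∃ c > (0 : ℝ), ∃ K K₂ η : ℝ, ∀ γ : M.Param, DriftMinorization
      (M.frozen γ ^ N) (M.lyap s) (fun x => c * M.lyap s x * (1 + ‖x‖) ^ (2 * (m - 1))) K K₂ η := by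
  obtain ⟨c, hc, K, hK, hc1, hdrift⟩ := exists_drift hm₀ hm₁ hU hs (by linarith)
  -- The square of V is the Lyapunov function with exponent 2s, so s ≤ 1/16 makes the drift
  -- available for it as well. It is used only to bound the growth of V² by a constant per step.
  obtain ⟨c', hc', K', hK', -, hdrift'⟩ := exists_drift hm₀ hm₁ hU (s := 2 * s) (by linarith)
    (by linarith)
  have hreach := M.reach_pos
  -- The constant of the N-step drift is NK, and the radius on which N steps minorize is also
  -- proportional to N. A drift above (32K/reach)‖x‖ far out hence exceeds 8NK outside that ball for
  -- every large N, which avoids a circular choice of N.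
  obtain ⟨R, hR⟩ := exists_drift_far hm₀ hU hs hc (C := 32 * K / M.reach) (by positivity)
  obtain ⟨n, hn⟩ := exists_nat_ge (R / (M.reach / 4))
  set N := n + 1 with hN
  have hNR : R ≤ N * (M.reach / 4) := by
    rw [div_le_iff₀ (by positivity)] at hn
    refine hn.trans ?_
    gcongr
    simp [hN]
  obtain ⟨q, hq0, hq1, hq⟩ := exists_pow_lower hU N (by omega)
  set ν := q • volume.restrict (Metric.closedBall (0 : E d) (M.reach / 4)) with hν
  have hνu : ν univ = q * volume (Metric.closedBall (0 : E d) (M.reach / 4)) := by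
    simp [hν]
  have hνfin : IsFiniteMeasure ν :=
    ⟨by rw [hνu]; exact ENNReal.mul_lt_top hq1.lt_top measure_closedBall_lt_top⟩
  have hφ0 : ∀ x : E d, 0 ≤ c * M.lyap s x * (1 + ‖x‖) ^ (2 * (m - 1)) := fun x => by
    have := M.lyap_pos s x
    positivity
  have hφV : ∀ x : E d, c * M.lyap s x * (1 + ‖x‖) ^ (2 * (m - 1)) ≤ M.lyap s x := fun x => by
    have h1 : (1 + ‖x‖) ^ (2 * (m - 1)) ≤ 1 :=
      Real.rpow_le_one_of_one_le_of_nonpos (by linarith [norm_nonneg x]) (by linarith)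
    have := M.lyap_pos s x
    calc _ ≤ 1 * M.lyap s x * 1 := by gcongr
      _ = _ := by ring
  refine ⟨N, by omega, c, hc, N * K, N * K', ν.real univ, fun γ => ?_⟩
  have hVm := (M.continuous_lyap s).measurable
  have hV2m := (M.continuous_lyap (2 * s)).measurable
  have hd1 := fun x => lintegral_pow_succ_le_drift (κ := M.frozen γ) hVm
    (fun x => (M.lyap_pos s x).le) hK.le (W := fun x => M.lyap s x
      - c * M.lyap s x * (1 + ‖x‖) ^ (2 * (m - 1)))
    (fun x => ⟨sub_nonneg.2 (hφV x), by linarith [hφ0 x]⟩) (fun x => hdrift γ x) n x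
  have hd2 := fun x => lintegral_pow_le (κ := M.frozen γ) hV2m
    (fun x => (M.lyap_pos (2 * s) x).le) hK'.le (fun x => (hdrift' γ x).trans
      (ENNReal.ofReal_le_ofReal (by
        have := M.lyap_pos (2 * s) x
        have : 0 ≤ c' * M.lyap (2 * s) x * (1 + ‖x‖) ^ (2 * (m - 1)) := by positivity
        linarith))) N x
  have hint : ∀ {V : E d → ℝ} {B : ℝ} (x : E d), Measurable V → (∀ y, 0 ≤ V y) →
      ∫⁻ y, ENNReal.ofReal (V y) ∂(M.frozen γ ^ N) x ≤ ENNReal.ofReal B →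
      Integrable V ((M.frozen γ ^ N) x) := fun x hV hV0 hB =>
    ⟨hV.aestronglyMeasurable, by
      rw [hasFiniteIntegral_iff_ofReal (Eventually.of_forall hV0)]
      exact hB.trans_lt ENNReal.ofReal_lt_top⟩
  have hle : ∀ {V : E d → ℝ} {B : ℝ} (x : E d), Measurable V → (∀ y, 0 ≤ V y) → 0 ≤ B →
      ∫⁻ y, ENNReal.ofReal (V y) ∂(M.frozen γ ^ N) x ≤ ENNReal.ofReal B →
      ∫ y, V y ∂(M.frozen γ ^ N) x ≤ B := fun x hV hV0 hB0 hB => by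
    rw [integral_eq_lintegral_of_nonneg_ae (Eventually.of_forall hV0) hV.aestronglyMeasurable]
    exact ENNReal.toReal_le_of_le_ofReal hB0 hB
  have hN0 : (0 : ℝ) < N := by positivity
  refine ⟨hVm, fun x => (M.lyap_pos s x).le, by positivity, by positivity, ?_, fun x => ?_,
    fun x => ?_, fun x => ?_, fun x => ?_, hφ0, ⟨Metric.closedBall 0 (N * (M.reach / 4)), ν, rfl,
      hνfin, fun x hx => hq γ x (by simpa using hx), fun x y hxy => ?_⟩⟩
  · refine ENNReal.toReal_pos ?_ (measure_ne_top _ _)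
    rw [hνu]
    exact mul_ne_zero hq0 (Metric.measure_closedBall_pos volume _ (by positivity)).ne'
  · exact hint x hVm (fun y => (M.lyap_pos s y).le) (hd1 x)
  · simp_rw [lyap_sq]
    exact hint x hV2m (fun y => (M.lyap_pos (2 * s) y).le) (hd2 x)
  · refine hle x hVm (fun y => (M.lyap_pos s y).le) ?_ (hd1 x)
    have := hφV x
    have : 0 ≤ N * K := by positivity
    linarith
  · simp_rw [lyap_sq]
    refine hle x hV2m (fun y => (M.lyap_pos (2 * s) y).le) ?_ (hd2 x)
    have := M.lyap_pos (2 * s) x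
    positivity
  · have hfar : ∀ z : E d, z ∉ Metric.closedBall (0 : E d) (N * (M.reach / 4)) →
        8 * (N * K) ≤ c * M.lyap s z * (1 + ‖z‖) ^ (2 * (m - 1)) := fun z hz => by
      have hz' : N * (M.reach / 4) ≤ ‖z‖ := by
        simp only [Metric.mem_closedBall, dist_zero_right, not_le] at hz
        exact hz.le
      refine le_trans ?_ (hR z (hNR.trans hz'))
      calc 8 * (N * K) = 32 * K / M.reach * (N * (M.reach / 4)) := by field_simp; norm_num
        _ ≤ _ := by gcongr
    rcases not_and_or.1 hxy with h | h
    · linarith [hfar x h, hφ0 y]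
    · linarith [hfar y h, hφ0 x]

end Model

end AdaptiveRWM

/-! ### The target: integrability and invariance -/

namespace AdaptiveRWM

variable {d : ℕ}

namespace Model

variable {M : Model d} {m : ℝ}

/-- Stretched exponentials of the potential are integrable. -/
lemma lintegral_exp_neg_lt_top (hm₀ : 0 < m) (hU : Regularity m M.U) {a : ℝ} (ha : 0 < a) :
    ∫⁻ x, ENNReal.ofReal (Real.exp (-(a * M.U x))) < ∞ := by
  obtain ⟨R, hR, d₁, hd₁, D₁, hD₁, _, _, _, _, _, _, _, _, _, _, hgr⟩ := hU.growth
  have h1 := ((tendsto_exp_mul_div_rpow_atTop (((d : ℝ) + 1) / m) (a * d₁) (by positivity)).comp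
    (tendsto_rpow_atTop hm₀)).eventually_ge_atTop 1
  obtain ⟨R', hR'⟩ := eventually_atTop.1 h1
  set R₀ := max (max R R') 1 with hR₀
  have hR₀1 : 1 ≤ R₀ := le_max_right _ _
  have hJ := finite_integral_one_add_norm (E := E d) (μ := volume) (r := (d : ℝ) + 1)
    (by rw [finrank_euclideanSpace_fin]; linarith)
  have hbound : ∀ x : E d, Real.exp (-(a * M.U x))
      ≤ (1 + R₀) ^ ((d : ℝ) + 1) * (1 + ‖x‖) ^ (-((d : ℝ) + 1)) := by
    intro x
    have hx1 : 0 < 1 + ‖x‖ := by positivity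
    rw [Real.rpow_neg hx1.le, ← div_eq_mul_inv, le_div_iff₀ (by positivity)]
    rcases le_total ‖x‖ R₀ with hx | hx
    · have h2 : Real.exp (-(a * M.U x)) ≤ 1 := Real.exp_le_one_iff.2 (by
        have := mul_nonneg ha.le (U_nonneg hU x)
        linarith)
      calc _ ≤ 1 * (1 + R₀) ^ ((d : ℝ) + 1) := by gcongr
        _ = _ := one_mul _
    · have hx0 : 0 < ‖x‖ := by linarith
      have hxR : R ≤ ‖x‖ := ((le_max_left _ _).trans (le_max_left _ _)).trans hx
      have h2 := hR' ‖x‖ (((le_max_right _ _).trans (le_max_left _ _)).trans hx)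
      simp only [Function.comp_apply] at h2
      rw [← Real.rpow_mul hx0.le, mul_div_cancel₀ _ hm₀.ne', le_div_iff₀ (by positivity),
        one_mul] at h2
      have h3 : Real.exp (a * d₁ * ‖x‖ ^ m) ≤ Real.exp (a * M.U x) := by
        refine Real.exp_le_exp.2 ?_
        rw [mul_assoc]
        exact mul_le_mul_of_nonneg_left (hgr x hxR).1.1 ha.le
      calc Real.exp (-(a * M.U x)) * (1 + ‖x‖) ^ ((d : ℝ) + 1)
          ≤ Real.exp (-(a * M.U x)) * ((1 + R₀) * ‖x‖) ^ ((d : ℝ) + 1) := by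
            gcongr
            nlinarith
        _ = (1 + R₀) ^ ((d : ℝ) + 1) * (Real.exp (-(a * M.U x)) * ‖x‖ ^ ((d : ℝ) + 1)) := by
            rw [Real.mul_rpow (by positivity) hx0.le]; ring
        _ ≤ (1 + R₀) ^ ((d : ℝ) + 1) * (Real.exp (-(a * M.U x)) * Real.exp (a * M.U x)) := by
            gcongr
            exact h2.trans h3
        _ = _ := by rw [← Real.exp_add]; simp
  calc ∫⁻ x, ENNReal.ofReal (Real.exp (-(a * M.U x)))
      ≤ ∫⁻ x : E d, ENNReal.ofReal ((1 + R₀) ^ ((d : ℝ) + 1)) *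
          ENNReal.ofReal ((1 + ‖x‖) ^ (-((d : ℝ) + 1))) := by
        refine lintegral_mono fun x => ?_
        rw [← ENNReal.ofReal_mul (by positivity)]
        exact ENNReal.ofReal_le_ofReal (hbound x)
    _ < ∞ := by
        rw [lintegral_const_mul' _ _ ENNReal.ofReal_ne_top]
        exact ENNReal.mul_lt_top ENNReal.ofReal_lt_top hJ

lemma measurable_targetWeight (M : Model d) :
    Measurable fun x => ENNReal.ofReal (Real.exp (-M.U x)) := by
  have := M.continuous_U.measurable
  fun_prop

lemma unnormalizedTarget_univ_ne_zero (M : Model d) : M.unnormalizedTarget univ ≠ 0 := by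
  unfold unnormalizedTarget
  rw [withDensity_apply _ MeasurableSet.univ, Measure.restrict_univ]
  intro h
  rw [lintegral_eq_zero_iff M.measurable_targetWeight] at h
  have h' : ∀ᵐ ξ ∂(volume : Measure (E d)), False := by
    filter_upwards [h] with ξ hξ
    exact (ENNReal.ofReal_pos.2 (Real.exp_pos _)).ne' hξ
  rw [Filter.eventually_false_iff_eq_bot, ae_eq_bot] at h'
  exact (NeZero.ne (volume : Measure (E d))) h'

lemma unnormalizedTarget_univ_ne_top (hm₀ : 0 < m) (hU : Regularity m M.U) :
    M.unnormalizedTarget univ ≠ ∞ := by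
  unfold unnormalizedTarget
  rw [withDensity_apply _ MeasurableSet.univ, Measure.restrict_univ]
  have := lintegral_exp_neg_lt_top hm₀ hU one_pos
  simp only [one_mul] at this
  exact this.ne

lemma isProbabilityMeasure_target (hm₀ : 0 < m) (hU : Regularity m M.U) :
    IsProbabilityMeasure M.target :=
  ⟨by
    simp only [target, Measure.smul_apply, smul_eq_mul]
    exact ENNReal.inv_mul_cancel M.unnormalizedTarget_univ_ne_zero
      (unnormalizedTarget_univ_ne_top hm₀ hU)⟩

lemma lintegral_target (M : Model d) {f : E d → ℝ≥0∞} (hf : Measurable f) :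
    ∫⁻ x, f x ∂M.target = (M.unnormalizedTarget univ)⁻¹ *
      ∫⁻ x, ENNReal.ofReal (Real.exp (-M.U x)) * f x := by
  rw [target, lintegral_smul_measure, smul_eq_mul]
  congr 1
  rw [unnormalizedTarget, lintegral_withDensity_eq_lintegral_mul _ M.measurable_targetWeight hf]
  rfl

lemma lintegral_lyap_target_ne_top (hm₀ : 0 < m) (hU : Regularity m M.U) {s : ℝ} (hs : s < 1) :
    ∫⁻ x, ENNReal.ofReal (M.lyap s x) ∂M.target ≠ ∞ := by
  rw [M.lintegral_target (f := fun x => ENNReal.ofReal (M.lyap s x))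
    (ENNReal.measurable_ofReal.comp (M.continuous_lyap s).measurable)]
  refine ENNReal.mul_ne_top (ENNReal.inv_ne_top.2 M.unnormalizedTarget_univ_ne_zero) ?_
  have h := (lintegral_exp_neg_lt_top hm₀ hU (a := 1 - s) (by linarith)).ne
  convert h using 3 with x
  rw [← ENNReal.ofReal_mul (Real.exp_pos _).le, lyap, ← Real.exp_add]
  ring_nf

lemma measurable_add_scale (M : Model d) (γ : M.Param) :
    Measurable fun p : E d × E d => p.1 + M.scale γ p.2 := by
  have hSm : Measurable (M.scale γ) := (M.continuous_scale γ).measurable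
  fun_prop

/-- Integrals against a symmetric weight are unchanged when the two ends of a move are exchanged. -/
lemma lintegral_move_symm (M : Model d) (γ : M.Param) {J : E d → E d → ℝ≥0∞}
    (hJ : Measurable fun p : E d × E d => J p.1 p.2) (hJc : ∀ x y, J x y = J y x)
    {f : E d → ℝ≥0∞} (hf : Measurable f) :
    ∫⁻ x, ∫⁻ ξ, J x (x + M.scale γ ξ) * f (x + M.scale γ ξ) ∂M.proposal
      = ∫⁻ x, ∫⁻ ξ, J x (x + M.scale γ ξ) * f x ∂M.proposal := by
  have h1 := M.measurable_add_scale γ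
  have hmeas1 : Measurable (Function.uncurry fun x ξ : E d =>
      J x (x + M.scale γ ξ) * f (x + M.scale γ ξ)) :=
    (hJ.comp (measurable_fst.prodMk h1)).mul (hf.comp h1)
  have hmeas2 : Measurable (Function.uncurry fun x ξ : E d => J x (x + M.scale γ ξ) * f x) :=
    (hJ.comp (measurable_fst.prodMk h1)).mul (hf.comp measurable_fst)
  rw [lintegral_lintegral_swap (f := fun x ξ => J x (x + M.scale γ ξ) * f (x + M.scale γ ξ))
    hmeas1.aemeasurable, lintegral_lintegral_swap (f := fun x ξ => J x (x + M.scale γ ξ) * f x)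
    hmeas2.aemeasurable]
  have hmeas3 : Measurable fun ξ : E d => ∫⁻ x, J x (x + M.scale γ ξ) * f x :=
    hmeas2.lintegral_prod_left'
  -- Exchanging the ends of a move amounts to reflecting ξ and then translating x by the scaled ξ,
  -- both of which preserve the measures involved.
  rw [← M.lintegral_proposal_neg hmeas3]
  refine lintegral_congr fun ξ => ?_
  rw [← lintegral_add_right_eq_self (fun x => J x (x + M.scale γ (-ξ)) * f x) (M.scale γ ξ)]
  refine lintegral_congr fun x => ?_
  rw [map_neg, add_neg_cancel_right, hJc]

/-- The flow of the Metropolis chain at equilibrium, as a symmetric weight. -/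
noncomputable def flow (M : Model d) (x y : E d) : ℝ≥0∞ :=
  ENNReal.ofReal (min (Real.exp (-M.U y)) (Real.exp (-M.U x)))

lemma measurable_flow (M : Model d) : Measurable fun p : E d × E d => M.flow p.1 p.2 := by
  have hUm := M.continuous_U.measurable
  unfold flow
  fun_prop

lemma flow_comm (M : Model d) (x y : E d) : M.flow x y = M.flow y x := by
  rw [flow, flow, min_comm]

/-- Multiplying the acceptance ratio by exp(-U(x)) yields an expression symmetric in the two ends of
the move. This is detailed balance. -/
lemma targetWeight_mul_acceptMove (M : Model d) (γ : M.Param) (x ξ : E d) :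
    ENNReal.ofReal (Real.exp (-M.U x)) * M.acceptMove γ x ξ = M.flow x (x + M.scale γ ξ) := by
  rw [flow, acceptMove, accept, move_eq, ← ENNReal.ofReal_mul (Real.exp_pos _).le,
    mul_min_of_nonneg _ _ (Real.exp_pos _).le, ← Real.exp_add, mul_one]
  congr 3
  ring

lemma targetWeight_mul_lintegral_kernel (M : Model d) (γ : M.Param) {f : E d → ℝ≥0∞}
    (hf : Measurable f) (x : E d) :
    ENNReal.ofReal (Real.exp (-M.U x)) * ∫⁻ y, f y ∂M.kernel (γ, x)
      = ∫⁻ ξ, M.flow x (x + M.scale γ ξ) * f (x + M.scale γ ξ) ∂M.proposal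
        + ∫⁻ ξ, ENNReal.ofReal (Real.exp (-M.U x)) * (f x * (1 - M.acceptMove γ x ξ))
          ∂M.proposal := by
  have ha := M.measurable_acceptMove_right γ x
  have hm1 : Measurable fun ξ => f (M.move γ x ξ) * M.acceptMove γ x ξ :=
    (hf.comp (M.measurable_move_right γ x)).mul ha
  have hm2 : Measurable fun ξ => f x * (1 - M.acceptMove γ x ξ) :=
    measurable_const.mul (measurable_const.sub ha)
  rw [M.lintegral_kernel γ x hf, lintegral_add_left hm1, mul_add,
    ← lintegral_const_mul _ hm1, ← lintegral_const_mul _ hm2]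
  congr 1
  refine lintegral_congr fun ξ => ?_
  rw [← targetWeight_mul_acceptMove, move_eq, mul_comm (f _), mul_assoc]

/-- The rejection term is written exactly as in `targetWeight_mul_lintegral_kernel`, so invariance
reduces to the symmetry of the flow and nothing has to be subtracted. -/
lemma targetWeight_mul_eq (M : Model d) (γ : M.Param) (f : E d → ℝ≥0∞) (x : E d) :
    ENNReal.ofReal (Real.exp (-M.U x)) * f x
      = ∫⁻ ξ, M.flow x (x + M.scale γ ξ) * f x ∂M.proposal
        + ∫⁻ ξ, ENNReal.ofReal (Real.exp (-M.U x)) * (f x * (1 - M.acceptMove γ x ξ))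
          ∂M.proposal := by
  have hm : Measurable fun ξ => M.flow x (x + M.scale γ ξ) * f x :=
    (M.measurable_flow.comp (measurable_const.prodMk (M.measurable_move_right γ x))).mul_const _
  rw [← lintegral_add_left hm]
  have : ∀ ξ, M.flow x (x + M.scale γ ξ) * f x
      + ENNReal.ofReal (Real.exp (-M.U x)) * (f x * (1 - M.acceptMove γ x ξ))
      = ENNReal.ofReal (Real.exp (-M.U x)) * f x := fun ξ => by
    rw [← targetWeight_mul_acceptMove, mul_comm (f x), mul_assoc, ← mul_add, ← add_mul,
      add_tsub_cancel_of_le (M.acceptMove_le_one γ x ξ), one_mul]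
  simp_rw [this]
  simp

/-- The target is invariant for the Metropolis kernels. -/
lemma lintegral_lintegral_kernel_target (M : Model d) (γ : M.Param) {f : E d → ℝ≥0∞}
    (hf : Measurable f) :
    ∫⁻ x, ∫⁻ y, f y ∂M.kernel (γ, x) ∂M.target = ∫⁻ x, f x ∂M.target := by
  have hfk : Measurable fun x => ∫⁻ y, f y ∂M.kernel (γ, x) :=
    (hf.lintegral_kernel (κ := M.frozen γ))
  rw [M.lintegral_target hfk, M.lintegral_target hf]
  congr 1
  have h1 := M.measurable_add_scale γ
  have hJ : Measurable fun p : E d × E d => M.flow p.1 (p.1 + M.scale γ p.2) :=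
    M.measurable_flow.comp (measurable_fst.prodMk h1)
  have hm1 : Measurable fun x =>
      ∫⁻ ξ, M.flow x (x + M.scale γ ξ) * f (x + M.scale γ ξ) ∂M.proposal :=
    (hJ.mul (hf.comp h1)).lintegral_prod_right'
  have hm2 : Measurable fun x => ∫⁻ ξ, M.flow x (x + M.scale γ ξ) * f x ∂M.proposal :=
    (hJ.mul (hf.comp measurable_fst)).lintegral_prod_right'
  rw [lintegral_congr (M.targetWeight_mul_lintegral_kernel γ hf),
    lintegral_congr (M.targetWeight_mul_eq γ f), lintegral_add_left hm1, lintegral_add_left hm2,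
    M.lintegral_move_symm γ M.measurable_flow M.flow_comm hf]

/-- The image of a function of the state under `n` steps with the tuning matrix frozen. -/
noncomputable def iter (M : Model d) (f : E d → ℝ≥0∞) : ℕ → M.Param × E d → ℝ≥0∞
  | 0, p => f p.2
  | n + 1, p => ∫⁻ y, iter M f n (p.1, y) ∂M.kernel p

lemma measurable_iter (M : Model d) {f : E d → ℝ≥0∞} (hf : Measurable f) (n : ℕ) :
    Measurable (M.iter f n) := by
  induction n with
  | zero => exact hf.comp measurable_snd
  | succ n ih =>
    have : Measurable (Function.uncurry fun (p : M.Param × E d) (y : E d) => M.iter f n (p.1, y)) :=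
      ih.comp (by fun_prop)
    exact this.lintegral_kernel_prod_right

lemma iter_le_one (M : Model d) {f : E d → ℝ≥0∞} (hf : ∀ x, f x ≤ 1) (n : ℕ) (p : M.Param × E d) :
    M.iter f n p ≤ 1 := by
  induction n generalizing p with
  | zero => exact hf _
  | succ n ih =>
    calc M.iter f (n + 1) p ≤ ∫⁻ _, 1 ∂M.kernel p := lintegral_mono fun y => ih _
      _ = 1 := by simp

lemma iter_add (M : Model d) {f : E d → ℝ≥0∞} (hf : Measurable f) (j n : ℕ) (γ : M.Param)
    (x : E d) : M.iter f (j + n) (γ, x) = ∫⁻ y, M.iter f j (γ, y) ∂(M.frozen γ ^ n) x := by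
  have hm : ∀ k, Measurable fun y => M.iter f k (γ, y) := fun k =>
    (M.measurable_iter hf k).comp measurable_prodMk_left
  induction n generalizing x with
  | zero => rw [lintegral_pow_zero _ (hm j), add_zero]
  | succ n ih =>
    rw [lintegral_pow_succ _ (hm j), ← add_assoc]
    simp_rw [← ih]
    rfl

lemma lintegral_iter_target (M : Model d) {f : E d → ℝ≥0∞} (hf : Measurable f) (n : ℕ)
    (γ : M.Param) : ∫⁻ x, M.iter f n (γ, x) ∂M.target = ∫⁻ x, f x ∂M.target := by
  induction n with
  | zero => rfl
  | succ n ih =>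
    rw [← ih]
    exact M.lintegral_lintegral_kernel_target γ
      ((M.measurable_iter hf n).comp measurable_prodMk_left)

end Model

end AdaptiveRWM

/-! ### Stretched-exponential convergence with a frozen tuning matrix -/

namespace AdaptiveRWM

variable {d : ℕ}

/-- Powers are dominated by stretched exponentials. -/
lemma exists_sq_le_exp_rpow {a β : ℝ} (ha : 0 < a) (hβ : 0 < β) :
    ∃ C > (0 : ℝ), ∀ t : ℝ, 1 ≤ t → t ^ 2 ≤ C * Real.exp (a * t ^ β) := by
  obtain ⟨k, hk⟩ := exists_nat_ge (2 / β)
  refine ⟨k.factorial / a ^ k, by positivity, fun t ht => ?_⟩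
  have ht0 : 0 < t := by linarith
  have h1 := Real.pow_div_factorial_le_exp (a * t ^ β) (by positivity) k
  have h2 : t ^ 2 ≤ (t ^ β) ^ k := by
    rw [← Real.rpow_natCast, ← Real.rpow_natCast, ← Real.rpow_mul ht0.le]
    refine Real.rpow_le_rpow_of_exponent_le ht ?_
    rw [div_le_iff₀ hβ] at hk
    push_cast
    linarith
  calc t ^ 2 ≤ (t ^ β) ^ k := h2
    _ = k.factorial / a ^ k * ((a * t ^ β) ^ k / k.factorial) := by
        rw [mul_pow]; field_simp
    _ ≤ _ := by gcongr

namespace Model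

variable {M : Model d} {m : ℝ}

/-- Up to the level `exp(s t^β)` the relative drift is at least a multiple of `t^(β-1)`. -/
lemma exists_relative_drift (hm₀ : 0 < m) (hm₁ : m < 1) (hU : Regularity m M.U) {s : ℝ}
    (hs : 0 < s) {c : ℝ} (hc : 0 < c) : ∃ b > (0 : ℝ), ∀ t : ℝ, 1 ≤ t → ∀ δ : ℝ, 0 ≤ δ →
      δ ≤ b * t ^ (m / (2 - m) - 1) → ∀ x : E d,
      δ * (M.lyap s x - M.lyap s x ^ 2 / Real.exp (s * t ^ (m / (2 - m))))
        ≤ c * M.lyap s x * (1 + ‖x‖) ^ (2 * (m - 1)) := by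
  obtain ⟨R, hR, d₁, hd₁, D₁, hD₁, _, _, _, _, _, _, _, _, _, _, hgr⟩ := hU.growth
  have h2m : 0 < 2 - m := by linarith
  set A := 1 + R + (1 / d₁) ^ (1 / m) with hA
  have hApos : 0 < A := by positivity
  refine ⟨c * A ^ (2 * (m - 1)), by positivity, fun t ht δ hδ0 hδ x => ?_⟩
  have ht0 : 0 < t := by linarith
  have hV := M.lyap_pos s x
  set v := Real.exp (s * t ^ (m / (2 - m))) with hv
  have hvpos : 0 < v := Real.exp_pos _
  -- Above the level v the left side is nonpositive because V²/v ≥ V. Below it the growth of U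
  -- confines x to radius O(t^(1/(2-m))).
  rcases le_total v (M.lyap s x) with h | h
  · have h1 : M.lyap s x - M.lyap s x ^ 2 / v ≤ 0 := by
      rw [sub_nonpos, le_div_iff₀ hvpos]
      nlinarith
    have h2 := mul_nonpos_of_nonneg_of_nonpos hδ0 h1
    exact h2.trans (by positivity)
  · have hUt : M.U x ≤ t ^ (m / (2 - m)) := by
      have := Real.exp_le_exp.1 h
      exact le_of_mul_le_mul_left this hs
    have hτ : 1 ≤ t ^ (1 / (2 - m)) := Real.one_le_rpow ht (by positivity)
    have hx : 1 + ‖x‖ ≤ A * t ^ (1 / (2 - m)) := by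
      have hx' : ‖x‖ ≤ R + (1 / d₁) ^ (1 / m) * t ^ (1 / (2 - m)) := by
        rcases le_total R ‖x‖ with hx | hx
        · have h1 : ‖x‖ ^ m ≤ 1 / d₁ * t ^ (m / (2 - m)) := by
            rw [one_div, ← div_eq_inv_mul, le_div_iff₀ hd₁, mul_comm]
            exact (hgr x hx).1.1.trans hUt
          have h2 : ‖x‖ ≤ (1 / d₁ * t ^ (m / (2 - m))) ^ (1 / m) := by
            rw [one_div m, Real.le_rpow_inv_iff_of_pos (norm_nonneg _) (by positivity) hm₀]
            exact h1
          rw [Real.mul_rpow (by positivity) (by positivity), ← Real.rpow_mul ht0.le] at h2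
          have h3 : m / (2 - m) * (1 / m) = 1 / (2 - m) := by field_simp
          rw [h3] at h2
          linarith
        · exact hx.trans (by have : 0 ≤ (1 / d₁) ^ (1 / m) * t ^ (1 / (2 - m)) := by positivity
                             linarith)
      calc 1 + ‖x‖ ≤ (1 + R) * 1 + (1 / d₁) ^ (1 / m) * t ^ (1 / (2 - m)) := by linarith
        _ ≤ (1 + R) * t ^ (1 / (2 - m)) + (1 / d₁) ^ (1 / m) * t ^ (1 / (2 - m)) := by gcongr
        _ = _ := by rw [hA]; ring
    have h1 : A ^ (2 * (m - 1)) * t ^ (m / (2 - m) - 1) ≤ (1 + ‖x‖) ^ (2 * (m - 1)) := by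
      -- The exponent β = m/(2-m) is determined by this identity: the drift at radius t^(1/(2-m))
      -- has order t^(β-1), so t steps accumulate t^β, the order of the logarithm of the level.
      have h2 : t ^ (m / (2 - m) - 1) = (t ^ (1 / (2 - m))) ^ (2 * (m - 1)) := by
        rw [← Real.rpow_mul ht0.le]
        congr 1
        field_simp
        ring
      rw [h2, ← Real.mul_rpow hApos.le (by positivity)]
      exact Real.rpow_le_rpow_of_nonpos (by positivity) hx (by linarith)
    calc δ * (M.lyap s x - M.lyap s x ^ 2 / v) ≤ δ * M.lyap s x := by
          gcongr
          exact sub_le_self _ (by positivity)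
      _ ≤ (c * A ^ (2 * (m - 1)) * t ^ (m / (2 - m) - 1)) * M.lyap s x := by gcongr
      _ = c * M.lyap s x * (A ^ (2 * (m - 1)) * t ^ (m / (2 - m) - 1)) := by ring
      _ ≤ _ := by gcongr

/-- The contraction factor over a time `t` of the relative drift of order `t^(β-1)`. -/
lemma pow_contraction_le {b β t : ℝ} (hb : 0 ≤ b) (hb1 : b ≤ 1) (ht : 1 ≤ t) (hβ1 : β ≤ 1) {N n : ℕ}
    (hN : 0 < N) (hn : t ≤ N * (n + 1)) :
    (1 - b * t ^ (β - 1) / 2) ^ n ≤ Real.exp (1 / 2) * Real.exp (-(b / (2 * N)) * t ^ β) := by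
  have ht0 : 0 < t := by linarith
  have hN' : (0 : ℝ) < N := by exact_mod_cast hN
  have hp1 : t ^ (β - 1) ≤ 1 := Real.rpow_le_one_of_one_le_of_nonpos ht (by linarith)
  have hp0 : 0 < t ^ (β - 1) := by positivity
  have hbp : b * t ^ (β - 1) ≤ 1 := by nlinarith
  have h1 : 1 - b * t ^ (β - 1) / 2 ≤ Real.exp (-(b * t ^ (β - 1) / 2)) := by
    have := Real.add_one_le_exp (-(b * t ^ (β - 1) / 2))
    linarith
  have h2 : t ^ β = t ^ (β - 1) * t := by
    rw [← Real.rpow_add_one ht0.ne']; congr 1; ring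
  calc (1 - b * t ^ (β - 1) / 2) ^ n ≤ Real.exp (-(b * t ^ (β - 1) / 2)) ^ n :=
        pow_le_pow_left₀ (by linarith) h1 n
    _ = Real.exp (n * -(b * t ^ (β - 1) / 2)) := by rw [Real.exp_nat_mul]
    _ ≤ Real.exp (1 / 2 + -(b / (2 * N)) * t ^ β) := by
        refine Real.exp_le_exp.2 ?_
        -- Rounding t/N down to n loses at most one contraction factor, which is the origin of the
        -- constant exp(1/2).
        have h3 : t / N ≤ n + 1 := by rw [div_le_iff₀ hN']; linarith
        have h4 := mul_le_mul_of_nonneg_left h3 (mul_nonneg hb hp0.le)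
        have h5 : b / (2 * N) * t ^ β = b * t ^ (β - 1) * (t / N) / 2 := by
          rw [h2]; field_simp
        rw [neg_mul, h5]
        linarith
    _ = _ := Real.exp_add _ _

/-- The stretched exponential rate produced by the iterated contraction. -/
lemma exists_contraction_rate {b β s q : ℝ} (hb0 : 0 < b) (hb1 : b ≤ 1) (hβ0 : 0 < β) (hβ1 : β ≤ 1)
    (hs : 0 < s) (hq0 : 0 ≤ q) {N : ℕ} (hN : 0 < N) : ∃ c > (0 : ℝ), ∃ C > (0 : ℝ),
    ∀ t n : ℕ, 1 ≤ t → n ≤ t → t ≤ N * (n + 1) →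
      (1 - b * (t : ℝ) ^ (β - 1) / 2) ^ n + n ^ 2 * q / Real.exp (s * (t : ℝ) ^ β)
        ≤ C * Real.exp (-c * (t : ℝ) ^ β) ∧
      n / Real.exp (s * (t : ℝ) ^ β) ≤ C * Real.exp (-c * (t : ℝ) ^ β) := by
  obtain ⟨C₁, hC₁, hsq⟩ := exists_sq_le_exp_rpow (a := s / 2) (by positivity) hβ0
  have hN' : (0 : ℝ) < N := by exact_mod_cast hN
  -- The first entry is the rate of the contraction. In the leak, half of the exponent s absorbs the
  -- polynomial factor t² and the other half remains as a rate.
  set c := min (b / (2 * N)) (s / 2) with hc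
  refine ⟨c, by positivity, Real.exp (1 / 2) + C₁ * q + C₁, by positivity, fun t n ht hnt htN => ?_⟩
  have ht1 : (1 : ℝ) ≤ t := by exact_mod_cast ht
  have htβ : 0 ≤ (t : ℝ) ^ β := by positivity
  have hnt' : (n : ℝ) ≤ t := by exact_mod_cast hnt
  set v := Real.exp (s * (t : ℝ) ^ β) with hv
  have hvpos : 0 < v := Real.exp_pos _
  have hexp1 : Real.exp (-(b / (2 * N)) * (t : ℝ) ^ β) ≤ Real.exp (-c * (t : ℝ) ^ β) :=
    Real.exp_le_exp.2 (mul_le_mul_of_nonneg_right (neg_le_neg (min_le_left _ _)) htβ)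
  have hexp2 : Real.exp (-(s / 2) * (t : ℝ) ^ β) ≤ Real.exp (-c * (t : ℝ) ^ β) :=
    Real.exp_le_exp.2 (mul_le_mul_of_nonneg_right (neg_le_neg (min_le_right _ _)) htβ)
  have hex0 : 0 < Real.exp (-c * (t : ℝ) ^ β) := Real.exp_pos _
  have hpow : (1 - b * (t : ℝ) ^ (β - 1) / 2) ^ n
      ≤ Real.exp (1 / 2) * Real.exp (-c * (t : ℝ) ^ β) := by
    refine (pow_contraction_le hb0.le hb1 ht1 hβ1 hN (by exact_mod_cast htN)).trans ?_
    gcongr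
  have hn2 : (n : ℝ) ^ 2 / v ≤ C₁ * Real.exp (-c * (t : ℝ) ^ β) := by
    calc (n : ℝ) ^ 2 / v ≤ (t : ℝ) ^ 2 / v := by gcongr
      _ ≤ C₁ * Real.exp (s / 2 * (t : ℝ) ^ β) / v := by gcongr; exact hsq t ht1
      _ = C₁ * Real.exp (-(s / 2) * (t : ℝ) ^ β) := by
          rw [mul_div_assoc, hv, ← Real.exp_sub]; congr 2; ring
      _ ≤ _ := by gcongr
  have hn1 : (n : ℝ) / v ≤ C₁ * Real.exp (-c * (t : ℝ) ^ β) := by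
    refine le_trans ?_ hn2
    gcongr
    rcases Nat.eq_zero_or_pos n with h0 | h0
    · simp [h0]
    · have : (1 : ℝ) ≤ n := by exact_mod_cast h0
      nlinarith
  constructor
  · calc (1 - b * (t : ℝ) ^ (β - 1) / 2) ^ n + n ^ 2 * q / v
        ≤ Real.exp (1 / 2) * Real.exp (-c * (t : ℝ) ^ β)
          + (C₁ * Real.exp (-c * (t : ℝ) ^ β)) * q := by
          rw [mul_div_right_comm ((n : ℝ) ^ 2)]
          gcongr
      _ = (Real.exp (1 / 2) + C₁ * q + 0) * Real.exp (-c * (t : ℝ) ^ β) := by ring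
      _ ≤ _ := by gcongr
  · refine hn1.trans ?_
    gcongr
    have : 0 ≤ Real.exp (1 / 2) + C₁ * q := by positivity
    linarith

lemma weighted_oscillation_le {P Q B A C ex Vx Vy Wx Wy : ℝ} (hP : P ≤ C * ex) (hQ : Q ≤ C * ex)
    (hC : 0 ≤ C * ex) (hB : 0 ≤ B) (hA : 0 ≤ A) (hVx : 0 ≤ Vx) (hVy : 0 ≤ Vy) (hx : Vx ≤ Wx)
    (hy : Vy ≤ Wy) :
    P * B * (A + Vy + Vx) + Q * B * (Wy + Wx) ≤ C * B * (A + 2) * ex * (1 + Wx + Wy) := by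
  have h1 : A + Vy + Vx ≤ (A + 1) * (1 + Wx + Wy) := by
    have := mul_nonneg hA (hVx.trans hx)
    have := mul_nonneg hA (hVy.trans hy)
    nlinarith
  calc P * B * (A + Vy + Vx) + Q * B * (Wy + Wx)
      ≤ (C * ex) * B * ((A + 1) * (1 + Wx + Wy)) + (C * ex) * B * (1 + Wx + Wy) := by
        have h2 : Wy + Wx ≤ 1 + Wx + Wy := by linarith
        have h3 : 0 ≤ A + Vy + Vx := by linarith
        have h4 : 0 ≤ Wy + Wx := by linarith
        gcongr
    _ = _ := by ring

lemma toReal_iter_add (M : Model d) {f : E d → ℝ≥0∞} (hf : Measurable f) (hf1 : ∀ x, f x ≤ 1)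
    (j n : ℕ) (γ : M.Param) (x : E d) :
    (M.iter f (j + n) (γ, x)).toReal = ∫ y, (M.iter f j (γ, y)).toReal ∂(M.frozen γ ^ n) x := by
  have hm : Measurable fun y => M.iter f j (γ, y) :=
    (M.measurable_iter hf j).comp measurable_prodMk_left
  rw [M.iter_add hf, integral_toReal hm.aemeasurable
    (Eventually.of_forall fun z => (M.iter_le_one hf1 _ _).trans_lt ENNReal.one_lt_top)]

/-- Uniform subgeometric convergence of the chains with frozen tuning matrix. -/
theorem exists_frozen_convergence (hm₀ : 0 < m) (hm₁ : m < 1) (hU : Regularity m M.U) {s : ℝ}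
    (hs : 0 < s) (hs16 : s ≤ 1 / 16) :
    ∃ c > (0 : ℝ), ∃ C > (0 : ℝ), ∀ (γ : M.Param) (f : E d → ℝ≥0∞), Measurable f →
      (∀ x, f x ≤ 1) → ∀ (t : ℕ) (x y : E d), M.iter f t (γ, y) ≤ M.iter f t (γ, x)
        + ENNReal.ofReal (C * Real.exp (-c * (t : ℝ) ^ (m / (2 - m)))
          * (1 + M.lyap (2 * s) x + M.lyap (2 * s) y)) := by
  obtain ⟨N, hN, c₀, hc₀, K, K₂, η, hDM⟩ := exists_driftMinorization hm₀ hm₁ hU hs hs16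
  obtain ⟨b₀, hb₀, hrel⟩ := exists_relative_drift hm₀ hm₁ hU hs hc₀
  have h2m : 0 < 2 - m := by linarith
  set β := m / (2 - m) with hβ
  have hβ0 : 0 < β := by positivity
  have hβ1 : β ≤ 1 := by rw [hβ, div_le_one h2m]; linarith
  -- The signs of K, K₂ and η are recorded only inside the drift structure of some tuning matrix,
  -- and the parameter set is empty when `lamMin` exceeds `lamMax` in positive dimension. The empty
  -- case is vacuous.
  by_cases hne : Nonempty M.Param
  swap
  · exact ⟨1, one_pos, 1, one_pos, fun γ => (hne ⟨γ⟩).elim⟩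
  obtain ⟨γ₁⟩ := hne
  have hK := (hDM γ₁).K_pos
  have hη := (hDM γ₁).η_pos
  have hK₂ := (hDM γ₁).K₂_nonneg
  set b := min b₀ (min η 1) with hb
  have hb0 : 0 < b := by positivity
  have hbb : b ≤ b₀ := min_le_left _ _
  have hbη : b ≤ η := (min_le_right _ _).trans (min_le_left _ _)
  have hb1 : b ≤ 1 := (min_le_right _ _).trans (min_le_right _ _)
  obtain ⟨c, hc, C₀, hC₀, hrate⟩ := exists_contraction_rate (q := K₂ * η / (2 * K)) hb0 hb1 hβ0 hβ1 hs
    (by positivity) hN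
  have hB0 : 0 < η / (4 * K) := by positivity
  have hA0 : 0 < 2 * (2 * K / η) := by positivity
  refine ⟨c, hc, max 1 (C₀ * (η / (4 * K)) * (2 * (2 * K / η) + 2)), by positivity,
    fun γ f hf hf1 t x y => ?_⟩
  have hVx := M.lyap_pos (2 * s) x
  have hVy := M.lyap_pos (2 * s) y
  rcases Nat.eq_zero_or_pos t with rfl | htpos
  · refine (M.iter_le_one hf1 _ _).trans (le_add_left ?_)
    rw [← ENNReal.ofReal_one]
    refine ENNReal.ofReal_le_ofReal ?_
    rw [Nat.cast_zero, Real.zero_rpow hβ0.ne', mul_zero, Real.exp_zero, mul_one]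
    have h1 : 1 ≤ max 1 (C₀ * (η / (4 * K)) * (2 * (2 * K / η) + 2)) := le_max_left _ _
    exact one_le_mul_of_one_le_of_one_le h1 (by linarith)
  have ht1 : (1 : ℝ) ≤ t := by exact_mod_cast htpos
  -- The contraction concerns N-step blocks. The remainder r is absorbed into the starting function,
  -- which remains between 0 and 1 after r steps.
  obtain ⟨n, r, htn, hnt, htN⟩ : ∃ n r, t = r + N * n ∧ n ≤ t ∧ t ≤ N * (n + 1) := by
    have h1 := Nat.mod_add_div t N
    have h2 := Nat.mod_lt t hN
    exact ⟨t / N, t % N, h1.symm, Nat.div_le_self t N, by rw [mul_add, mul_one]; omega⟩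
  have hfin : ∀ k z, M.iter f k (γ, z) ≠ ∞ := fun k z =>
    ne_top_of_le_ne_top ENNReal.one_ne_top (M.iter_le_one hf1 k _)
  have hp1 : (t : ℝ) ^ (β - 1) ≤ 1 := Real.rpow_le_one_of_one_le_of_nonpos ht1 (by linarith)
  have hp0 : 0 < (t : ℝ) ^ (β - 1) := by positivity
  have hδ0 : 0 ≤ b * (t : ℝ) ^ (β - 1) := by positivity
  have hδb : b * (t : ℝ) ^ (β - 1) ≤ b := mul_le_of_le_one_right hb0.le hp1
  have hφ := hrel t ht1 _ hδ0 (mul_le_mul_of_nonneg_right hbb hp0.le)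
  have hit := (hDM γ).iterate hδ0 (hδb.trans hbη) (hδb.trans hb1) (Real.exp_pos _) hφ
    (g := fun k z => (M.iter f (r + N * k) (γ, z)).toReal)
    (fun k => ((M.measurable_iter hf _).comp measurable_prodMk_left).ennreal_toReal)
    (fun k z => ENNReal.toReal_nonneg)
    (fun k z => ENNReal.toReal_le_of_le_ofReal zero_le_one
      (by rw [ENNReal.ofReal_one]; exact M.iter_le_one hf1 _ _))
    (fun k z => by rw [mul_add, mul_one, ← add_assoc, M.toReal_iter_add hf hf1]) n y x
  simp only [← htn] at hit
  obtain ⟨hr1, hr2⟩ := hrate t n htpos hnt htN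
  have hVV : ∀ z, M.lyap s z ≤ M.lyap (2 * s) z := fun z => by
    refine Real.exp_le_exp.2 ?_
    have := mul_nonneg hs.le (U_nonneg hU z)
    linarith
  have hfinal := weighted_oscillation_le hr1 hr2 (by positivity) hB0.le hA0.le (M.lyap_pos s x).le
    (M.lyap_pos s y).le (hVV x) (hVV y)
  rw [lyap_sq, lyap_sq, mul_div_right_comm (n : ℝ)] at hit
  rw [← ENNReal.ofReal_toReal (hfin t y), ← ENNReal.ofReal_toReal (hfin t x),
    ← ENNReal.ofReal_add ENNReal.toReal_nonneg (by positivity)]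
  refine ENNReal.ofReal_le_ofReal ?_
  rw [← sub_le_iff_le_add']
  refine hit.trans (hfinal.trans ?_)
  refine mul_le_mul_of_nonneg_right (mul_le_mul_of_nonneg_right (le_max_right _ _)
    (Real.exp_pos _).le) (by linarith)

/-- Convergence of the frozen chains to the target. -/
theorem exists_frozen_convergence_target (hm₀ : 0 < m) (hm₁ : m < 1) (hU : Regularity m M.U) {s : ℝ}
    (hs : 0 < s) (hs16 : s ≤ 1 / 16) :
    ∃ c > (0 : ℝ), ∃ C > (0 : ℝ), ∀ (γ : M.Param) (f : E d → ℝ≥0∞), Measurable f →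
      (∀ x, f x ≤ 1) → ∀ (t : ℕ) (x : E d), ∫⁻ y, f y ∂M.target ≤ M.iter f t (γ, x)
        + ENNReal.ofReal (C * Real.exp (-c * (t : ℝ) ^ (m / (2 - m))) * (1 + M.lyap (2 * s) x)) := by
  obtain ⟨c, hc, C, hC, h⟩ := exists_frozen_convergence hm₀ hm₁ hU hs hs16
  have := isProbabilityMeasure_target hm₀ hU
  have hfin := lintegral_lyap_target_ne_top hm₀ hU (s := 2 * s) (by linarith)
  set I := (∫⁻ x, ENNReal.ofReal (M.lyap (2 * s) x) ∂M.target).toReal with hI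
  have hI0 : 0 ≤ I := ENNReal.toReal_nonneg
  have hVm : Measurable fun y => ENNReal.ofReal (M.lyap (2 * s) y) :=
    ENNReal.measurable_ofReal.comp (M.continuous_lyap (2 * s)).measurable
  refine ⟨c, hc, C * (1 + I), by positivity, fun γ f hf hf1 t x => ?_⟩
  have hVx := M.lyap_pos (2 * s) x
  set A := C * Real.exp (-c * (t : ℝ) ^ (m / (2 - m))) with hA
  have hA0 : 0 ≤ A := by positivity
  -- By invariance the target integral of f is that of its t-step image, so the comparison of two
  -- starting points can be averaged over the second. The Lyapunov function with exponent 2s < 1 has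
  -- finite target integral.
  rw [← M.lintegral_iter_target hf t γ]
  calc ∫⁻ y, M.iter f t (γ, y) ∂M.target
      ≤ ∫⁻ y, ((M.iter f t (γ, x) + ENNReal.ofReal (A * (1 + M.lyap (2 * s) x)))
          + ENNReal.ofReal A * ENNReal.ofReal (M.lyap (2 * s) y)) ∂M.target := by
        refine lintegral_mono fun y => (h γ f hf hf1 t x y).trans (le_of_eq ?_)
        have hVy := M.lyap_pos (2 * s) y
        rw [← hA, mul_add A _ (M.lyap (2 * s) y), ENNReal.ofReal_add (by positivity) (by positivity),
          ← add_assoc, ENNReal.ofReal_mul hA0 (q := M.lyap (2 * s) y)]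
    _ = M.iter f t (γ, x) + ENNReal.ofReal (A * (1 + M.lyap (2 * s) x))
          + ENNReal.ofReal A * ENNReal.ofReal I := by
        rw [lintegral_add_left measurable_const, lintegral_const_mul _ hVm, hI,
          ENNReal.ofReal_toReal hfin]
        simp
    _ ≤ _ := by
        rw [add_assoc, ← ENNReal.ofReal_mul hA0, ← ENNReal.ofReal_add (by positivity)
          (by positivity)]
        gcongr
        have : 0 ≤ A * I * M.lyap (2 * s) x := by positivity
        rw [show C * (1 + I) * Real.exp (-c * (t : ℝ) ^ (m / (2 - m))) = A * (1 + I) by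
          rw [hA]; ring]
        nlinarith

end Model

end AdaptiveRWM

/-! ### The law of the adaptive process: tower property, moments, support -/

namespace AdaptiveRWM

variable {d : ℕ}

namespace AdaptationPlan

variable {M : Model d} (Q : AdaptationPlan M) (γ₀ : M.Param) (x₀ : E d)

instance : IsProbabilityMeasure (Q.law γ₀ x₀) := by
  unfold law
  infer_instance

/-- The history of a trajectory up to time `n`. -/
abbrev hist (M : Model d) (n : ℕ) (ω : ℕ → M.Param × E d) : (_ : Finset.Iic n) → M.Param × E d :=
  Preorder.frestrictLe (π := fun _ : ℕ => M.Param × E d) n ω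

lemma measurable_hist (M : Model d) (n : ℕ) : Measurable (hist M n) :=
  Preorder.measurable_frestrictLe (X := fun _ : ℕ => M.Param × E d) n

/-- The current point of a history. -/
abbrev last {M : Model d} {n : ℕ} (h : (_ : Finset.Iic n) → M.Param × E d) : M.Param × E d :=
  h ⟨n, Finset.mem_Iic.2 le_rfl⟩

/-- In the Ionescu-Tulcea construction the joint law of a history and the next point is the
composition product of the history's law with the step kernel. -/
lemma lintegral_law_step {n : ℕ}
    {F : ((_ : Finset.Iic n) → M.Param × E d) × (M.Param × E d) → ℝ≥0∞} (hF : Measurable F) :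
    ∫⁻ ω, F (hist M n ω, ω (n + 1)) ∂Q.law γ₀ x₀
      = ∫⁻ ω, ∫⁻ z, F (hist M n ω, z) ∂Q.step n (hist M n ω) ∂Q.law γ₀ x₀ := by
  have hm : Measurable fun ω : ℕ → M.Param × E d => (hist M n ω, ω (n + 1)) :=
    (measurable_hist M n).prodMk (measurable_pi_apply _)
  have key := Kernel.partialTraj_compProd_eq_map_traj (X := fun _ => M.Param × E d) (κ := Q.step)
    (Nat.zero_le n) (x₀ := fun _ => (γ₀, x₀))
  rw [← lintegral_map (f := F) hF hm, law, ← key, Measure.lintegral_compProd hF,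
    ← Kernel.traj_map_frestrictLe_apply, lintegral_map]
  · exact hF.lintegral_kernel_prod_right'
  · exact measurable_hist M n

/-- The tower property: the conditional law of `X_{n+1}` given the history and `Γ_{n+1}`. -/
lemma lintegral_law_tower {n : ℕ}
    {G : (((_ : Finset.Iic n) → M.Param × E d) × M.Param) × E d → ℝ≥0∞} (hG : Measurable G) :
    ∫⁻ ω, G ((hist M n ω, (ω (n + 1)).1), (ω (n + 1)).2) ∂Q.law γ₀ x₀
      = ∫⁻ ω, ∫⁻ y, G ((hist M n ω, (ω (n + 1)).1), y) ∂M.kernel ((ω (n + 1)).1, (ω n).2)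
          ∂Q.law γ₀ x₀ := by
  set κ' := M.kernel.comap (paramState M n) (measurable_paramState M n) with hκ'
  have h1 : Measurable fun p : ((_ : Finset.Iic n) → M.Param × E d) × (M.Param × E d) =>
      G ((p.1, p.2.1), p.2.2) := hG.comp (by fun_prop)
  have hI : Measurable fun p : ((_ : Finset.Iic n) → M.Param × E d) × M.Param =>
      ∫⁻ y, G (p, y) ∂κ' p := hG.lintegral_kernel_prod_right'
  have h2 : Measurable fun p : ((_ : Finset.Iic n) → M.Param × E d) × (M.Param × E d) =>
      ∫⁻ y, G ((p.1, p.2.1), y) ∂κ' (p.1, p.2.1) :=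
    hI.comp (measurable_fst.prodMk (measurable_fst.comp measurable_snd))
  have hc : ∀ (ω : ℕ → M.Param × E d) γ, κ' (hist M n ω, γ) = M.kernel (γ, (ω n).2) :=
    fun ω γ => Kernel.comap_apply _ _ _
  have e1 := Q.lintegral_law_step γ₀ x₀ h1
  have e2 := Q.lintegral_law_step γ₀ x₀ h2
  simp only [hc] at e2
  refine e1.trans (Eq.trans ?_ e2.symm)
  refine lintegral_congr fun ω => ?_
  have m1 : Measurable fun z : M.Param × E d => G ((hist M n ω, z.1), z.2) :=
    h1.comp measurable_prodMk_left
  have m2 : Measurable fun γ : M.Param => ∫⁻ y, G ((hist M n ω, γ), y) ∂κ' (hist M n ω, γ) :=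
    hI.comp measurable_prodMk_left
  simp only [hc] at m2
  have m3 : Measurable fun z : M.Param × E d =>
      ∫⁻ y, G ((hist M n ω, z.1), y) ∂M.kernel (z.1, (ω n).2) := m2.comp measurable_fst
  rw [step, Kernel.lintegral_compProd _ _ _ m1, Kernel.lintegral_compProd _ _ _ m3]
  refine lintegral_congr fun γ => ?_
  simp only [← hκ', hc, lintegral_const, measure_univ, mul_one]

lemma measurable_state (M : Model d) (n : ℕ) :
    Measurable fun ω : ℕ → M.Param × E d => (ω n).2 :=
  measurable_snd.comp (measurable_pi_apply n)

lemma lintegral_marginal {f : E d → ℝ≥0∞} (hf : Measurable f) (n : ℕ) :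
    ∫⁻ x, f x ∂Q.marginal γ₀ x₀ n = ∫⁻ ω, f (ω n).2 ∂Q.law γ₀ x₀ := by
  rw [marginal, lintegral_map hf (measurable_state M n)]

instance (n : ℕ) : IsProbabilityMeasure (Q.marginal γ₀ x₀ n) := by
  unfold marginal
  exact Measure.isProbabilityMeasure_map (measurable_state M n).aemeasurable

lemma lintegral_marginal_succ {f : E d → ℝ≥0∞} (hf : Measurable f) (n : ℕ) :
    ∫⁻ x, f x ∂Q.marginal γ₀ x₀ (n + 1)
      = ∫⁻ ω, ∫⁻ y, f y ∂M.kernel ((ω (n + 1)).1, (ω n).2) ∂Q.law γ₀ x₀ := by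
  rw [Q.lintegral_marginal γ₀ x₀ hf]
  exact Q.lintegral_law_tower γ₀ x₀ (G := fun p => f p.2) (hf.comp measurable_snd)

lemma marginal_zero : Q.marginal γ₀ x₀ 0 = Measure.dirac x₀ := by
  have h := Kernel.traj_map_frestrictLe_apply (X := fun _ => M.Param × E d) (κ := Q.step) 0 0
    (fun _ => (γ₀, x₀))
  rw [Kernel.partialTraj_self, Kernel.id_apply] at h
  have h' : (Q.law γ₀ x₀).map (hist M 0) = Measure.dirac (fun _ => (γ₀, x₀)) := h
  have hl : Measurable fun p : (_ : Finset.Iic 0) → M.Param × E d => (last p).2 := by fun_prop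
  have e : Q.marginal γ₀ x₀ 0 = ((Q.law γ₀ x₀).map (hist M 0)).map fun p => (last p).2 := by
    rw [Measure.map_map hl (measurable_hist M 0)]
    rfl
  rw [e, h', Measure.map_dirac' hl]

lemma lintegral_marginal_zero {f : E d → ℝ≥0∞} (hf : Measurable f) :
    ∫⁻ x, f x ∂Q.marginal γ₀ x₀ 0 = f x₀ := by
  rw [marginal_zero, lintegral_dirac' _ hf]

/-- Moments of the adaptive chain under a simultaneous growth condition. -/
lemma lintegral_marginal_le {f : E d → ℝ≥0∞} (hf : Measurable f) {a b : ℝ≥0∞} (ha : 1 ≤ a)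
    (h : ∀ (γ : M.Param) (x : E d), ∫⁻ y, f y ∂M.kernel (γ, x) ≤ a * f x + b) (n : ℕ) :
    ∫⁻ x, f x ∂Q.marginal γ₀ x₀ n ≤ a ^ n * (f x₀ + n * b) := by
  induction n with
  | zero => rw [Q.lintegral_marginal_zero γ₀ x₀ hf]; simp
  | succ n ih =>
    rw [Q.lintegral_marginal_succ γ₀ x₀ hf]
    calc ∫⁻ ω, ∫⁻ y, f y ∂M.kernel ((ω (n + 1)).1, (ω n).2) ∂Q.law γ₀ x₀
        ≤ ∫⁻ ω, (a * f (ω n).2 + b) ∂Q.law γ₀ x₀ := lintegral_mono fun ω => h _ _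
      _ = a * ∫⁻ x, f x ∂Q.marginal γ₀ x₀ n + b := by
          have hm : Measurable fun ω : ℕ → M.Param × E d => f (ω n).2 := hf.comp (measurable_state M n)
          rw [lintegral_add_right _ measurable_const, lintegral_const_mul _ hm,
            Q.lintegral_marginal γ₀ x₀ hf]
          simp
      _ ≤ a * (a ^ n * (f x₀ + n * b)) + a ^ (n + 1) * b := by
          gcongr
          exact le_mul_of_one_le_left zero_le (one_le_pow₀ ha)
      _ = _ := by push_cast; ring

/-- Proposals are truncated, so almost surely each step has length at most √λ* ρ, whatever the plan.
The tower property applied to the indicator of a longer jump transfers this to the process. -/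
lemma ae_norm_le_marginal (n : ℕ) :
    ∀ᵐ x ∂Q.marginal γ₀ x₀ n, ‖x‖ ≤ ‖x₀‖ + n * (√M.lamMax * M.rho) := by
  set L := √M.lamMax * M.rho with hL
  have hjump : ∀ n, ∀ᵐ ω ∂Q.law γ₀ x₀, ‖(ω (n + 1)).2 - (ω n).2‖ ≤ L := by
    intro n
    set B : Set (E d × E d) := {p | ¬ ‖p.2 - p.1‖ ≤ L} with hB
    have hBm : MeasurableSet B := by
      have : Measurable fun p : E d × E d => ‖p.2 - p.1‖ := by fun_prop
      exact (measurableSet_le this measurable_const).compl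
    set G : (((_ : Finset.Iic n) → M.Param × E d) × M.Param) × E d → ℝ≥0∞ :=
      fun p => B.indicator 1 ((last p.1.1).2, p.2) with hG
    have hGm : Measurable G := (measurable_one.indicator hBm).comp (by fun_prop)
    have h0 := Q.lintegral_law_tower γ₀ x₀ hGm
    have hz : ∀ ω : ℕ → M.Param × E d, ∫⁻ y, G ((hist M n ω, (ω (n + 1)).1), y)
        ∂M.kernel ((ω (n + 1)).1, (ω n).2) = 0 := fun ω => by
      rw [← lintegral_zero (μ := M.kernel ((ω (n + 1)).1, (ω n).2))]
      refine lintegral_congr_ae ?_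
      filter_upwards [M.ae_norm_sub_le_kernel (ω (n + 1)).1 (ω n).2] with y hy
      exact indicator_of_notMem (by simpa [hB] using hy) _
    simp_rw [hz, lintegral_zero] at h0
    have hGm' : Measurable fun ω : ℕ → M.Param × E d =>
        G ((hist M n ω, (ω (n + 1)).1), (ω (n + 1)).2) :=
      hGm.comp (((measurable_hist M n).prodMk
        (measurable_fst.comp (measurable_pi_apply (n + 1)))).prodMk (measurable_state M (n + 1)))
    rw [lintegral_eq_zero_iff hGm'] at h0
    filter_upwards [h0] with ω hω
    by_contra hc
    have : G ((hist M n ω, (ω (n + 1)).1), (ω (n + 1)).2) = 1 := indicator_of_mem hc _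
    rw [this] at hω
    simp at hω
  have hzero : ∀ᵐ ω ∂Q.law γ₀ x₀, (ω 0).2 = x₀ := by
    have h : ∀ᵐ x ∂Q.marginal γ₀ x₀ 0, x = x₀ := by
      rw [marginal_zero, ae_dirac_eq]
      rfl
    exact ae_of_ae_map (measurable_state M 0).aemeasurable h
  have hall : ∀ᵐ ω ∂Q.law γ₀ x₀, ‖(ω n).2‖ ≤ ‖x₀‖ + n * L := by
    filter_upwards [hzero, ae_all_iff.2 hjump] with ω h0 h1
    induction n with
    | zero => simp [h0]
    | succ n ih =>
      have h2 := norm_add_le ((ω (n + 1)).2 - (ω n).2) (ω n).2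
      rw [sub_add_cancel] at h2
      push_cast
      linarith [h1 n]
  have hs : MeasurableSet {x : E d | ‖x‖ ≤ ‖x₀‖ + n * L} :=
    measurableSet_le measurable_norm measurable_const
  rw [marginal, ae_map_iff (measurable_state M n).aemeasurable hs]
  exact hall

end AdaptationPlan

end AdaptiveRWM

/-! ### Comparison of the adaptive chain with the chain frozen at time T -/

namespace AdaptiveRWM

variable {d : ℕ}

lemma measurable_frobNorm_sub {α : Type*} [MeasurableSpace α]
    {f g : α → Matrix (Fin d) (Fin d) ℝ} (hf : Measurable f) (hg : Measurable g) :
    Measurable fun a => frobNorm (f a - g a) := by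
  have he : ∀ {h : α → Matrix (Fin d) (Fin d) ℝ}, Measurable h →
      ∀ i j, Measurable fun a => h a i j :=
    fun hh i j => (continuous_id.matrix_elem i j).measurable.comp hh
  unfold frobNorm
  simp only [Matrix.sub_apply]
  exact (Finset.measurable_sum _ fun i _ => Finset.measurable_sum _ fun j _ =>
    ((he hf i j).sub (he hg i j)).pow_const 2).sqrt

namespace AdaptationPlan

variable {M : Model d} (Q : AdaptationPlan M) (γ₀ : M.Param) (x₀ : E d)

/-- The increment of the tuning parameter at time `s`. -/
noncomputable def increment (s : ℕ) (ω : ℕ → M.Param × E d) : ℝ :=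
  frobNorm ((ω (s + 1)).1.1 - (ω s).1.1)

lemma measurable_increment (s : ℕ) : Measurable (increment (M := M) s) :=
  measurable_frobNorm_sub
    (measurable_subtype_coe.comp (measurable_fst.comp (measurable_pi_apply (s + 1))))
    (measurable_subtype_coe.comp (measurable_fst.comp (measurable_pi_apply s)))

/-- The event that the `k` increments of the tuning parameter after time `T` are at most `G`. -/
def tame (M : Model d) (G : ℕ → ℝ) (T k : ℕ) : Set (ℕ → M.Param × E d) :=
  {ω | ∀ i < k, increment (T + i) ω ≤ G (T + i)}

lemma measurableSet_tame (G : ℕ → ℝ) (T k : ℕ) : MeasurableSet (tame M G T k) := by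
  have : tame M G T k = ⋂ i, ⋂ (_ : i < k), {ω | increment (T + i) ω ≤ G (T + i)} := by
    ext ω; simp [tame]
  rw [this]
  exact MeasurableSet.iInter fun i => MeasurableSet.iInter fun _ =>
    measurableSet_le (measurable_increment _) measurable_const

lemma tame_succ_subset (G : ℕ → ℝ) (T k : ℕ) : tame M G T (k + 1) ⊆ tame M G T k :=
  fun _ hω i hi => hω i (hi.trans k.lt_succ_self)

lemma frobNorm_sub_le_of_mem_tame {G : ℕ → ℝ} (hG : Antitone G) {T k : ℕ}
    {ω : ℕ → M.Param × E d} (hω : ω ∈ tame M G T k) :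
    frobNorm ((ω (T + k)).1.1 - (ω T).1.1) ≤ k * G T := by
  induction k with
  | zero => simp [frobNorm]
  | succ k ih =>
    have h1 := ih (tame_succ_subset G T k hω)
    have h2 : increment (T + k) ω ≤ G (T + k) := hω k k.lt_succ_self
    have h3 := hG (Nat.le_add_right T k)
    have h4 := frobNorm_add_le ((ω (T + k + 1)).1.1 - (ω (T + k)).1.1)
      ((ω (T + k)).1.1 - (ω T).1.1)
    rw [sub_add_sub_cancel] at h4
    have h5 : frobNorm ((ω (T + k + 1)).1.1 - (ω (T + k)).1.1) ≤ G (T + k) := h2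
    push_cast
    rw [← add_assoc]
    linarith

/-- The event `tame M G T (k + 1)`, read off the history up to time `T + k` and the next tuning
parameter. -/
def tameHist (M : Model d) (G : ℕ → ℝ) (T k : ℕ) :
    Set (((_ : Finset.Iic (T + k)) → M.Param × E d) × M.Param) :=
  {p | (∀ i, ∀ hi : i < k, frobNorm ((p.1 ⟨T + i + 1, Finset.mem_Iic.2 (by omega)⟩).1.1
      - (p.1 ⟨T + i, Finset.mem_Iic.2 (by omega)⟩).1.1) ≤ G (T + i)) ∧
    frobNorm (p.2.1 - (last p.1).1.1) ≤ G (T + k)}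

lemma measurableSet_tameHist (G : ℕ → ℝ) (T k : ℕ) : MeasurableSet (tameHist M G T k) := by
  simp only [tameHist, ofPred_and, ofPred_forall]
  refine MeasurableSet.inter ?_ ?_
  · refine MeasurableSet.iInter fun i => MeasurableSet.iInter fun hi => ?_
    refine measurableSet_le (measurable_frobNorm_sub ?_ ?_) measurable_const
    · exact measurable_subtype_coe.comp (measurable_fst.comp
        ((measurable_pi_apply _).comp measurable_fst))
    · exact measurable_subtype_coe.comp (measurable_fst.comp
        ((measurable_pi_apply _).comp measurable_fst))
  · refine measurableSet_le (measurable_frobNorm_sub ?_ ?_) measurable_const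
    · exact measurable_subtype_coe.comp measurable_snd
    · exact measurable_subtype_coe.comp (measurable_fst.comp
        ((measurable_pi_apply _).comp measurable_fst))

lemma mem_tameHist_iff (G : ℕ → ℝ) (T k : ℕ) (ω : ℕ → M.Param × E d) :
    (hist M (T + k) ω, (ω (T + k + 1)).1) ∈ tameHist M G T k ↔ ω ∈ tame M G T (k + 1) := by
  constructor
  · rintro ⟨h1, h2⟩ i hi
    rcases Nat.lt_succ_iff_lt_or_eq.1 hi with h | rfl
    · exact h1 i h
    · exact h2
  · intro h
    exact ⟨fun i hi => h i (hi.trans k.lt_succ_self), h k k.lt_succ_self⟩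

-- The event depends only on the history and on the next tuning parameter, both drawn before the
-- next state. The tower property may therefore integrate out that state with the event held fixed.
open Classical in
lemma lintegral_tame_tower (G : ℕ → ℝ) (T k : ℕ) {u : M.Param × E d → ℝ≥0∞}
    (hu : Measurable u) :
    ∫⁻ ω, (if ω ∈ tame M G T (k + 1) then u ((ω T).1, (ω (T + k + 1)).2) else 1) ∂Q.law γ₀ x₀
      = ∫⁻ ω, (∫⁻ y, (if ω ∈ tame M G T (k + 1) then u ((ω T).1, y) else 1)
            ∂M.kernel ((ω (T + k + 1)).1, (ω (T + k)).2)) ∂Q.law γ₀ x₀ := by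
  have hT : T ∈ Finset.Iic (T + k) := Finset.mem_Iic.2 (Nat.le_add_right T k)
  have hv : Measurable fun p : (((_ : Finset.Iic (T + k)) → M.Param × E d) × M.Param) × E d =>
      u ((p.1.1 ⟨T, hT⟩).1, p.2) := by
    have h1 : Measurable fun p : (((_ : Finset.Iic (T + k)) → M.Param × E d) × M.Param) × E d =>
        (p.1.1 ⟨T, hT⟩).1 :=
      measurable_fst.comp ((measurable_pi_apply _).comp (measurable_fst.comp measurable_fst))
    exact hu.comp (h1.prodMk measurable_snd)
  have hF : Measurable fun p : (((_ : Finset.Iic (T + k)) → M.Param × E d) × M.Param) × E d =>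
      if p.1 ∈ tameHist M G T k then u ((p.1.1 ⟨T, hT⟩).1, p.2) else 1 :=
    Measurable.ite (measurable_fst (measurableSet_tameHist G T k)) hv measurable_const
  have key := Q.lintegral_law_tower γ₀ x₀ hF
  simp only [mem_tameHist_iff] at key
  exact key

-- On the good event the current parameter is within (k+1)G(T) of the frozen one and the Lipschitz
-- bound applies. The value 1 off the event dominates every function bounded by one, so leaving the
-- event cannot break the inequality.
open Classical in
lemma lintegral_kernel_tame_le {C : ℝ} (hC : 0 < C)
    (hlip : ∀ (γ γ' : M.Param) (x : E d) (h : E d → ℝ≥0∞), Measurable h → (∀ z, h z ≤ 1) →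
      ∫⁻ y, h y ∂M.kernel (γ', x)
        ≤ (∫⁻ y, h y ∂M.kernel (γ, x)) + ENNReal.ofReal (C * frobNorm (γ'.1 - γ.1)))
    {G : ℕ → ℝ} (hG : Antitone G) (T k : ℕ)
    {u : M.Param × E d → ℝ≥0∞} (hu : Measurable u) (hu1 : ∀ p, u p ≤ 1)
    (ω : ℕ → M.Param × E d) :
    (if ω ∈ tame M G T k then
        ∫⁻ y, u ((ω T).1, y) ∂M.kernel ((ω T).1, (ω (T + k)).2) else 1)
      ≤ (∫⁻ y, (if ω ∈ tame M G T (k + 1) then u ((ω T).1, y) else 1)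
            ∂M.kernel ((ω (T + k + 1)).1, (ω (T + k)).2))
          + ENNReal.ofReal (C * ((k + 1 : ℕ) * G T)) := by
  have hum : Measurable fun y => u ((ω T).1, y) := hu.comp (by fun_prop)
  by_cases h : ω ∈ tame M G T (k + 1)
  · have h2 := frobNorm_sub_le_of_mem_tame hG h
    rw [frobNorm_sub_comm, ← add_assoc] at h2
    have h3 := hlip (ω (T + k + 1)).1 (ω T).1 (ω (T + k)).2 _ hum fun z => hu1 _
    have h4 := ENNReal.ofReal_le_ofReal (mul_le_mul_of_nonneg_left h2 hC.le)
    simp only [if_pos h, if_pos (tame_succ_subset G T k h)]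
    exact h3.trans (add_le_add_right h4 _)
  · simp only [h, if_false, lintegral_const, measure_univ, mul_one]
    refine le_trans ?_ (le_self_add)
    split_ifs
    · calc _ ≤ ∫⁻ _, 1 ∂M.kernel ((ω T).1, (ω (T + k)).2) :=
            lintegral_mono fun y => hu1 _
        _ = 1 := by simp
    · exact le_rfl

open Classical in
lemma lintegral_tame_step {C : ℝ} (hC : 0 < C)
    (hlip : ∀ (γ γ' : M.Param) (x : E d) (h : E d → ℝ≥0∞), Measurable h → (∀ z, h z ≤ 1) →
      ∫⁻ y, h y ∂M.kernel (γ', x)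
        ≤ (∫⁻ y, h y ∂M.kernel (γ, x)) + ENNReal.ofReal (C * frobNorm (γ'.1 - γ.1)))
    {G : ℕ → ℝ} (hG : Antitone G) (T k : ℕ)
    {u : M.Param × E d → ℝ≥0∞} (hu : Measurable u) (hu1 : ∀ p, u p ≤ 1) :
    ∫⁻ ω, (if ω ∈ tame M G T k then
        ∫⁻ y, u ((ω T).1, y) ∂M.kernel ((ω T).1, (ω (T + k)).2) else 1) ∂Q.law γ₀ x₀
      ≤ (∫⁻ ω, (if ω ∈ tame M G T (k + 1) then u ((ω T).1, (ω (T + k + 1)).2) else 1)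
          ∂Q.law γ₀ x₀) + ENNReal.ofReal (C * ((k + 1 : ℕ) * G T)) := by
  rw [Q.lintegral_tame_tower γ₀ x₀ G T k hu]
  refine (lintegral_mono fun ω => lintegral_kernel_tame_le hC hlip hG T k hu hu1 ω).trans ?_
  rw [lintegral_add_right _ measurable_const]
  simp

open Classical in
/-- The adaptive chain is compared with the chain whose tuning parameter is frozen at time `T`. -/
theorem _root_.AdaptiveRWM.Model.exists_adaptive_comparison (M : Model d) : ∃ C > (0 : ℝ),
    ∀ (Q : AdaptationPlan M) (γ₀ : M.Param) (x₀ : E d) (G : ℕ → ℝ), (∀ s, 0 < G s) → Antitone G →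
      ∀ (T t : ℕ) (f : E d → ℝ≥0∞), Measurable f → (∀ x, f x ≤ 1) →
        ∫⁻ ω, M.iter f t (ω T) ∂Q.law γ₀ x₀
          ≤ ∫⁻ x, f x ∂Q.marginal γ₀ x₀ (T + t) + ENNReal.ofReal (C * (t : ℝ) ^ 2 * G T)
            + Q.law γ₀ x₀ {ω | ∃ s, T ≤ s ∧ G s < increment s ω} := by
  obtain ⟨C, hC, hlip⟩ := M.exists_kernel_lipschitz
  refine ⟨C, hC, fun Q γ₀ x₀ G hG0 hG T t f hf hf1 => ?_⟩
  -- Interpolation by k adaptive steps followed by t - k frozen ones. Each exchange costs at most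
  -- CtG(T), because k + 1 ≤ t, and t exchanges give Ct²G(T).
  have hind : ∀ k ≤ t, ∫⁻ ω, M.iter f t (ω T) ∂Q.law γ₀ x₀
      ≤ (∫⁻ ω, (if ω ∈ tame M G T k then M.iter f (t - k) ((ω T).1, (ω (T + k)).2) else 1)
          ∂Q.law γ₀ x₀) + ENNReal.ofReal (C * (k * t * G T)) := by
    intro k
    induction k with
    | zero => intro _; simp [tame]
    | succ k ih =>
      intro hk
      refine (ih (by omega)).trans ?_
      have h := Q.lintegral_tame_step γ₀ x₀ hC hlip hG T k (M.measurable_iter hf (t - (k + 1)))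
        (M.iter_le_one hf1 (t - (k + 1)))
      have e : t - k = (t - (k + 1)) + 1 := by omega
      rw [e]
      refine (add_le_add_left h _).trans ?_
      rw [add_assoc, ← ENNReal.ofReal_add (by have := (hG0 T).le; positivity)
        (by have := (hG0 T).le; positivity)]
      refine add_le_add_right (ENNReal.ofReal_le_ofReal ?_) _
      have : ((k + 1 : ℕ) : ℝ) ≤ t := by exact_mod_cast hk
      have h2 := mul_le_mul_of_nonneg_right this (hG0 T).le
      have h3 := mul_le_mul_of_nonneg_left h2 hC.le
      push_cast at *
      nlinarith
  refine (hind t le_rfl).trans ?_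
  rw [Q.lintegral_marginal γ₀ x₀ hf, add_right_comm]
  have e : C * ((t : ℝ) * t * G T) = C * (t : ℝ) ^ 2 * G T := by ring
  rw [e]
  refine add_le_add_left ?_ _
  have hm := measurableSet_tame (M := M) G T t
  calc _ ≤ ∫⁻ ω, (f (ω (T + t)).2 + (tame M G T t)ᶜ.indicator 1 ω) ∂Q.law γ₀ x₀ := by
        refine lintegral_mono fun ω => ?_
        by_cases h : ω ∈ tame M G T t <;> simp [h, Model.iter]
    _ = ∫⁻ ω, f (ω (T + t)).2 ∂Q.law γ₀ x₀ + Q.law γ₀ x₀ (tame M G T t)ᶜ := by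
        rw [lintegral_add_right _ (measurable_one.indicator hm.compl),
          lintegral_indicator_one hm.compl]
    _ ≤ _ := by
        gcongr
        intro ω hω
        simp only [tame, mem_compl_iff, mem_ofPred_eq, not_forall, not_le] at hω
        obtain ⟨i, -, hi⟩ := hω
        exact ⟨T + i, Nat.le_add_right _ _, hi⟩

end AdaptationPlan

end AdaptiveRWM

/-! ### Wasserstein bounds from total variation and from tails -/

namespace AdaptiveRWM

variable {d : ℕ}

/-- The truncated distance, as a number in `[0, ∞]`. -/
lemma lintegral_cost_eq (ξ : Measure (E d × E d)) [IsFiniteMeasure ξ] :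
    ENNReal.ofReal (∫ p, min ‖p.1 - p.2‖ 1 ∂ξ)
      = ∫⁻ p, ENNReal.ofReal (min ‖p.1 - p.2‖ 1) ∂ξ := by
  refine ofReal_integral_eq_lintegral_ofReal ?_
    (ae_of_all _ fun p => le_min (norm_nonneg _) zero_le_one)
  refine Integrable.of_bound (C := 1) ?_ (ae_of_all _ fun p => ?_)
  · exact (((continuous_fst.sub continuous_snd).norm.min continuous_const)).aestronglyMeasurable
  · rw [Real.norm_of_nonneg (le_min (norm_nonneg _) zero_le_one)]
    exact min_le_right _ _

lemma isProbabilityMeasure_of_mem_couplings {μ ν : Measure (E d)} [IsProbabilityMeasure μ]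
    {ξ : Measure (E d × E d)} (hξ : ξ ∈ couplings μ ν) : IsProbabilityMeasure ξ := by
  refine ⟨?_⟩
  have := congrArg (fun μ => μ univ) hξ.1
  simpa [Measure.map_apply measurable_fst MeasurableSet.univ] using this

/-- A one-sided setwise bound controls the Wasserstein distance for the truncated distance. -/
theorem wasserstein_le_of_forall_le (μ ν : Measure (E d)) [IsProbabilityMeasure μ]
    [IsProbabilityMeasure ν] {δ : ℝ} (hδ : 0 ≤ δ)
    (h : ∀ A, MeasurableSet A → ν A ≤ μ A + ENNReal.ofReal δ) : wasserstein μ ν ≤ δ := by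
  obtain ⟨s, hs, hs1, hs2⟩ := hahn_decomposition (μ := ν) (ν := μ)
  -- By the Hahn decomposition this is the minimum of the two measures. The residuals α and β then
  -- have equal mass, and that mass is at most δ.
  set κ : Measure (E d) := μ.restrict s + ν.restrict sᶜ with hκ
  have hκμ : κ ≤ μ := by
    refine Measure.le_iff.2 fun t ht => ?_
    rw [hκ, Measure.add_apply, Measure.restrict_apply ht, Measure.restrict_apply ht,
      ← measure_inter_add_sdiff t hs, ← sdiff_eq]
    exact add_le_add_right (hs2 _ (ht.diff hs) fun x hx => hx.2) _
  have hκν : κ ≤ ν := by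
    refine Measure.le_iff.2 fun t ht => ?_
    rw [hκ, Measure.add_apply, Measure.restrict_apply ht, Measure.restrict_apply ht,
      ← measure_inter_add_sdiff t hs, ← sdiff_eq]
    exact add_le_add_left (hs1 _ (ht.inter hs) inter_subset_right) _
  have : IsFiniteMeasure κ := isFiniteMeasure_of_le μ hκμ
  obtain ⟨α, hα⟩ : ∃ α, κ + α = μ := ⟨μ - κ, by rw [add_comm, Measure.sub_add_cancel_of_le hκμ]⟩
  obtain ⟨β, hβ⟩ : ∃ β, κ + β = ν := ⟨ν - κ, by rw [add_comm, Measure.sub_add_cancel_of_le hκν]⟩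
  have hα1 : κ univ + α univ = 1 := by rw [← Measure.add_apply, hα, measure_univ]
  have hβ1 : κ univ + β univ = 1 := by rw [← Measure.add_apply, hβ, measure_univ]
  have hκt : κ univ ≠ ∞ := measure_ne_top κ univ
  have hαβ : α univ = β univ := (ENNReal.add_right_inj hκt).1 (hα1.trans hβ1.symm)
  have : IsFiniteMeasure α := isFiniteMeasure_of_le μ (hα ▸ Measure.le_add_left le_rfl)
  have : IsFiniteMeasure β := isFiniteMeasure_of_le ν (hβ ▸ Measure.le_add_left le_rfl)
  have hαδ : α univ ≤ ENNReal.ofReal δ := by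
    refine (ENNReal.add_le_add_iff_left hκt).1 ?_
    rw [hα1, hκ, Measure.add_apply, Measure.restrict_apply_univ, Measure.restrict_apply_univ,
      add_right_comm]
    calc (1 : ℝ≥0∞) = ν s + ν sᶜ := by rw [measure_add_measure_compl hs, measure_univ]
      _ ≤ _ := by gcongr; exact h s hs
  have hcancel : ∀ γ : Measure (E d), γ univ = α univ → (α univ)⁻¹ • (α univ • γ) = γ := by
    intro γ hγ
    by_cases h0 : α univ = 0
    · have : γ = 0 := Measure.measure_univ_eq_zero.1 (hγ.trans h0)
      simp [this]
    · rw [smul_smul, ENNReal.inv_mul_cancel h0 (measure_ne_top α univ), one_smul]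
  have hdiag : Measurable fun x : E d => (x, x) := measurable_id.prodMk measurable_id
  -- The maximal coupling: the common part sits on the diagonal at zero cost and the residuals are
  -- coupled independently at cost at most their mass. If that mass vanishes, the infinite factor
  -- multiplies the zero measure.
  set ξ : Measure (E d × E d) := κ.map (fun x => (x, x)) + (α univ)⁻¹ • α.prod β with hξ
  have hmem : ξ ∈ couplings μ ν := by
    constructor
    · rw [hξ, Measure.map_add _ _ measurable_fst, Measure.map_smul, Measure.map_map measurable_fst
        hdiag, Measure.map_fst_prod, ← hαβ, hcancel α rfl]
      exact (congrArg (· + α) Measure.map_id).trans hα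
    · rw [hξ, Measure.map_add _ _ measurable_snd, Measure.map_smul, Measure.map_map measurable_snd
        hdiag, Measure.map_snd_prod, hcancel β hαβ.symm]
      exact (congrArg (· + β) Measure.map_id).trans hβ
  have := isProbabilityMeasure_of_mem_couplings hmem
  have hcost : ∫ p, min ‖p.1 - p.2‖ 1 ∂ξ ≤ δ := by
    rw [← ENNReal.ofReal_le_ofReal_iff hδ, lintegral_cost_eq]
    have hc : Measurable fun p : E d × E d => ENNReal.ofReal (min ‖p.1 - p.2‖ 1) := by fun_prop
    rw [hξ, lintegral_add_measure, lintegral_smul_measure, lintegral_map hc hdiag]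
    simp only [sub_self, norm_zero, zero_le_one, min_eq_left, ENNReal.ofReal_zero, lintegral_zero,
      zero_add, smul_eq_mul]
    calc (α univ)⁻¹ * ∫⁻ p, ENNReal.ofReal (min ‖p.1 - p.2‖ 1) ∂α.prod β
        ≤ (α univ)⁻¹ * ∫⁻ _, 1 ∂α.prod β := by
          gcongr with p
          rw [← ENNReal.ofReal_one]
          exact ENNReal.ofReal_le_ofReal (min_le_right _ _)
      _ = (α univ)⁻¹ * α univ * α univ := by
          rw [lintegral_one, ← univ_prod_univ, Measure.prod_prod, ← hαβ, mul_assoc]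
      _ ≤ 1 * α univ := by gcongr; exact ENNReal.inv_mul_le_one _
      _ ≤ _ := by rw [one_mul]; exact hαδ
  have hbdd : BddBelow ((fun ξ : Measure (E d × E d) => ∫ p, min ‖p.1 - p.2‖ 1 ∂ξ) ''
      couplings μ ν) := by
    refine ⟨0, ?_⟩
    rintro _ ⟨ζ, -, rfl⟩
    exact integral_nonneg fun p => le_min (norm_nonneg _) zero_le_one
  exact (csInf_le hbdd ⟨ξ, hmem, rfl⟩).trans hcost

/-- A lower bound for the Wasserstein distance from a comparison of the tails. -/
theorem le_wasserstein_of_tail (μ ν : Measure (E d)) [IsProbabilityMeasure μ]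
    [IsProbabilityMeasure ν] {a r : ℝ}
    (h : ENNReal.ofReal a + μ {x | r < ‖x‖} ≤ ν {y | r + 1 ≤ ‖y‖}) : a ≤ wasserstein μ ν := by
  refine le_csInf (Set.Nonempty.image _ ⟨μ.prod ν, ?_⟩) ?_
  · constructor
    · rw [Measure.map_fst_prod, measure_univ, one_smul]
    · rw [Measure.map_snd_prod, measure_univ, one_smul]
  rintro _ ⟨ξ, hξ, rfl⟩
  have := isProbabilityMeasure_of_mem_couplings hξ
  have hpos : 0 ≤ ∫ p, min ‖p.1 - p.2‖ 1 ∂ξ :=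
    integral_nonneg fun p => le_min (norm_nonneg _) zero_le_one
  have hR : MeasurableSet {x : E d | r < ‖x‖} := measurableSet_lt measurable_const measurable_norm
  have hS : MeasurableSet {y : E d | r + 1 ≤ ‖y‖} :=
    measurableSet_le measurable_const measurable_norm
  change a ≤ ∫ p, min ‖p.1 - p.2‖ 1 ∂ξ
  rw [← ENNReal.ofReal_le_ofReal_iff hpos, lintegral_cost_eq]
  refine (ENNReal.add_le_add_iff_right (measure_ne_top μ {x | r < ‖x‖})).1 (h.trans ?_)
  rw [← hξ.1, ← hξ.2, Measure.map_apply measurable_fst hR, Measure.map_apply measurable_snd hS]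
  have hRm : MeasurableSet ((Prod.fst : E d × E d → E d) ⁻¹' {x | r < ‖x‖}) := measurable_fst hR
  have hSm : MeasurableSet ((Prod.snd : E d × E d → E d) ⁻¹' {y | r + 1 ≤ ‖y‖}) :=
    measurable_snd hS
  rw [← lintegral_indicator_one hSm, ← lintegral_indicator_one hRm,
    ← lintegral_add_right _ (measurable_one.indicator hRm)]
  -- Pointwise, if the second coordinate has norm at least r + 1, then either the first has norm
  -- above r or the two are at distance at least one.
  refine lintegral_mono fun p => ?_
  by_cases h1 : r < ‖p.1‖
  · rw [indicator_of_mem (s := Prod.fst ⁻¹' _) (show p ∈ Prod.fst ⁻¹' {x : E d | r < ‖x‖} from h1)]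
    exact (indicator_le_self' (fun _ _ => zero_le) p).trans le_add_self
  by_cases h2 : r + 1 ≤ ‖p.2‖
  · have h3 : 1 ≤ ‖p.1 - p.2‖ := by
      rw [norm_sub_rev]
      linarith [norm_sub_norm_le p.2 p.1]
    rw [min_eq_right h3, ENNReal.ofReal_one]
    exact (indicator_le_self' (fun _ _ => zero_le) p).trans le_self_add
  · rw [indicator_of_notMem (s := Prod.snd ⁻¹' _)
      (show p ∉ Prod.snd ⁻¹' {y : E d | r + 1 ≤ ‖y‖} from h2)]
    exact zero_le

end AdaptiveRWM

/-! ### The upper bound -/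

namespace AdaptiveRWM

variable {d : ℕ}

/-- Because G tends to zero, the defining set is nonempty and its infimum is attained. -/
lemma recip_invRecip_le {G : ℕ → ℝ} (hG0 : ∀ t, 0 < G t) (hG : Tendsto G atTop (𝓝 0)) (y : ℝ) :
    y ≤ 1 / G (invRecip G y) := by
  have hne : {s : ℕ | y ≤ 1 / G s}.Nonempty := by
    have h1 : Tendsto G atTop (𝓝[>] 0) :=
      tendsto_nhdsWithin_iff.2 ⟨hG, Eventually.of_forall hG0⟩
    have h2 := (tendsto_inv_nhdsGT_zero.comp h1).eventually_ge_atTop y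
    obtain ⟨s, hs⟩ := h2.exists
    exact ⟨s, by simpa using hs⟩
  exact Nat.sInf_mem hne

namespace AdaptationPlan

variable {M : Model d} (Q : AdaptationPlan M) (γ₀ : M.Param) (x₀ : E d)

/-- Diminishing adaptation: large increments of the tuning parameter after a late time are
unlikely. -/
lemma eventually_law_le {G : ℕ → ℝ} (hG0 : ∀ t, 0 < G t)
    (h : ∀ᵐ ω ∂(Q.law γ₀ x₀),
      Tendsto (fun t : ℕ => frobNorm ((ω (t + 1)).1.1 - (ω t).1.1) / G t) atTop (𝓝 0))
    {ε : ℝ≥0∞} (hε : 0 < ε) :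
    ∀ᶠ S : ℕ in atTop, Q.law γ₀ x₀ {ω | ∃ s, S ≤ s ∧ G s < increment s ω} ≤ ε := by
  set B : ℕ → Set (ℕ → M.Param × E d) := fun S => {ω | ∃ s, S ≤ s ∧ G s < increment s ω} with hB
  have hm : ∀ S, MeasurableSet (B S) := by
    intro S
    have : B S = ⋃ s, ⋃ (_ : S ≤ s), {ω | G s < increment s ω} := by
      ext ω; simp [hB]
    rw [this]
    exact MeasurableSet.iUnion fun s => MeasurableSet.iUnion fun _ =>
      measurableSet_lt measurable_const (measurable_increment s)
  have hanti : Antitone B := fun S S' hS ω ⟨s, hs, h⟩ => ⟨s, hS.trans hs, h⟩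
  have hlim := tendsto_measure_iInter_atTop (μ := Q.law γ₀ x₀)
    (fun S => (hm S).nullMeasurableSet) hanti ⟨0, measure_ne_top _ _⟩
  -- An outcome in every B S has infinitely many ratios above one, which contradicts the almost sure
  -- limit. Continuity from above then makes the probabilities vanish.
  have hnull : Q.law γ₀ x₀ (⋂ S, B S) = 0 := by
    refine measure_mono_null (t := {ω | ¬ Tendsto (fun t : ℕ =>
      frobNorm ((ω (t + 1)).1.1 - (ω t).1.1) / G t) atTop (𝓝 0)}) ?_ h
    intro ω hω ht
    obtain ⟨N, hN⟩ := eventually_atTop.1 (ht.eventually_lt_const zero_lt_one)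
    obtain ⟨s, hs, hs'⟩ := mem_iInter.1 hω N
    have := hN s hs
    rw [div_lt_one (hG0 s)] at this
    exact (lt_asymm this hs').elim
  rw [hnull] at hlim
  exact hlim.eventually_le_const hε

end AdaptationPlan

namespace Model

/-- Upper bound for the distance of the adaptive chain to the target. -/
theorem exists_wasserstein_le (M : Model d) {m : ℝ} (hm₀ : 0 < m) (hm₁ : m < 1)
    (hU : Regularity m M.U) :
    ∃ c > (0 : ℝ), ∃ J > (0 : ℝ), ∀ x₀ : E d, ∃ K > (0 : ℝ),
      ∀ (γ₀ : M.Param) (Q : AdaptationPlan M) (G : ℕ → ℝ),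
        (∀ t, 0 < G t) → Antitone G → Tendsto G atTop (𝓝 0) →
        (∀ᵐ ω ∂(Q.law γ₀ x₀), Tendsto (fun t : ℕ =>
          frobNorm ((ω (t + 1)).1.1 - (ω t).1.1) / G t) atTop (𝓝 0)) →
        ∀ ε : ℝ, 0 < ε → ∃ S : ℕ, ∀ t : ℕ,
          wasserstein (Q.marginal γ₀ x₀ (S + invRecip G (J * (t : ℝ) ^ 2 / ε) + t)) M.target
            ≤ K * ((S + invRecip G (J * (t : ℝ) ^ 2 / ε) : ℕ) : ℝ)
                * Real.exp (-c * (t : ℝ) ^ (m / (2 - m))) + ε := by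
  have hs : (0 : ℝ) < 1 / 16 := by norm_num
  obtain ⟨c, hc, C', hC', hconv⟩ := M.exists_frozen_convergence_target hm₀ hm₁ hU hs le_rfl
  obtain ⟨C, hC, hcomp⟩ := M.exists_adaptive_comparison
  obtain ⟨c₁, hc₁, B, hB, -, hdrift⟩ := M.exists_drift hm₀ hm₁ hU (s := 2 * (1 / 16))
    (by norm_num) (by norm_num)
  set V : E d → ℝ := M.lyap (2 * (1 / 16)) with hV
  have hV0 : ∀ x, 0 < V x := fun x => M.lyap_pos _ x
  have hVm : Measurable V := (M.continuous_lyap _).measurable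
  have := M.isProbabilityMeasure_target hm₀ hU
  -- The choice J = 2C turns the comparison error C t² G(T) into at most ε/2.
  refine ⟨c, hc, 2 * C, by positivity, fun x₀ => ⟨C' * (1 + V x₀ + B), by
    have := hV0 x₀; positivity, fun γ₀ Q G hG0 hG hGlim hdim ε hε => ?_⟩⟩
  have hmom : ∀ T : ℕ, ∫⁻ ω, ENNReal.ofReal (V (ω T).2) ∂Q.law γ₀ x₀
      ≤ ENNReal.ofReal (V x₀ + T * B) := by
    intro T
    have h1 := Q.lintegral_marginal_le γ₀ x₀ (f := fun x => ENNReal.ofReal (V x))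
      (hVm.ennreal_ofReal) (a := 1) (b := ENNReal.ofReal B) le_rfl (fun γ x => by
        refine (hdrift γ x).trans ?_
        rw [one_mul, ← ENNReal.ofReal_add (hV0 x).le hB.le]
        refine ENNReal.ofReal_le_ofReal ?_
        have : 0 ≤ c₁ * V x * (1 + ‖x‖) ^ (2 * (m - 1)) := by
          have := hV0 x
          positivity
        linarith) T
    rw [Q.lintegral_marginal γ₀ x₀ hVm.ennreal_ofReal, one_pow, one_mul] at h1
    refine h1.trans (le_of_eq ?_)
    rw [ENNReal.ofReal_add (hV0 x₀).le (by positivity), ENNReal.ofReal_mul (by positivity),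
      ENNReal.ofReal_natCast]
  -- Requiring S ≥ 1 makes T ≥ 1, so that the additive constants in 1 + V(x₀) + TB can be absorbed
  -- into a multiple of T.
  obtain ⟨S, hS1, hS⟩ := ((eventually_ge_atTop 1).and
    (Q.eventually_law_le γ₀ x₀ hG0 hdim (ENNReal.ofReal_pos.2 (half_pos hε)))).exists
  refine ⟨S, fun t => ?_⟩
  set T := S + invRecip G (2 * C * (t : ℝ) ^ 2 / ε) with hT
  have hT1 : (1 : ℝ) ≤ T := by exact_mod_cast (hS1.trans (Nat.le_add_right _ _))
  have hGT : C * (t : ℝ) ^ 2 * G T ≤ ε / 2 := by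
    have h1 := recip_invRecip_le hG0 hGlim (2 * C * (t : ℝ) ^ 2 / ε)
    have h2 : G T ≤ G (invRecip G (2 * C * (t : ℝ) ^ 2 / ε)) := hG (Nat.le_add_left _ _)
    have h3 := h1.trans (one_div_le_one_div_of_le (hG0 T) h2)
    rw [div_le_div_iff₀ hε (hG0 T)] at h3
    linarith
  set e := Real.exp (-c * (t : ℝ) ^ (m / (2 - m))) with he
  have he0 : 0 < e := Real.exp_pos _
  have hKT : C' * e * (1 + (V x₀ + T * B)) ≤ C' * (1 + V x₀ + B) * T * e := by
    have h1 : 1 + (V x₀ + T * B) ≤ (1 + V x₀ + B) * T := by nlinarith [hV0 x₀]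
    calc C' * e * (1 + (V x₀ + T * B)) ≤ C' * e * ((1 + V x₀ + B) * T) := by gcongr
      _ = _ := by ring
  refine wasserstein_le_of_forall_le _ _ (by have := hV0 x₀; positivity) fun A hA => ?_
  have hf : Measurable (A.indicator (1 : E d → ℝ≥0∞)) := measurable_one.indicator hA
  have hf1 : ∀ x, A.indicator (1 : E d → ℝ≥0∞) x ≤ 1 := fun x =>
    indicator_le_self' (fun _ _ => zero_le) x
  have h2 := hcomp Q γ₀ x₀ G hG0 hG T t _ hf hf1
  rw [lintegral_indicator_one hA] at h2
  have hVω : Measurable fun ω : ℕ → M.Param × E d => V (ω T).2 :=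
    hVm.comp (AdaptationPlan.measurable_state M T)
  have hbad : Q.law γ₀ x₀ {ω | ∃ s, T ≤ s ∧ G s < AdaptationPlan.increment s ω}
      ≤ ENNReal.ofReal (ε / 2) := by
    refine (measure_mono ?_).trans hS
    rintro ω ⟨s, hs, h⟩
    exact ⟨s, (Nat.le_add_right _ _).trans hs, h⟩
  calc M.target A = ∫⁻ _, M.target A ∂Q.law γ₀ x₀ := by simp
    _ ≤ ∫⁻ ω, (M.iter (A.indicator 1) t (ω T)
          + ENNReal.ofReal (C' * e) * (1 + ENNReal.ofReal (V (ω T).2))) ∂Q.law γ₀ x₀ := by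
        refine lintegral_mono fun ω => ?_
        have h1 := hconv (ω T).1 _ hf hf1 t (ω T).2
        rw [lintegral_indicator_one hA] at h1
        refine h1.trans (le_of_eq ?_)
        have h3 : (0 : ℝ) ≤ 1 + V (ω T).2 := by have := hV0 (ω T).2; positivity
        rw [ENNReal.ofReal_mul (by positivity), ENNReal.ofReal_add zero_le_one (hV0 _).le,
          ENNReal.ofReal_one]
    _ = ∫⁻ ω, M.iter (A.indicator 1) t (ω T) ∂Q.law γ₀ x₀
          + ENNReal.ofReal (C' * e) * (1 + ∫⁻ ω, ENNReal.ofReal (V (ω T).2) ∂Q.law γ₀ x₀) := by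
        have m1 : Measurable fun ω : ℕ → M.Param × E d => 1 + ENNReal.ofReal (V (ω T).2) :=
          measurable_const.add hVω.ennreal_ofReal
        rw [lintegral_add_right _ (m1.const_mul _), lintegral_const_mul _ m1,
          lintegral_add_left measurable_const]
        simp
    _ ≤ (Q.marginal γ₀ x₀ (T + t) A + ENNReal.ofReal (ε / 2) + ENNReal.ofReal (ε / 2))
          + ENNReal.ofReal (C' * e) * (1 + ENNReal.ofReal (V x₀ + T * B)) := by
        refine add_le_add (h2.trans ?_) ?_
        · exact add_le_add (add_le_add le_rfl (ENNReal.ofReal_le_ofReal hGT)) hbad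
        · gcongr
          exact hmom T
    _ = Q.marginal γ₀ x₀ (T + t) A
          + ENNReal.ofReal (C' * e * (1 + (V x₀ + T * B)) + ε) := by
        have h5 : 0 ≤ V x₀ + T * B := by have := hV0 x₀; positivity
        have h6 : ENNReal.ofReal (C' * e * (1 + (V x₀ + T * B)))
            = ENNReal.ofReal (C' * e) * (1 + ENNReal.ofReal (V x₀ + T * B)) := by
          rw [ENNReal.ofReal_mul (by positivity), ENNReal.ofReal_add zero_le_one h5,
            ENNReal.ofReal_one]
        rw [ENNReal.ofReal_add (by positivity) hε.le, h6, add_assoc (Q.marginal _ _ _ _),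
          ← ENNReal.ofReal_add (by positivity) (by positivity), add_halves, add_assoc,
          add_comm (ENNReal.ofReal ε)]
    _ ≤ _ := by gcongr

end Model

end AdaptiveRWM

/-! ### The lower bound -/

namespace AdaptiveRWM

variable {d : ℕ}

namespace Model

lemma exists_potential_le (M : Model d) {m R D : ℝ}
    (hD : 0 ≤ D) (hUD : ∀ x, R ≤ ‖x‖ → M.U x ≤ D * ‖x‖ ^ m) :
    ∃ C ≥ (0 : ℝ), ∀ x, M.U x ≤ C + D * ‖x‖ ^ m := by
  obtain ⟨C, hC⟩ := (isCompact_closedBall (0 : E d) R).exists_bound_of_continuousOn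
    M.continuous_U.continuousOn
  refine ⟨max C 0, le_max_right _ _, fun x => ?_⟩
  rcases le_total R ‖x‖ with h | h
  · linarith [hUD x h, le_max_right C 0]
  · have h1 := (le_abs_self _).trans (hC x (by simpa using h))
    have : 0 ≤ D * ‖x‖ ^ m := by positivity
    linarith [le_max_left C 0]

/-- A unit ball centred at distance r + 1 lies between radii r and r + 2. Subadditivity of the m-th
power bounds U on it by D(r^m + 2^m), and the ball's volume does not depend on r. -/
lemma exists_le_target_tail (hd : 0 < d) (M : Model d) {m : ℝ} (hm₀ : 0 < m) (hm₁ : m < 1)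
    (hU : Regularity m M.U) {R D : ℝ} (hR : 0 < R) (hD : 0 ≤ D)
    (hUD : ∀ x, R ≤ ‖x‖ → M.U x ≤ D * ‖x‖ ^ m) :
    ∃ p > (0 : ℝ), ∀ r ≥ R,
      ENNReal.ofReal (p * Real.exp (-(D * r ^ m))) ≤ M.target {y | r ≤ ‖y‖} := by
  set v : ℝ≥0∞ := (M.unnormalizedTarget univ)⁻¹ * volume (Metric.ball (0 : E d) 1) with hv
  have hv0 : v ≠ 0 := mul_ne_zero (ENNReal.inv_ne_zero.2 (M.unnormalizedTarget_univ_ne_top hm₀ hU))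
    (Metric.measure_ball_pos volume (0 : E d) one_pos).ne'
  have hvt : v ≠ ∞ := ENNReal.mul_ne_top
    (ENNReal.inv_ne_top.2 M.unnormalizedTarget_univ_ne_zero) measure_ball_lt_top.ne
  have hvr : 0 < v.toReal := ENNReal.toReal_pos hv0 hvt
  refine ⟨v.toReal * Real.exp (-(D * 2 ^ m)), by positivity, fun r hr => ?_⟩
  have hr0 : 0 < r := hR.trans_le hr
  set z : E d := (r + 1) • PiLp.single 2 (⟨0, hd⟩ : Fin d) (1 : ℝ) with hz
  have hzn : ‖z‖ = r + 1 := by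
    rw [hz, norm_smul, PiLp.norm_single, norm_one, mul_one,
      Real.norm_of_nonneg (by positivity)]
  have hball : ∀ y ∈ Metric.ball z 1, r ≤ ‖y‖ ∧ ‖y‖ ≤ r + 2 := by
    intro y hy
    rw [mem_ball_iff_norm] at hy
    have h1 := norm_sub_norm_le z y
    have h2 := norm_sub_norm_le y z
    rw [norm_sub_rev] at h1
    constructor <;> linarith
  have hBm : MeasurableSet (Metric.ball z 1) := measurableSet_ball
  refine le_trans ?_ (measure_mono (μ := M.target) fun y hy => (hball y hy).1)
  have hS : M.target (Metric.ball z 1) = (M.unnormalizedTarget univ)⁻¹ *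
      ∫⁻ y in Metric.ball z 1, ENNReal.ofReal (Real.exp (-M.U y)) := by
    rw [target, Measure.smul_apply, unnormalizedTarget, withDensity_apply _ hBm, smul_eq_mul]
  have hlow : ∀ y ∈ Metric.ball z 1,
      ENNReal.ofReal (Real.exp (-(D * 2 ^ m)) * Real.exp (-(D * r ^ m)))
        ≤ ENNReal.ofReal (Real.exp (-M.U y)) := by
    intro y hy
    obtain ⟨h1, h2⟩ := hball y hy
    rw [← Real.exp_add]
    refine ENNReal.ofReal_le_ofReal (Real.exp_le_exp.2 ?_)
    have h3 := hUD y (hr.trans h1)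
    have h4 : ‖y‖ ^ m ≤ r ^ m + 2 ^ m :=
      (Real.rpow_le_rpow (norm_nonneg _) h2 hm₀.le).trans
        (Real.rpow_add_le_add_rpow hr0.le (by norm_num) hm₀.le hm₁.le)
    nlinarith
  rw [hS]
  calc ENNReal.ofReal (v.toReal * Real.exp (-(D * 2 ^ m)) * Real.exp (-(D * r ^ m)))
      = (M.unnormalizedTarget univ)⁻¹ * (ENNReal.ofReal
          (Real.exp (-(D * 2 ^ m)) * Real.exp (-(D * r ^ m))) * volume (Metric.ball z 1)) := by
        rw [mul_assoc, ENNReal.ofReal_mul hvr.le, ENNReal.ofReal_toReal hvt, hv,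
          Measure.addHaar_ball_center volume z]
        ring
    _ ≤ _ := by
        gcongr
        rw [← setLIntegral_const]
        exact setLIntegral_mono' hBm hlow

/-- Exponential moments of the adaptive chain grow at most stretched exponentially. -/
lemma exists_moment_growth (M : Model d) {m : ℝ} (hm₀ : 0 < m) (hm₁ : m < 1)
    (hU : Regularity m M.U) {s : ℝ} (hs : 0 < s) :
    ∃ A > (0 : ℝ), ∃ B > (0 : ℝ), ∀ᶠ n : ℕ in atTop, ∀ (Q : AdaptationPlan M) (γ₀ : M.Param)
      (x₀ : E d), ∫⁻ x, ENNReal.ofReal (M.lyap s x) ∂Q.marginal γ₀ x₀ n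
        ≤ ENNReal.ofReal ((M.lyap s x₀ + B) * Real.exp (A * (n : ℝ) ^ (m / (2 - m)))) := by
  obtain ⟨R, hR, d₁, -, D, hD, _, _, _, _, _, _, _, _, _, _, hg⟩ := hU.growth
  obtain ⟨R', hR', C, hC, hgrow⟩ := M.exists_growth hm₀ hm₁ hU hs
  obtain ⟨C₀, hC₀, hUle⟩ := M.exists_potential_le hD.le fun x hx => (hg x hx).1.2
  have h2m : 0 < 2 - m := by linarith
  set β := m / (2 - m) with hβ
  have hβ0 : 0 < β := by positivity
  set L := √M.lamMax * M.rho with hL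
  have hL0 : 0 ≤ L := mul_nonneg (Real.sqrt_nonneg _) M.rho_pos.le
  set C₁ := C₀ + D * L ^ m with hC₁
  -- The summands pay, in turn, for the n-th power of the growth factor, for the factor n ≤
  -- exp(n^β/β), and for the size of V near the threshold radius.
  refine ⟨C + 1 / β + s * D, by positivity, Real.exp (s * C₁), Real.exp_pos _, ?_⟩
  have hlim : Tendsto (fun n : ℕ => (n : ℝ) ^ (1 / (2 - m))) atTop atTop :=
    (tendsto_rpow_atTop (by positivity)).comp tendsto_natCast_atTop_atTop
  filter_upwards [eventually_ge_atTop 1, hlim.eventually_ge_atTop R'] with n hn hnR Q γ₀ x₀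
  have hn0 : (0 : ℝ) < n := by exact_mod_cast hn
  -- The threshold balances two regimes: beyond radius q the growth factor 1 + Cq^(2(m-1)) compounds
  -- over n steps to exp(Cn^β), and within it one step leaves V of order exp(sDq^m), where q^m =
  -- n^β.
  set q := (n : ℝ) ^ (1 / (2 - m)) with hq
  set x := (n : ℝ) ^ β with hx
  have hq0 : 0 < q := hR'.trans_le hnR
  have hx0 : 0 < x := Real.rpow_pos_of_pos hn0 _
  have hqm : q ^ m = x := by
    rw [hq, ← Real.rpow_mul hn0.le, hx, hβ]; congr 1; ring
  have hqn : n * q ^ (2 * (m - 1)) = x := by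
    rw [hq, ← Real.rpow_mul hn0.le, hx, hβ]
    nth_rewrite 1 [← Real.rpow_one (n : ℝ)]
    rw [← Real.rpow_add hn0]
    congr 1
    field_simp
    ring
  set a : ℝ := 1 + C * q ^ (2 * (m - 1)) with ha
  have ha1 : 1 ≤ a := by
    have : 0 ≤ C * q ^ (2 * (m - 1)) := by positivity
    linarith
  set b : ℝ := Real.exp (s * (C₁ + D * x)) with hb
  have hb0 : 0 < b := Real.exp_pos _
  have hstep : ∀ (γ : M.Param) (y : E d), ∫⁻ z, ENNReal.ofReal (M.lyap s z) ∂M.kernel (γ, y)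
      ≤ ENNReal.ofReal a * ENNReal.ofReal (M.lyap s y) + ENNReal.ofReal b := by
    intro γ y
    rcases le_total q ‖y‖ with h | h
    · refine (hgrow γ y (hnR.trans h)).trans (le_trans ?_ le_self_add)
      rw [mul_comm, ← ENNReal.ofReal_mul (by positivity)]
      refine ENNReal.ofReal_le_ofReal ?_
      refine mul_le_mul_of_nonneg_right ?_ (M.lyap_pos s y).le
      rw [ha]
      gcongr 1 + C * ?_
      exact Real.rpow_le_rpow_of_nonpos hq0 h (by linarith)
    · refine le_trans ?_ le_add_self
      calc ∫⁻ z, ENNReal.ofReal (M.lyap s z) ∂M.kernel (γ, y)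
          ≤ ∫⁻ _, ENNReal.ofReal b ∂M.kernel (γ, y) := by
            refine lintegral_mono_ae ?_
            filter_upwards [M.ae_norm_sub_le_kernel γ y] with z hz
            refine ENNReal.ofReal_le_ofReal (Real.exp_le_exp.2 ?_)
            refine mul_le_mul_of_nonneg_left ?_ hs.le
            have h1 : ‖z‖ ≤ q + L := by
              have := norm_add_le (z - y) y
              rw [sub_add_cancel] at this
              linarith
            have h2 : ‖z‖ ^ m ≤ x + L ^ m := by
              rw [← hqm]
              exact (Real.rpow_le_rpow (norm_nonneg _) h1 hm₀.le).trans
                (Real.rpow_add_le_add_rpow hq0.le hL0 hm₀.le hm₁.le)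
            have h3 := mul_le_mul_of_nonneg_left h2 hD.le
            linarith [hUle z]
        _ = _ := by simp
  have hmom := Q.lintegral_marginal_le γ₀ x₀ (f := fun x => ENNReal.ofReal (M.lyap s x))
    (M.continuous_lyap s).measurable.ennreal_ofReal (by rwa [ENNReal.one_le_ofReal]) hstep n
  refine hmom.trans ?_
  have hV0 := M.lyap_pos s x₀
  rw [← ENNReal.ofReal_natCast, ← ENNReal.ofReal_mul hn0.le, ← ENNReal.ofReal_add hV0.le
    (by positivity), ← ENNReal.ofReal_pow (by positivity), ← ENNReal.ofReal_mul (by positivity)]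
  refine ENNReal.ofReal_le_ofReal ?_
  have h1 : a ^ n ≤ Real.exp (C * x) := by
    calc a ^ n ≤ Real.exp (C * q ^ (2 * (m - 1))) ^ n := by
          gcongr
          rw [ha, add_comm]
          exact Real.add_one_le_exp _
      _ = _ := by rw [← Real.exp_nat_mul, ← hqn]; congr 1; ring
  have h2 : (n : ℝ) ≤ Real.exp (1 / β * x) := by
    rw [← Real.log_le_iff_le_exp hn0]
    have := Real.log_le_rpow_div hn0.le hβ0
    rw [one_div_mul_eq_div]
    exact this
  have h3 : n * b ≤ Real.exp (s * C₁) * Real.exp (1 / β * x + s * D * x) := by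
    calc n * b ≤ Real.exp (1 / β * x) * b := by gcongr
      _ = _ := by rw [hb, ← Real.exp_add, ← Real.exp_add]; congr 1; ring
  have h4 : M.lyap s x₀ ≤ M.lyap s x₀ * Real.exp (1 / β * x + s * D * x) :=
    le_mul_of_one_le_right hV0.le (Real.one_le_exp (by positivity))
  calc a ^ n * (M.lyap s x₀ + n * b)
      ≤ Real.exp (C * x) * ((M.lyap s x₀ + Real.exp (s * C₁))
          * Real.exp (1 / β * x + s * D * x)) := by
        gcongr
        linarith
    _ = _ := by
        rw [mul_left_comm, ← Real.exp_add]
        congr 2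
        ring

/-- Lower bound for the distance of the adaptive chain to the target. -/
theorem exists_le_wasserstein (hd : 0 < d) (M : Model d) {m : ℝ} (hm₀ : 0 < m) (hm₁ : m < 1)
    (hU : Regularity m M.U) :
    ∃ c > (0 : ℝ), ∀ x₀ : E d, ∃ K > (0 : ℝ), ∀ (γ₀ : M.Param) (Q : AdaptationPlan M) (n : ℕ),
      K * Real.exp (-c * (n : ℝ) ^ (m / (2 - m)))
        ≤ wasserstein (Q.marginal γ₀ x₀ n) M.target := by
  obtain ⟨R, hR, d₁, hd₁, D, hD, _, _, _, _, _, _, _, _, _, _, hg⟩ := hU.growth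
  obtain ⟨p, hp, htail⟩ := M.exists_le_target_tail hd hm₀ hm₁ hU hR hD.le
    fun x hx => (hg x hx).1.2
  have := M.isProbabilityMeasure_target hm₀ hU
  -- With this exponent V is at least exp((D+1)r^m) beyond radius r, so Markov's inequality gains
  -- exp(-r^m) over the tail exp(-Dr^m) of the target.
  set s := (D + 1) / d₁ with hs
  have hs0 : 0 < s := by positivity
  obtain ⟨A, hA, B, hB, hmom⟩ := M.exists_moment_growth hm₀ hm₁ hU hs0
  have h2m : 0 < 2 - m := by linarith
  set β := m / (2 - m) with hβ
  have hβ0 : 0 < β := by positivity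
  set L := √M.lamMax * M.rho with hL
  have hL0 : 0 ≤ L := mul_nonneg (Real.sqrt_nonneg _) M.rho_pos.le
  -- At r = K n^(1/(2-m)) that gain is exp(-(A+1)n^β), which absorbs the moment growth exp(An^β) and
  -- leaves a factor exp(-n^β).
  set K := (A + 1) ^ (1 / m) with hK
  have hK0 : 0 < K := by positivity
  have hKm : K ^ m = A + 1 := by
    rw [hK, ← Real.rpow_mul (by positivity), one_div_mul_cancel hm₀.ne', Real.rpow_one]
  set c := D * K ^ m with hc
  refine ⟨c, by positivity, fun x₀ => ?_⟩
  have hV0 := M.lyap_pos s x₀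
  -- The target tail is needed at r + 1 instead of r, and (r+1)^m ≤ r^m + 1 costs the factor
  -- exp(-D).
  set p₁ := p * Real.exp (-D) with hp₁
  have hp₁0 : 0 < p₁ := by positivity
  have hlim : Tendsto (fun n : ℕ => K * (n : ℝ) ^ (1 / (2 - m))) atTop atTop :=
    ((tendsto_rpow_atTop (by positivity)).comp tendsto_natCast_atTop_atTop).const_mul_atTop hK0
  have hlim' : Tendsto (fun n : ℕ => (M.lyap s x₀ + B) * Real.exp (-((n : ℝ) ^ β))) atTop
      (𝓝 0) := by
    have h1 : Tendsto (fun n : ℕ => (n : ℝ) ^ β) atTop atTop :=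
      (tendsto_rpow_atTop hβ0).comp tendsto_natCast_atTop_atTop
    simpa using (Real.tendsto_exp_neg_atTop_nhds_zero.comp h1).const_mul (M.lyap s x₀ + B)
  obtain ⟨n₀, hn₀⟩ := eventually_atTop.1 (hmom.and ((hlim.eventually_ge_atTop R).and
    (hlim'.eventually_le_const (half_pos hp₁0))))
  set r₀ := max R (‖x₀‖ + n₀ * L + 1) with hr₀
  set p₀ := p * Real.exp (-(D * r₀ ^ m)) with hp₀
  have hp₀0 : 0 < p₀ := by positivity
  refine ⟨min (p₁ / 2) p₀, by positivity, fun γ₀ Q n => ?_⟩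
  set x := (n : ℝ) ^ β with hx
  have hx0 : 0 ≤ x := by positivity
  rcases le_total n₀ n with hn | hn
  · obtain ⟨h1, h2, h3⟩ := hn₀ n hn
    set r := K * (n : ℝ) ^ (1 / (2 - m)) with hr
    have hr0 : 0 < r := hR.trans_le h2
    have hrm : r ^ m = K ^ m * x := by
      rw [hr, Real.mul_rpow hK0.le (by positivity), ← Real.rpow_mul n.cast_nonneg, hx, hβ,
        one_div_mul_eq_div]
    refine (mul_le_mul_of_nonneg_right (min_le_left _ _) (Real.exp_pos _).le).trans ?_
    refine le_wasserstein_of_tail _ _ (r := r) ?_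
    have hmarkov : Q.marginal γ₀ x₀ n {y | r < ‖y‖}
        ≤ ENNReal.ofReal (p₁ / 2 * Real.exp (-c * x)) := by
      have hm1 := mul_meas_ge_le_lintegral (μ := Q.marginal γ₀ x₀ n)
        (M.continuous_lyap s).measurable.ennreal_ofReal
        (ENNReal.ofReal (Real.exp ((D + 1) * r ^ m)))
      have hsub : {y : E d | r < ‖y‖} ⊆ {y | ENNReal.ofReal (Real.exp ((D + 1) * r ^ m))
          ≤ ENNReal.ofReal (M.lyap s y)} := by
        intro y (hy : r < ‖y‖)
        refine ENNReal.ofReal_le_ofReal (Real.exp_le_exp.2 ?_)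
        have h4 := (hg y (h2.trans hy.le)).1.1
        have h5 : r ^ m ≤ ‖y‖ ^ m := Real.rpow_le_rpow hr0.le hy.le hm₀.le
        calc (D + 1) * r ^ m = s * (d₁ * r ^ m) := by rw [hs]; field_simp
          _ ≤ s * (d₁ * ‖y‖ ^ m) := by gcongr
          _ ≤ s * M.U y := by gcongr
      have hm2 := (mul_le_mul_right (measure_mono hsub) _).trans (hm1.trans (h1 Q γ₀ x₀))
      have hE : ENNReal.ofReal (Real.exp (-((D + 1) * r ^ m)))
          * ENNReal.ofReal (Real.exp ((D + 1) * r ^ m)) = 1 := by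
        rw [← ENNReal.ofReal_mul (Real.exp_pos _).le, ← Real.exp_add, neg_add_cancel,
          Real.exp_zero, ENNReal.ofReal_one]
      calc Q.marginal γ₀ x₀ n {y | r < ‖y‖}
          = ENNReal.ofReal (Real.exp (-((D + 1) * r ^ m))) *
            (ENNReal.ofReal (Real.exp ((D + 1) * r ^ m)) *
              Q.marginal γ₀ x₀ n {y | r < ‖y‖}) := by rw [← mul_assoc, hE, one_mul]
        _ ≤ ENNReal.ofReal (Real.exp (-((D + 1) * r ^ m))) *
            ENNReal.ofReal ((M.lyap s x₀ + B) * Real.exp (A * x)) := by gcongr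
        _ = ENNReal.ofReal ((M.lyap s x₀ + B) * Real.exp (-x) * Real.exp (-c * x)) := by
            rw [← ENNReal.ofReal_mul (Real.exp_pos _).le, mul_left_comm, ← Real.exp_add,
              mul_assoc (M.lyap s x₀ + B), ← Real.exp_add, hrm, hc, hKm]
            congr 3
            ring
        _ ≤ _ := by gcongr
    calc ENNReal.ofReal (p₁ / 2 * Real.exp (-c * x)) + Q.marginal γ₀ x₀ n {y | r < ‖y‖}
        ≤ ENNReal.ofReal (p₁ / 2 * Real.exp (-c * x))
          + ENNReal.ofReal (p₁ / 2 * Real.exp (-c * x)) := by gcongr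
      _ = ENNReal.ofReal (p₁ * Real.exp (-c * x)) := by
          rw [← ENNReal.ofReal_add (by positivity) (by positivity)]
          congr 1
          ring
      _ ≤ ENNReal.ofReal (p * Real.exp (-(D * (r + 1) ^ m))) := by
          refine ENNReal.ofReal_le_ofReal ?_
          rw [hp₁, mul_assoc, ← Real.exp_add]
          refine mul_le_mul_of_nonneg_left (Real.exp_le_exp.2 ?_) hp.le
          have h6 := Real.rpow_add_le_add_rpow hr0.le zero_le_one hm₀.le hm₁.le
          rw [Real.one_rpow, hrm] at h6
          have h7 := mul_le_mul_of_nonneg_left h6 hD.le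
          rw [hc]
          linarith
      _ ≤ _ := htail (r + 1) (by linarith)
  -- For n ≤ n₀ the chain stays in the ball of radius ‖x₀‖ + n₀L, so the target mass at least one
  -- unit farther out is a lower bound by itself.
  · have h1 : min (p₁ / 2) p₀ * Real.exp (-c * x) ≤ p₀ := by
      refine (mul_le_of_le_one_right (by positivity) ?_).trans (min_le_right _ _)
      refine Real.exp_le_one_iff.2 ?_
      have : 0 ≤ c * x := by positivity
      linarith
    refine h1.trans (le_wasserstein_of_tail _ _ (r := ‖x₀‖ + n₀ * L) ?_)
    have h2 : Q.marginal γ₀ x₀ n {y | ‖x₀‖ + n₀ * L < ‖y‖} = 0 := by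
      refine measure_mono_null ?_ (Q.ae_norm_le_marginal γ₀ x₀ n)
      intro y (hy : _ < ‖y‖) (h : ‖y‖ ≤ _)
      have h3 : (n : ℝ) * L ≤ n₀ * L := by gcongr
      linarith
    rw [h2, add_zero]
    refine (htail r₀ (le_max_left _ _)).trans (measure_mono fun y (hy : r₀ ≤ ‖y‖) => ?_)
    exact (le_max_right _ _).trans hy

end Model

end AdaptiveRWM

/-! ### Both bounds combined -/

theorem proposition6p2 {d : ℕ} (hd : 0 < d) (M : AdaptiveRWM.Model d) (m : ℝ) (hm₀ : 0 < m)
    (hm₁ : m < 1) (hU : AdaptiveRWM.Regularity m M.U) :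
    ∃ cLow > (0 : ℝ), ∃ cUp > (0 : ℝ), ∃ J > (0 : ℝ), ∀ x₀ : AdaptiveRWM.E d,
      ∃ MLow > (0 : ℝ), ∃ MUp > (0 : ℝ),
        ∀ (γ₀ : M.Param) (Q : AdaptiveRWM.AdaptationPlan M) (G : ℕ → ℝ),
          (∀ t, 0 < G t) → StrictAnti G → Tendsto G atTop (𝓝 0) →
          (∀ᵐ ω ∂(Q.law γ₀ x₀),
            Tendsto (fun t : ℕ =>
              AdaptiveRWM.frobNorm ((ω (t + 1)).1.1 - (ω t).1.1) / G t) atTop (𝓝 0)) →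
          ∀ ε : ℝ, 0 < ε → ε < 1 → ∃ S : ℕ, ∀ t T : ℕ,
            T = S + AdaptiveRWM.invRecip G (J * (t : ℝ) ^ 2 / ε) →
              MLow * Real.exp (-cLow * ((T + t : ℕ) : ℝ) ^ (m / (2 - m)))
                  ≤ AdaptiveRWM.wasserstein (Q.marginal γ₀ x₀ (T + t)) M.target ∧
              AdaptiveRWM.wasserstein (Q.marginal γ₀ x₀ (T + t)) M.target
                  ≤ MUp * (T : ℝ) * Real.exp (-cUp * (t : ℝ) ^ (m / (2 - m))) + ε := by
  obtain ⟨cLow, hcLow, hlow⟩ := M.exists_le_wasserstein hd hm₀ hm₁ hU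
  obtain ⟨cUp, hcUp, J, hJ, hup⟩ := M.exists_wasserstein_le hm₀ hm₁ hU
  refine ⟨cLow, hcLow, cUp, hcUp, J, hJ, fun x₀ => ?_⟩
  obtain ⟨MLow, hMLow, hlow⟩ := hlow x₀
  obtain ⟨MUp, hMUp, hup⟩ := hup x₀
  refine ⟨MLow, hMLow, MUp, hMUp, fun γ₀ Q G hG0 hG hGlim hdim ε hε _ => ?_⟩
  obtain ⟨S, hS⟩ := hup γ₀ Q G hG0 hG.antitone hGlim hdim ε hε
  refine ⟨S, fun t T hT => ?_⟩
  subst hT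
  exact ⟨hlow γ₀ Q _, hS t⟩
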